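/- Let $k\ge 1$ and let $\Lambda$ be a $k$-graph: a countable small category, with degree functor $d:\Lambda\to\mathbb N^k$ such that whenever $d(\lambda)=m+n$ there is a unique pair $(\mu,\nu)$ with $\lambda=\mu\nu$, $d(\mu)=m$, $d(\nu)=n$. Write $r,s$ for range and source, identify objects with identity morphisms ($\Lambda^0$), put $v\Lambda^{n}=\{\lambda: r(\lambda)=v,\ d(\lambda)=n\}$, and let $v\Lambda^{\le n}$ be the set of $\lambda$ with $r(\lambda)=v$, $d(\lambda)\le n$ such that no proper extension $\lambda\mu\ne\lambda$ satisfies $d(\lambda\mu)\le n$. Assume that $\Lambda$ is row-finite (each $v\Lambda^{e_i}$ is finite) and locally convex (if $i<j$, $\mu\in v\Lambda^{e_i}$ and $\nu\in v\Lambda^{e_j}$, then $s(\mu)\Lambda^{e_j}\ne\emptyset$ and $s(\nu)\Lambda^{e_i}\neq\emptyset$). **Algebras.** $\mathcal O_\Lambda$ is the universal C*-algebra generated by $x_\lambda$ ($\lambda\in\Lambda$) subject to: the $x_v$ ($v\in\Lambda^0$) are mutually orthogonal projections; $x_\lambda^*x_\lambda=x_{s(\lambda)}$; $x_v=\sum_{\lambda\in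 v\Lambda^{e_i}}x_\lambda x_\lambda^*$ if $v\Lambda^{e_i}\ne\emptyset$; $x_\lambda x_\mu=x_{\lambda\mu}$ if $s(\lambda)=r(\mu)$. $\mathcal P_\Lambda$ is the universal C*-algebra generated by $a_\lambda$ ($\lambda\in\Lambda$) subject to: the $a_v$ are mutually orthogonal projections; $\sum_{\lambda\in v\Lambda^{\le m}}a_\lambda^*a_\lambda=a_v$ for all $v\in\Lambda^0$, $m\in\mathbb N^k$; $a_\mu a_\nu=a_{\nu\mu}$ if $s(\nu)=r(\mu)$. Let $\mathcal A_\Lambda=\overline{\operatorname{span}}\{a_\lambda\}\subset\mathcal P_\Lambda$, a closed non-self-adjoint subalgebra. **Categories.** A representation of $\mathcal O_\Lambda$ is a $*$-homomorphism $\pi:\mathcal O_\Lambda\to B(L)$, $L$ a Hilbert space, such that $\sum_v\pi(x_v)$ converges to $1$ strongly. An $\mathcal A_\Lambda$-module is a Hilbert space $H$ with a continuous homomorphism $\pi:\mathcal A_\Lambda\to B(H)$, where we write $A_\lambda=\pi(a_\lambda)$, such that each $A_v$ is an orthogonal projection, $\sum_{\lambda\in v\Lambda^{e_i}}A_\lambda^*A_\lambda=A_v$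 whenever $v\Lambda^{e_i}\neq\emptyset$, and $\sum_vA_v$ converges to $1$ weakly. Put $H_v=A_vH$. Morphisms in both cases are bounded linear intertwiners, and isomorphisms are taken in these categories. Let $U$ be the functor that turns a representation $L$ into the module on the same Hilbert space on which $a_\lambda$ acts by $\pi(x_\lambda)^*$. **The functor $\Pi$.** For a module $H$, let $\Pi(H)$ be the Hilbert space obtained by separation and completion from the formal sums of symbols $[\lambda,\xi]$ ($\lambda\in\Lambda$, $\xi\in H_{s(\lambda)}$, linear in $\xi$) for the inner product $$\langle[\lambda,\xi],[\mu,\eta]\rangle=\sum_{\lambda\nu=\mu\gamma\in r(\lambda)\Lambda^{\le d(\lambda)+d(\mu)}}\langle A_\nu\xi,A_\gamma\eta\rangle ,$$ with $x_\mu$ acting by $[\lambda,\xi]\mapsto[\mu\lambda,\xi]$ if $s(\mu)=r(\lambda)$ and $[\lambda,\xi]\mapsto0$ otherwise. On morphisms, $\Pi(\theta)[\lambda,\xi]=[\lambda,\theta\xi]$. This is a functor from $\mathcal A_\Lambda$-modules to representations of $\mathcal O_\Lambda$. A representation $L$ has finite Pythagorean dimension if $L\cong\Pi(K)$ for some finite-dimensional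 module $K$. **Submodules.** A submodule is a closed subspace invariant under all $A_\lambda$; it is itself a module. The trees at $v$ are the finite sets of paths obtained from $\{v\}$ by finitely many steps, each of which replaces an element $\mu$ of the set by the paths $\mu\alpha$, $\alpha\in s(\mu)\Lambda^{e_i}$, for some $i$ with $s(\mu)\Lambda^{e_i}\ne\emptyset$. A submodule $H'\subset H$ is complete if for all $\varepsilon>0$, $v\in\Lambda^0$, $\xi\in H_v$ there are a tree $t$ at $v$ and vectors $\eta_\mu\in H'$ ($\mu\in t$) with $\sum_{\mu\in t}\|A_\mu\xi-\eta_\mu\|^2<\varepsilon^2$. A residual subspace of $H$ is the orthogonal complement of a submodule, provided it contains no nonzero submodule. $H$ is full if it has no nonzero residual subspace. A module (representation) is irreducible if it is nonzero and its only submodules (closed invariant subspaces) are $0$ and the whole space. **Theorem.** Let $\mathrm{Mod}_{\rm full,fd}(\mathcal A_\Lambda)$ be the full subcategory of finite-dimensional full modules and $\mathrm{Rep}_{\rm Pfd}(\mathcal O_\Lambda)$ the full subcategory of representations of finite Pythagorean dimension. 1. $\Pi$ restricts to a functor $\Pi_{\rm full,fd}:\mathrm{Mod}_{\rm full,fd}(\mathcal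 A_\Lambda)\to\mathrm{Rep}_{\rm Pfd}(\mathcal O_\Lambda)$, which is essentially surjective and fully faithful. 2. For every $L$ in $\mathrm{Rep}_{\rm Pfd}(\mathcal O_\Lambda)$ the module $UL$ has a smallest complete submodule $\Sigma(L)$; it is finite dimensional and full, and every morphism $\theta:L\to L'$ in $\mathrm{Rep}_{\rm Pfd}(\mathcal O_\Lambda)$ maps $\Sigma(L)$ into $\Sigma(L')$. Hence $\Sigma$, with $\Sigma(\theta)=\theta|_{\Sigma(L)}$, is a functor $\mathrm{Rep}_{\rm Pfd}(\mathcal O_\Lambda)\to\mathrm{Mod}_{\rm full,fd}(\mathcal A_\Lambda)$; it is essentially surjective and fully faithful. 3. $\Pi_{\rm full,fd}$ and $\Sigma$ are mutually quasi-inverse: they form an equivalence of categories. 4. Both functors preserve irreducibility and isomorphism classes: for $H,K$ in $\mathrm{Mod}_{\rm full,fd}(\mathcal A_\Lambda)$ and $L,L'$ in $\mathrm{Rep}_{\rm Pfd}(\mathcal O_\Lambda)$, $H$ is irreducible if and only if $\Pi(H)$ is, $L$ is irreducible if and only if $\Sigma(L)$ is, $H\cong K$ if and only if $\Pi(H)\cong\Pi(K)$,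 and $L\cong L'$ if and only if $\Sigma(L)\cong\Sigma(L')$. -/

import Mathlib

universe u v

set_option linter.unusedSectionVars false

/-- A `k`-graph: a small countable category, presented through its set of arrows (paths) with
range, source, identity arrows and the partially defined composition, together with a degree
functor to `ℕ^k` that has the factorisation property. -/
structure KGraph (k : ℕ) where
  /-- the objects (vertices) -/
  Vertex : Type u
  /-- the arrows (paths) -/
  Path : Type u
  countable_path : Countable Path
  rng : Path → Vertex
  src : Path → Vertex
  /-- the identity arrow at a vertex -/
  vert : Vertex → Path
  /-- the composite `l ∘ m`, defined when the source of `l` is the range of `m` -/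
  comp : (l m : Path) → src l = rng m → Path
  rng_vert : ∀ v, rng (vert v) = v
  src_vert : ∀ v, src (vert v) = v
  rng_comp : ∀ l m h, rng (comp l m h) = rng l
  src_comp : ∀ l m h, src (comp l m h) = src m
  vert_comp : ∀ l h, comp (vert (rng l)) l h = l
  comp_vert : ∀ l h, comp l (vert (src l)) h = l
  comp_assoc : ∀ l m n (h₁ : src l = rng m) (h₂ : src m = rng n) h₃ h₄,
    comp (comp l m h₁) n h₃ = comp l (comp m n h₂) h₄
  deg : Path → (Fin k → ℕ)
  deg_vert : ∀ v, deg (vert v) = 0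
  deg_comp : ∀ l m h, deg (comp l m h) = deg l + deg m
  factorisation : ∀ (l : Path) (m n : Fin k → ℕ), deg l = m + n →
    ∃! p : Path × Path, ∃ h : src p.1 = rng p.2,
      comp p.1 p.2 h = l ∧ deg p.1 = m ∧ deg p.2 = n

namespace KGraph

variable {k : ℕ} (Λ : KGraph.{u} k)

/-- The standard basis vector `e_i` of `ℕ^k`. -/
def e (i : Fin k) : Fin k → ℕ := Pi.single i 1

/-- `Λ` is row-finite: every vertex is the range of finitely many edges. -/
class RowFinite : Prop where
  finite : ∀ v, {l : Λ.Path | Λ.rng l = v ∧ ∃ i, Λ.deg l = e i}.Finite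

/-- `Λ` is locally convex. -/
class LocallyConvex : Prop where
  nonempty : ∀ (i j : Fin k), i < j → ∀ (m n : Λ.Path), Λ.rng m = Λ.rng n →
    Λ.deg m = e i → Λ.deg n = e j →
    (∃ l, Λ.rng l = Λ.src m ∧ Λ.deg l = e j) ∧ (∃ l, Λ.rng l = Λ.src n ∧ Λ.deg l = e i)

open Classical in
/-- Composition of paths as a total operation; it is only meaningful, and only used, for
composable pairs (the value is irrelevant otherwise). -/
noncomputable def mul (l m : Λ.Path) : Λ.Path :=
  if h : Λ.src l = Λ.rng m then Λ.comp l m h else l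

/-- `v Λ^{≤ n}`: the paths `l` with range `v`, of degree at most `n`, and such that no strictly
larger path `l ∘ m` has degree at most `n`. -/
def pathsLE (v : Λ.Vertex) (n : Fin k → ℕ) : Set Λ.Path :=
  {l | Λ.rng l = v ∧ Λ.deg l ≤ n ∧
    ∀ m (h : Λ.src l = Λ.rng m), Λ.deg (Λ.comp l m h) ≤ n → Λ.comp l m h = l}

/-! ### Elementary facts on paths -/

section basic

variable {Λ}

theorem mul_eq {l m : Λ.Path} (h : Λ.src l = Λ.rng m) : Λ.mul l m = Λ.comp l m h := by
  simp [mul, h]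

theorem rng_mul (l m : Λ.Path) : Λ.rng (Λ.mul l m) = Λ.rng l := by
  unfold mul; split_ifs
  · exact Λ.rng_comp _ _ _
  · rfl

theorem src_mul {l m : Λ.Path} (h : Λ.src l = Λ.rng m) : Λ.src (Λ.mul l m) = Λ.src m := by
  rw [mul_eq h, Λ.src_comp]

theorem deg_mul {l m : Λ.Path} (h : Λ.src l = Λ.rng m) :
    Λ.deg (Λ.mul l m) = Λ.deg l + Λ.deg m := by
  rw [mul_eq h, Λ.deg_comp]

theorem mul_assoc' {l m n : Λ.Path} (h₁ : Λ.src l = Λ.rng m) (h₂ : Λ.src m = Λ.rng n) :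
    Λ.mul (Λ.mul l m) n = Λ.mul l (Λ.mul m n) := by
  rw [mul_eq (l := Λ.mul l m) (by rw [src_mul h₁, h₂]),
    mul_eq (m := Λ.mul m n) (by rw [rng_mul, h₁])]
  simp only [mul_eq h₁, mul_eq h₂]
  exact Λ.comp_assoc _ _ _ _ _ _ _

theorem vert_mul {v : Λ.Vertex} {l : Λ.Path} (h : v = Λ.rng l) : Λ.mul (Λ.vert v) l = l := by
  subst h
  rw [mul_eq (Λ.src_vert _), Λ.vert_comp]

theorem mul_vert {v : Λ.Vertex} {l : Λ.Path} (h : Λ.src l = v) : Λ.mul l (Λ.vert v) = l := by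
  subst h
  rw [mul_eq (Λ.rng_vert _).symm, Λ.comp_vert]

theorem exists_factor (l : Λ.Path) (m n : Fin k → ℕ) (h : Λ.deg l = m + n) :
    ∃ a b, Λ.src a = Λ.rng b ∧ Λ.mul a b = l ∧ Λ.deg a = m ∧ Λ.deg b = n := by
  obtain ⟨⟨a, b⟩, ⟨hc, h1, h2, h3⟩, -⟩ := Λ.factorisation l m n h
  exact ⟨a, b, hc, by rw [mul_eq hc, h1], h2, h3⟩

theorem factor_unique {a b a' b' : Λ.Path} (h : Λ.src a = Λ.rng b) (h' : Λ.src a' = Λ.rng b')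
    (e1 : Λ.mul a b = Λ.mul a' b') (e2 : Λ.deg a = Λ.deg a') : a = a' ∧ b = b' := by
  have e3 : Λ.deg b = Λ.deg b' := by
    have := congrArg Λ.deg e1
    rw [deg_mul h, deg_mul h', e2] at this
    exact add_left_cancel this
  obtain ⟨p, -, hu⟩ := Λ.factorisation (Λ.mul a b) (Λ.deg a) (Λ.deg b) (deg_mul h)
  have h1 := hu (a, b) ⟨h, (mul_eq h).symm, rfl, rfl⟩
  have h2 := hu (a', b') ⟨h', by rw [e1]; exact (mul_eq h').symm, e2.symm, e3.symm⟩
  have := h1.trans h2.symm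
  exact ⟨congrArg Prod.fst this, congrArg Prod.snd this⟩

theorem eq_vert_of_deg {l : Λ.Path} (h : Λ.deg l = 0) : l = Λ.vert (Λ.rng l) := by
  refine (factor_unique (a := l) (b := Λ.vert (Λ.src l)) (a' := Λ.vert (Λ.rng l)) (b' := l)
    (Λ.rng_vert _).symm (Λ.src_vert _) ?_ ?_).1
  · rw [mul_vert rfl, vert_mul rfl]
  · rw [h, Λ.deg_vert]

theorem mul_left_cancel' {l m m' : Λ.Path} (h : Λ.src l = Λ.rng m) (h' : Λ.src l = Λ.rng m')
    (e1 : Λ.mul l m = Λ.mul l m') : m = m' :=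
  (factor_unique h h' e1 rfl).2

theorem exists_factor_le (l : Λ.Path) (m : Fin k → ℕ) (h : m ≤ Λ.deg l) :
    ∃ a b, Λ.src a = Λ.rng b ∧ Λ.mul a b = l ∧ Λ.deg a = m := by
  obtain ⟨a, b, h1, h2, h3, -⟩ := exists_factor l m (Λ.deg l - m) (by
    rw [add_tsub_cancel_of_le h])
  exact ⟨a, b, h1, h2, h3⟩

theorem e_le_iff {i : Fin k} {n : Fin k → ℕ} : e i ≤ n ↔ 0 < n i := by
  constructor
  · intro h; have := h i; simp [e] at this; omega
  · intro h j
    by_cases hj : j = i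
    · subst hj; simp [e]; omega
    · simp [e, hj]

theorem e_self (i : Fin k) : (e i : Fin k → ℕ) i = 1 := by simp [e]

theorem e_ne {i j : Fin k} (h : j ≠ i) : (e i : Fin k → ℕ) j = 0 := by simp [e, h]

variable (Λ) in
/-- There is an edge of colour `i` with range `v`. -/
def HasEdge (v : Λ.Vertex) (i : Fin k) : Prop := ∃ l, Λ.rng l = v ∧ Λ.deg l = e i

theorem mem_pathsLE {v : Λ.Vertex} {n : Fin k → ℕ} {l : Λ.Path} :
    l ∈ Λ.pathsLE v n ↔ Λ.rng l = v ∧ Λ.deg l ≤ n ∧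
      ∀ i, Λ.deg l i < n i → ¬ Λ.HasEdge (Λ.src l) i := by
  refine ⟨fun ⟨h1, h2, h3⟩ => ⟨h1, h2, fun i hi => ?_⟩,
    fun ⟨h1, h2, h3⟩ => ⟨h1, h2, fun m hm hd => ?_⟩⟩
  · rintro ⟨m, hm1, hm2⟩
    have h4 := h3 m hm1.symm (by
      rw [Λ.deg_comp, hm2]
      intro j
      by_cases hj : j = i
      · subst hj; simp [e]; omega
      · simpa [e, hj] using h2 j)
    have h5 := congrArg (fun l => Λ.deg l i) h4
    simp [Λ.deg_comp, hm2, e] at h5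
  · rw [Λ.deg_comp] at hd
    by_cases h0 : Λ.deg m = 0
    · have := eq_vert_of_deg h0
      rw [← mul_eq hm, this]
      exact mul_vert hm
    · exfalso
      obtain ⟨i, hi⟩ := Function.ne_iff.1 h0
      simp only [Pi.zero_apply] at hi
      obtain ⟨a, b, hc, hab, ha⟩ := exists_factor_le m (e i) (e_le_iff.2 (by omega))
      refine h3 i ?_ ⟨a, ?_, ha⟩
      · have := hd i; simp at this; omega
      · rw [hm, ← hab, rng_mul]

theorem finite_deg [Λ.RowFinite] (v : Λ.Vertex) (n : Fin k → ℕ) :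
    {l : Λ.Path | Λ.rng l = v ∧ Λ.deg l = n}.Finite := by
  induction hN : ∑ i, n i generalizing n with
  | zero =>
    have hn : n = 0 := by
      funext i
      simpa using (Finset.sum_eq_zero_iff.1 hN) i (Finset.mem_univ i)
    refine (Set.finite_singleton (Λ.vert v)).subset ?_
    rintro l ⟨h1, h2⟩
    rw [Set.mem_singleton_iff, ← h1]
    exact eq_vert_of_deg (h2.trans hn)
  | succ N ih =>
    obtain ⟨i, hi⟩ : ∃ i, 0 < n i := by
      by_contra! hcon
      rw [Finset.sum_eq_zero (fun i _ => by simpa using hcon i)] at hN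
      omega
    have hle : e i ≤ n := e_le_iff.2 hi
    have hs : ∑ j, (n - e i) j = N := by
      have : ∑ j, (n - e i) j + ∑ j, (e i : Fin k → ℕ) j = ∑ j, n j := by
        rw [← Finset.sum_add_distrib]
        refine Finset.sum_congr rfl fun j _ => ?_
        exact Nat.sub_add_cancel (hle j)
      rw [hN] at this
      simp [e] at this
      exact this
    have hf := (ih (n - e i) hs).biUnion (t := fun l => (fun m => Λ.mul l m) ''
      {m : Λ.Path | Λ.rng m = Λ.src l ∧ ∃ i, Λ.deg m = e i}) fun l _ =>
        (RowFinite.finite (Λ := Λ) (Λ.src l)).image _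
    refine hf.subset ?_
    rintro l ⟨h1, h2⟩
    obtain ⟨a, b, hc, hab, ha, hb⟩ := exists_factor l (n - e i) (e i) (by
      rw [h2, tsub_add_cancel_of_le hle])
    simp only [Set.mem_iUnion]
    refine ⟨a, ⟨?_, ha⟩, b, ⟨hc.symm, i, hb⟩, hab⟩
    rw [← h1, ← hab, rng_mul]

theorem finite_pathsLE [Λ.RowFinite] (v : Λ.Vertex) (n : Fin k → ℕ) :
    (Λ.pathsLE v n).Finite := by
  have := (Set.finite_Iic n).biUnion (t := fun m => {l : Λ.Path | Λ.rng l = v ∧ Λ.deg l = m})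
    fun m _ => finite_deg v m
  refine this.subset ?_
  rintro l ⟨h1, h2, -⟩
  simp only [Set.mem_iUnion]
  exact ⟨Λ.deg l, h2, h1, rfl⟩

end basic

/-- `v Λ^{≤ n}` as a finite set. -/
noncomputable def le [Λ.RowFinite] (v : Λ.Vertex) (n : Fin k → ℕ) : Finset Λ.Path :=
  (finite_pathsLE v n).toFinset

/-- `v Λ^{e_i}`, the edges of colour `i` with range `v`, as a finite set. -/
noncomputable def edges [Λ.RowFinite] (v : Λ.Vertex) (i : Fin k) : Finset Λ.Path :=
  (finite_deg v (e i)).toFinset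

open Classical in
/-- The basic caret of colour `i` at `v`: the edges of colour `i` with range `v` if there are any,
and the trivial caret `{v}` otherwise. -/
noncomputable def caret [Λ.RowFinite] (v : Λ.Vertex) (i : Fin k) : Finset Λ.Path :=
  if (Λ.edges v i).Nonempty then Λ.edges v i else {Λ.vert v}

open Classical in
/-- The trees at `v`: `{v}` is a tree and if `t` is a tree and `m ∈ t` is a leaf, then replacing
`m` by `m ∘ a`, for `a` in a basic caret at the source of `m`, gives a tree. -/
inductive IsTree [Λ.RowFinite] (v : Λ.Vertex) : Finset Λ.Path → Prop
  | trivial : IsTree v {Λ.vert v}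
  | graft (t : Finset Λ.Path) (m : Λ.Path) (i : Fin k) : IsTree v t → m ∈ t →
      IsTree v (t.erase m ∪ (Λ.caret (Λ.src m) i).image (Λ.mul m))

section combinatorics

variable {Λ} [Λ.RowFinite]

theorem mem_le {v : Λ.Vertex} {n : Fin k → ℕ} {l : Λ.Path} :
    l ∈ Λ.le v n ↔ Λ.rng l = v ∧ Λ.deg l ≤ n ∧
      ∀ i, Λ.deg l i < n i → ¬ Λ.HasEdge (Λ.src l) i := by
  simp only [le, Set.Finite.mem_toFinset, mem_pathsLE]

theorem mem_edges {v : Λ.Vertex} {i : Fin k} {l : Λ.Path} :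
    l ∈ Λ.edges v i ↔ Λ.rng l = v ∧ Λ.deg l = e i := by
  simp [edges]

theorem edges_nonempty {v : Λ.Vertex} {i : Fin k} :
    (Λ.edges v i).Nonempty ↔ Λ.HasEdge v i := by
  simp [Finset.Nonempty, mem_edges, HasEdge]

theorem mem_caret {v : Λ.Vertex} {i : Fin k} {l : Λ.Path} :
    l ∈ Λ.caret v i ↔ Λ.rng l = v ∧
      (Λ.deg l = e i ∨ (¬ Λ.HasEdge v i ∧ l = Λ.vert v)) := by
  unfold caret
  split_ifs with h
  · rw [edges_nonempty] at h
    simp [mem_edges, h]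
  · rw [edges_nonempty] at h
    rw [Finset.mem_singleton]
    constructor
    · rintro rfl
      exact ⟨Λ.rng_vert _, Or.inr ⟨h, rfl⟩⟩
    · rintro ⟨h1, h2 | h2⟩
      · exact absurd ⟨l, h1, h2⟩ h
      · exact h2.2

theorem rng_of_mem_caret {v : Λ.Vertex} {i : Fin k} {l : Λ.Path} (h : l ∈ Λ.caret v i) :
    Λ.rng l = v := (mem_caret.1 h).1

theorem mem_le_zero {v : Λ.Vertex} {l : Λ.Path} : l ∈ Λ.le v 0 ↔ l = Λ.vert v := by
  rw [mem_le]
  constructor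
  · rintro ⟨h1, h2, -⟩
    rw [← h1]
    exact eq_vert_of_deg (le_antisymm h2 (fun i => Nat.zero_le _))
  · rintro rfl
    refine ⟨Λ.rng_vert _, by rw [Λ.deg_vert], fun i hi => by simp at hi⟩

theorem le_zero (v : Λ.Vertex) : Λ.le v 0 = {Λ.vert v} := by
  ext l; rw [mem_le_zero, Finset.mem_singleton]

theorem self_mem_le (l : Λ.Path) : l ∈ Λ.le (Λ.rng l) (Λ.deg l) :=
  mem_le.2 ⟨rfl, le_rfl, fun _ hi => absurd hi (lt_irrefl _)⟩

theorem mul_mem_le_iff {m l : Λ.Path} (h : Λ.src m = Λ.rng l) {n : Fin k → ℕ} :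
    Λ.mul m l ∈ Λ.le (Λ.rng m) (Λ.deg m + n) ↔ l ∈ Λ.le (Λ.src m) n := by
  rw [mem_le, mem_le, rng_mul, deg_mul h, src_mul h]
  simp [h]

theorem mul_mem_le {v : Λ.Vertex} {n : Fin k → ℕ} {i : Fin k} {t a : Λ.Path}
    (ht : t ∈ Λ.le v n) (ha : a ∈ Λ.caret (Λ.src t) i) : Λ.mul t a ∈ Λ.le v (n + e i) := by
  obtain ⟨h1, h2, h3⟩ := mem_le.1 ht
  obtain ⟨h4, h5⟩ := mem_caret.1 ha
  rw [mem_le, rng_mul, deg_mul h4.symm, src_mul h4.symm]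
  rcases h5 with h5 | ⟨h5, rfl⟩
  · refine ⟨h1, by rw [h5]; exact add_le_add_left h2 _, fun j hj => ?_⟩
    rw [h5] at hj
    have hj' : Λ.deg t j < n j := by simpa using hj
    have h6 := h3 j hj'
    rintro ⟨b, hb1, hb2⟩
    obtain ⟨c, d, hcd, hcd', hc, -⟩ := exists_factor (Λ.mul a b) (e j) (e i) (by
      rw [deg_mul hb1.symm, h5, hb2, add_comm])
    refine h6 ⟨c, ?_, hc⟩
    rw [← h4, ← rng_mul a b, ← hcd', rng_mul]
  · rw [Λ.deg_vert, Λ.src_vert]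
    refine ⟨h1, by rw [add_zero]; exact h2.trans (by simp), fun j hj => ?_⟩
    by_cases hji : j = i
    · subst hji; exact h5
    · apply h3
      simpa [e, hji] using hj

theorem deg_of_hasEdge {v : Λ.Vertex} {n : Fin k → ℕ} {i : Fin k} {t : Λ.Path}
    (ht : t ∈ Λ.le v n) (h : Λ.HasEdge (Λ.src t) i) : Λ.deg t i = n i := by
  obtain ⟨h1, h2, h3⟩ := mem_le.1 ht
  exact le_antisymm (h2 i) (not_lt.1 fun h4 => h3 i h4 h)

theorem mul_inj {v : Λ.Vertex} {n : Fin k → ℕ} {i : Fin k} {t a t' a' : Λ.Path}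
    (ht : t ∈ Λ.le v n) (ha : a ∈ Λ.caret (Λ.src t) i)
    (ht' : t' ∈ Λ.le v n) (ha' : a' ∈ Λ.caret (Λ.src t') i)
    (h : Λ.mul t a = Λ.mul t' a') : t = t' ∧ a = a' := by
  obtain ⟨h4, h5⟩ := mem_caret.1 ha
  obtain ⟨h4', h5'⟩ := mem_caret.1 ha'
  have key : Λ.deg a = Λ.deg a' := by
    have hd := congrArg (fun l => Λ.deg l i) h
    simp only [deg_mul h4.symm, deg_mul h4'.symm, Pi.add_apply] at hd
    have hl : Λ.deg t i ≤ n i := (mem_le.1 ht).2.1 i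
    have hl' : Λ.deg t' i ≤ n i := (mem_le.1 ht').2.1 i
    rcases h5 with h5 | ⟨h5, rfl⟩ <;> rcases h5' with h5' | ⟨h5', rfl⟩
    · rw [h5, h5']
    · have := deg_of_hasEdge ht ⟨a, h4, h5⟩
      simp [h5, e, Λ.deg_vert] at hd
      omega
    · have := deg_of_hasEdge ht' ⟨a', h4', h5'⟩
      simp [h5', e, Λ.deg_vert] at hd
      omega
    · rw [Λ.deg_vert, Λ.deg_vert]
  refine factor_unique h4.symm h4'.symm h ?_
  have hd := congrArg Λ.deg h
  rw [deg_mul h4.symm, deg_mul h4'.symm, key] at hd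
  exact add_right_cancel hd

variable [Λ.LocallyConvex]

theorem hasEdge_src {i j : Fin k} (hij : i ≠ j) {a : Λ.Path} (ha : Λ.deg a = e i)
    (h : Λ.HasEdge (Λ.rng a) j) : Λ.HasEdge (Λ.src a) j := by
  obtain ⟨b, hb1, hb2⟩ := h
  rcases lt_or_gt_of_ne hij with hlt | hlt
  · exact (LocallyConvex.nonempty i j hlt a b hb1.symm ha hb2).1
  · exact (LocallyConvex.nonempty j i hlt b a hb1 hb2 ha).2

theorem exists_of_mem_le {v : Λ.Vertex} {n : Fin k → ℕ} {i : Fin k} {l : Λ.Path}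
    (hl : l ∈ Λ.le v (n + e i)) :
    ∃ t ∈ Λ.le v n, ∃ a ∈ Λ.caret (Λ.src t) i, Λ.mul t a = l := by
  obtain ⟨h1, h2, h3⟩ := mem_le.1 hl
  by_cases hi : Λ.deg l i = n i + 1
  · obtain ⟨t, a, hc, hta, ht, ha⟩ := exists_factor l (Λ.deg l - e i) (e i) (by
      rw [tsub_add_cancel_of_le (e_le_iff.2 (by omega))])
    refine ⟨t, ?_, a, mem_caret.2 ⟨hc.symm, Or.inl ha⟩, hta⟩
    have hdt : ∀ j, Λ.deg t j = Λ.deg l j - (e i : Fin k → ℕ) j := fun j => by rw [ht]; rfl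
    refine mem_le.2 ⟨by rw [← h1, ← hta, rng_mul], fun j => ?_, fun j hj => ?_⟩
    · have h2j : Λ.deg l j ≤ n j + (e i : Fin k → ℕ) j := h2 j
      change Λ.deg t j ≤ n j
      rw [hdt]
      omega
    · rw [hdt] at hj
      have hji : j ≠ i := by
        rintro rfl
        rw [e_self] at hj; omega
      rw [e_ne hji] at hj
      intro hE
      rw [hc] at hE
      refine h3 j (by simp [e_ne hji]; omega) ?_
      rw [← hta, src_mul hc]
      exact hasEdge_src hji.symm ha hE
  · have h2i : Λ.deg l i ≤ n i + (e i : Fin k → ℕ) i := h2 i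
    rw [e_self] at h2i
    have h6 : ¬ Λ.HasEdge (Λ.src l) i := h3 i (by simp [e_self]; omega)
    refine ⟨l, mem_le.2 ⟨h1, fun j => ?_, fun j hj => ?_⟩, Λ.vert (Λ.src l),
      mem_caret.2 ⟨Λ.rng_vert _, Or.inr ⟨h6, rfl⟩⟩, mul_vert rfl⟩
    · by_cases hji : j = i
      · subst hji
        change Λ.deg l j ≤ n j
        omega
      · simpa [e_ne hji] using h2 j
    · by_cases hji : j = i
      · subst hji; exact h6
      · exact h3 j (by simpa [e_ne hji] using hj)

theorem sum_le_add {M : Type*} [AddCommMonoid M] (v : Λ.Vertex) (n : Fin k → ℕ) (i : Fin k)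
    (F : Λ.Path → M) :
    ∑ l ∈ Λ.le v (n + e i), F l = ∑ t ∈ Λ.le v n, ∑ a ∈ Λ.caret (Λ.src t) i, F (Λ.mul t a) := by
  rw [Finset.sum_sigma']
  symm
  refine Finset.sum_bij (fun p _ => Λ.mul p.1 p.2) ?_ ?_ ?_ ?_
  · rintro ⟨t, a⟩ h
    rw [Finset.mem_sigma] at h
    exact mul_mem_le h.1 h.2
  · rintro ⟨t, a⟩ h ⟨t', a'⟩ h' heq
    rw [Finset.mem_sigma] at h h'
    obtain ⟨rfl, rfl⟩ := mul_inj h.1 h.2 h'.1 h'.2 heq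
    rfl
  · intro l hl
    obtain ⟨t, ht, a, ha, h⟩ := exists_of_mem_le hl
    exact ⟨⟨t, a⟩, Finset.mem_sigma.2 ⟨ht, ha⟩, h⟩
  · intros; rfl

/-- Induction over `ℕ^k` above a base point. -/
theorem nk_induction {n₀ : Fin k → ℕ} {p : (Fin k → ℕ) → Prop} (h0 : p n₀)
    (hs : ∀ n i, n₀ ≤ n → p n → p (n + e i)) (n : Fin k → ℕ) (hn : n₀ ≤ n) : p n := by
  induction hN : ∑ i, (n - n₀) i generalizing n with
  | zero =>
    have : n = n₀ := by
      funext i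
      have h1 := (Finset.sum_eq_zero_iff.1 hN) i (Finset.mem_univ i)
      have h2 : n₀ i ≤ n i := hn i
      simp at h1
      omega
    rw [this]; exact h0
  | succ N ih =>
    obtain ⟨i, hi⟩ : ∃ i, 0 < (n - n₀) i := by
      by_contra! hcon
      rw [Finset.sum_eq_zero (fun i _ => by simpa using hcon i)] at hN
      omega
    have hi' : n₀ i < n i := by simpa using hi
    have hle : e i ≤ n := e_le_iff.2 (by omega)
    have hle' : n₀ ≤ n - e i := by
      intro j
      have := hn j
      by_cases hj : j = i
      · subst hj; simp [e_self]; omega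
      · simpa [e_ne hj] using this
    have hs' : ∑ j, (n - e i - n₀) j = N := by
      have : ∑ j, (n - e i - n₀) j + ∑ j, (e i : Fin k → ℕ) j = ∑ j, (n - n₀) j := by
        rw [← Finset.sum_add_distrib]
        refine Finset.sum_congr rfl fun j _ => ?_
        have h1 : n₀ j ≤ n j - (e i : Fin k → ℕ) j := hle' j
        have h2 : (e i : Fin k → ℕ) j ≤ n j := hle j
        simp only [Pi.sub_apply]
        omega
      rw [hN] at this
      simp [e] at this
      exact this
    have := hs (n - e i) i hle' (ih _ hle' hs')
    rwa [tsub_add_cancel_of_le hle] at this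

theorem hasEdge_of_deg_zero {i : Fin k} (t : Λ.Path) (hd : Λ.deg t i = 0)
    (h : Λ.HasEdge (Λ.rng t) i) : Λ.HasEdge (Λ.src t) i := by
  suffices H : ∀ n : Fin k → ℕ, 0 ≤ n → ∀ t : Λ.Path, Λ.deg t = n → Λ.deg t i = 0 →
      Λ.HasEdge (Λ.rng t) i → Λ.HasEdge (Λ.src t) i from
    H (Λ.deg t) (fun _ => Nat.zero_le _) t rfl hd h
  refine nk_induction ?_ ?_
  · intro t ht _ hE
    rw [eq_vert_of_deg ht] at hE ⊢
    rw [Λ.rng_vert] at hE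
    rwa [Λ.src_vert]
  · intro n j _ ih t ht h0 hE
    obtain ⟨a, b, hc, rfl, ha, hb⟩ := exists_factor t n (e j) ht
    rw [deg_mul hc] at h0
    simp only [Pi.add_apply] at h0
    have hji : j ≠ i := by
      rintro rfl
      rw [hb, e_self] at h0; omega
    rw [rng_mul] at hE
    rw [src_mul hc]
    have := ih a ha (by omega) hE
    rw [hc] at this
    exact hasEdge_src hji hb this

theorem deg_pos_of_mem_le {v : Λ.Vertex} {n : Fin k → ℕ} {i : Fin k} {t : Λ.Path}
    (ht : t ∈ Λ.le v n) (hn : 0 < n i) (h : Λ.HasEdge v i) : 0 < Λ.deg t i := by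
  obtain ⟨h1, h2, h3⟩ := mem_le.1 ht
  by_contra h0
  have h0' : Λ.deg t i = 0 := by omega
  exact h3 i (by omega) (hasEdge_of_deg_zero t h0' (by rw [h1]; exact h))

end combinatorics

end KGraph

section OpProd
open scoped ENNReal

/-- The C*-algebra of all bounded families of operators `(T_i)`, `T_i ∈ B(H i)`, with pointwise
operations and the supremum norm. -/
def OpProd {ι : Type v} (H : ι → Type u) [∀ i, NormedAddCommGroup (H i)]
    [∀ i, InnerProductSpace ℂ (H i)] [∀ i, CompleteSpace (H i)] : Type (max u v) :=
  lp (fun i => (H i →L[ℂ] H i)) ∞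

namespace OpProd

variable {ι : Type v} (H : ι → Type u) [∀ i, NormedAddCommGroup (H i)]
    [∀ i, InnerProductSpace ℂ (H i)] [∀ i, CompleteSpace (H i)]

noncomputable instance : NonUnitalCStarAlgebra (OpProd H) where
  toNonUnitalNormedRing := inferInstanceAs (NonUnitalNormedRing (lp (fun i => (H i →L[ℂ] H i)) ∞))
  toStarRing := inferInstanceAs (StarRing (lp (fun i => (H i →L[ℂ] H i)) ∞))
  toCompleteSpace := inferInstanceAs (CompleteSpace (lp (fun i => (H i →L[ℂ] H i)) ∞))
  toCStarRing := inferInstanceAs (CStarRing (lp (fun i => (H i →L[ℂ] H i)) ∞))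
  toNormedSpace := inferInstanceAs (NormedSpace ℂ (lp (fun i => (H i →L[ℂ] H i)) ∞))
  toIsScalarTower := lp.infty_isScalarTower
  toSMulCommClass := lp.infty_smulCommClass
  toStarModule := inferInstanceAs (StarModule ℂ (lp (fun i => (H i →L[ℂ] H i)) ∞))

/-- The evaluation at an index. -/
noncomputable def eval (i : ι) : OpProd H →⋆ₙₐ[ℂ] (H i →L[ℂ] H i) where
  toFun f := f.1 i
  map_smul' _ _ := rfl
  map_zero' := rfl
  map_add' _ _ := rfl
  map_mul' _ _ := rfl
  map_star' _ := rfl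

theorem norm_eval_le (i : ι) (f : OpProd H) : ‖eval H i f‖ ≤ ‖f‖ :=
  lp.norm_apply_le_norm (E := fun i => (H i →L[ℂ] H i)) ENNReal.top_ne_zero f i

variable {H} in
theorem ext {f g : OpProd H} (h : ∀ i, eval H i f = eval H i g) : f = g :=
  Subtype.ext (funext h)

/-- The C*-subalgebra generated by a set. -/
noncomputable def gen (s : Set (OpProd H)) : NonUnitalStarSubalgebra ℂ (OpProd H) :=
  (NonUnitalStarAlgebra.adjoin ℂ s).topologicalClosure

noncomputable instance (s : Set (OpProd H)) : IsClosed (gen H s : Set (OpProd H)) :=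
  NonUnitalStarSubalgebra.isClosed_topologicalClosure _

variable {H} in
theorem gen_induction {s : Set (OpProd H)} {p : OpProd H → Prop} (hc : IsClosed {f | p f})
    (hs : ∀ f ∈ s, p f) (h0 : p 0) (ha : ∀ f g, p f → p g → p (f + g))
    (hm : ∀ f g, p f → p g → p (f * g)) (hsm : ∀ (c : ℂ) f, p f → p (c • f))
    (hst : ∀ f, p f → p (star f)) {f : OpProd H} (hf : f ∈ gen H s) : p f := by
  have hcl : f ∈ closure ((NonUnitalStarAlgebra.adjoin ℂ s : NonUnitalStarSubalgebra ℂ (OpProd H)) :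
      Set (OpProd H)) := hf
  refine closure_minimal (fun g hg => ?_) hc hcl
  induction hg using NonUnitalStarAlgebra.adjoin_induction with
  | mem g hg => exact hs g hg
  | add f g _ _ h h' => exact ha f g h h'
  | zero => exact h0
  | mul f g _ _ h h' => exact hm f g h h'
  | smul c f _ h => exact hsm c f h
  | star f _ h => exact hst f h

end OpProd
end OpProd

namespace KGraph
variable {k : ℕ} (Λ : KGraph.{u} k) [Λ.RowFinite]

/-! ### The universal C*-algebras and the non-self-adjoint algebra -/

section relations

variable {B : Type*} [NonUnitalRing B] [StarRing B]

/-- The defining relations of the generators `x_l` of `𝒪_Λ`. -/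
structure IsOFamily (X : Λ.Path → B) : Prop where
  proj : ∀ v, IsStarProjection (X (Λ.vert v))
  orth : ∀ v w, v ≠ w → X (Λ.vert v) * X (Λ.vert w) = 0
  star_mul_self : ∀ l, star (X l) * X l = X (Λ.vert (Λ.src l))
  sum : ∀ v i, (Λ.edges v i).Nonempty →
    X (Λ.vert v) = ∑ l ∈ Λ.edges v i, X l * star (X l)
  mul : ∀ l m (h : Λ.src l = Λ.rng m), X l * X m = X (Λ.comp l m h)

/-- The defining relations of the generators `a_l` of `𝒫_Λ`. -/
structure IsPFamily (A : Λ.Path → B) : Prop where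
  proj : ∀ v, IsStarProjection (A (Λ.vert v))
  orth : ∀ v w, v ≠ w → A (Λ.vert v) * A (Λ.vert w) = 0
  sum : ∀ v n, ∑ l ∈ Λ.le v n, star (A l) * A l = A (Λ.vert v)
  mul : ∀ l m (h : Λ.src m = Λ.rng l), A l * A m = A (Λ.comp m l h)

/-- The relations satisfied by the operators of an `𝒜_Λ`-module. -/
structure IsModFamily (A : Λ.Path → B) : Prop where
  proj : ∀ v, IsStarProjection (A (Λ.vert v))
  orth : ∀ v w, v ≠ w → A (Λ.vert v) * A (Λ.vert w) = 0
  sum : ∀ v i, (Λ.edges v i).Nonempty →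
    ∑ l ∈ Λ.edges v i, star (A l) * A l = A (Λ.vert v)
  mul : ∀ l m (h : Λ.src m = Λ.rng l), A l * A m = A (Λ.comp m l h)

variable {Λ} {A : Λ.Path → B}

theorem IsModFamily.mul' (hA : Λ.IsModFamily A) {l m : Λ.Path} (h : Λ.src m = Λ.rng l) :
    A (Λ.mul m l) = A l * A m := by rw [hA.mul l m h, mul_eq h]

theorem IsModFamily.vert_src_mul (hA : Λ.IsModFamily A) (l : Λ.Path) :
    A (Λ.vert (Λ.src l)) * A l = A l := by
  rw [← hA.mul' (Λ.rng_vert _).symm, mul_vert rfl]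

theorem IsModFamily.mul_vert_rng (hA : Λ.IsModFamily A) (l : Λ.Path) :
    A l * A (Λ.vert (Λ.rng l)) = A l := by
  rw [← hA.mul' (Λ.src_vert _), vert_mul rfl]

theorem IsModFamily.mul_eq_zero (hA : Λ.IsModFamily A) {l m : Λ.Path} (h : Λ.src m ≠ Λ.rng l) :
    A l * A m = 0 := by
  rw [← hA.mul_vert_rng l, ← hA.vert_src_mul m, mul_assoc, ← mul_assoc (A (Λ.vert _)),
    hA.orth _ _ (Ne.symm h), zero_mul, mul_zero]

theorem IsModFamily.caret_sum (hA : Λ.IsModFamily A) (v : Λ.Vertex) (i : Fin k) :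
    ∑ l ∈ Λ.caret v i, star (A l) * A l = A (Λ.vert v) := by
  unfold caret
  split_ifs with h
  · exact hA.sum v i h
  · rw [Finset.sum_singleton, (hA.proj v).isSelfAdjoint.star_eq, (hA.proj v).isIdempotentElem]

theorem IsModFamily.isPFamily [Λ.LocallyConvex] (hA : Λ.IsModFamily A) : Λ.IsPFamily A where
  proj := hA.proj
  orth := hA.orth
  mul := hA.mul
  sum v n := by
    refine nk_induction (n₀ := 0) (p := fun n => ∑ l ∈ Λ.le v n, star (A l) * A l = A (Λ.vert v))
      ?_ ?_ n (fun _ => Nat.zero_le _)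
    · rw [le_zero, Finset.sum_singleton, (hA.proj v).isSelfAdjoint.star_eq,
        (hA.proj v).isIdempotentElem]
    · intro n i _ ih
      rw [sum_le_add, ← ih]
      refine Finset.sum_congr rfl fun t _ => ?_
      have : ∀ a ∈ Λ.caret (Λ.src t) i, star (A (Λ.mul t a)) * A (Λ.mul t a) =
          star (A t) * (star (A a) * A a) * A t := fun a ha => by
        rw [hA.mul' (rng_of_mem_caret ha).symm, star_mul]
        simp only [mul_assoc]
      rw [Finset.sum_congr rfl this, ← Finset.sum_mul, ← Finset.mul_sum, hA.caret_sum, mul_assoc,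
        hA.vert_src_mul]

theorem IsPFamily.mul_eq_zero (hA : Λ.IsPFamily A) {l m : Λ.Path} (h : Λ.src m ≠ Λ.rng l) :
    A l * A m = 0 := by
  have h1 : A l * A (Λ.vert (Λ.rng l)) = A l := by
    rw [hA.mul _ _ (Λ.src_vert _), Λ.vert_comp]
  have h2 : A (Λ.vert (Λ.src m)) * A m = A m := by
    rw [hA.mul _ _ (Λ.rng_vert _).symm, Λ.comp_vert]
  rw [← h1, ← h2, mul_assoc, ← mul_assoc (A (Λ.vert _)),
    hA.orth _ _ (Ne.symm h), zero_mul, mul_zero]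

end relations

section operators

variable {Λ} {H : Type*} [NormedAddCommGroup H] [InnerProductSpace ℂ H] [CompleteSpace H]

theorem norm_sq_eq_inner (T : H →L[ℂ] H) (x : H) :
    ‖T x‖ ^ 2 = RCLike.re (inner ℂ x ((star T * T) x)) := by
  rw [← inner_self_eq_norm_sq (𝕜 := ℂ), ← ContinuousLinearMap.adjoint_inner_right]
  rfl

theorem norm_proj_le {p : H →L[ℂ] H} (hp : IsStarProjection p) (x : H) : ‖p x‖ ≤ ‖x‖ := by
  have h1 := norm_sq_eq_inner p x
  rw [hp.isSelfAdjoint.star_eq, hp.isIdempotentElem] at h1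
  have h2 : RCLike.re (inner ℂ x (p x)) ≤ ‖x‖ * ‖p x‖ := re_inner_le_norm x (p x)
  by_contra! h
  nlinarith [norm_nonneg x, norm_nonneg (p x)]

theorem norm_proj_sq {p : H →L[ℂ] H} (hp : IsStarProjection p) (x : H) :
    ‖p x‖ ^ 2 = RCLike.re (inner ℂ x (p x)) := by
  rw [norm_sq_eq_inner, hp.isSelfAdjoint.star_eq, hp.isIdempotentElem]

theorem IsOFamily.norm_le_one {X : Λ.Path → (H →L[ℂ] H)} (hX : Λ.IsOFamily X) (l : Λ.Path) :
    ‖X l‖ ≤ 1 := by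
  refine ContinuousLinearMap.opNorm_le_bound _ zero_le_one fun x => ?_
  rw [one_mul]
  refine le_trans ?_ (norm_proj_le (hX.proj (Λ.src l)) x)
  refine le_of_sq_le_sq ?_ (norm_nonneg _)
  rw [norm_sq_eq_inner, hX.star_mul_self, norm_proj_sq (hX.proj _)]

theorem IsPFamily.norm_le_one {A : Λ.Path → (H →L[ℂ] H)} (hA : Λ.IsPFamily A) (l : Λ.Path) :
    ‖A l‖ ≤ 1 := by
  refine ContinuousLinearMap.opNorm_le_bound _ zero_le_one fun x => ?_
  rw [one_mul]
  refine le_trans ?_ (norm_proj_le (hA.proj (Λ.rng l)) x)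
  refine le_of_sq_le_sq ?_ (norm_nonneg _)
  rw [norm_proj_sq (hA.proj _), ← hA.sum (Λ.rng l) (Λ.deg l), sum_apply,
    inner_sum, map_sum]
  simp only [← norm_sq_eq_inner]
  exact Finset.single_le_sum (f := fun l => ‖A l x‖ ^ 2) (fun _ _ => sq_nonneg _) (self_mem_le l)

end operators

/-- A Hilbert space with a family of operators satisfying the relations of `𝒪_Λ`. -/
structure OIndex : Type (u + 1) where
  H : Type u
  [normedAddCommGroup : NormedAddCommGroup H]
  [innerProductSpace : InnerProductSpace ℂ H]
  [completeSpace : CompleteSpace H]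
  X : Λ.Path → (H →L[ℂ] H)
  isOFamily : Λ.IsOFamily X

/-- A Hilbert space with a family of operators satisfying the relations of `𝒫_Λ`. -/
structure PIndex : Type (u + 1) where
  H : Type u
  [normedAddCommGroup : NormedAddCommGroup H]
  [innerProductSpace : InnerProductSpace ℂ H]
  [completeSpace : CompleteSpace H]
  A : Λ.Path → (H →L[ℂ] H)
  isPFamily : Λ.IsPFamily A

attribute [instance] OIndex.normedAddCommGroup OIndex.innerProductSpace OIndex.completeSpace
attribute [instance] PIndex.normedAddCommGroup PIndex.innerProductSpace PIndex.completeSpace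

/-- The generator `x_l`, as the family of its values in all realisations of the relations. -/
noncomputable def oGen (l : Λ.Path) : OpProd (fun i : Λ.OIndex => i.H) :=
  ⟨fun i => i.X l, memℓp_infty ⟨1, by rintro _ ⟨i, rfl⟩; exact i.isOFamily.norm_le_one l⟩⟩

/-- The generator `a_l`, as the family of its values in all realisations of the relations. -/
noncomputable def pGen (l : Λ.Path) : OpProd (fun i : Λ.PIndex => i.H) :=
  ⟨fun i => i.A l, memℓp_infty ⟨1, by rintro _ ⟨i, rfl⟩; exact i.isPFamily.norm_le_one l⟩⟩

/-- The graph C*-algebra `𝒪_Λ`, the universal C*-algebra of the relations `IsOFamily`: the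
C*-algebra generated by the elements `x_l` in the product of all Hilbert space realisations of the
relations, so that the norm of a *-polynomial in the generators is the supremum of its norms in all
realisations. -/
def OAlg : Type (u + 1) := OpProd.gen (fun i : Λ.OIndex => i.H) (Set.range Λ.oGen)

/-- The Pythagorean C*-algebra `𝒫_Λ`, the universal C*-algebra of the relations `IsPFamily`. -/
def PAlg : Type (u + 1) := OpProd.gen (fun i : Λ.PIndex => i.H) (Set.range Λ.pGen)

noncomputable instance : NonUnitalCStarAlgebra Λ.OAlg :=
  inferInstanceAs (NonUnitalCStarAlgebra
    (OpProd.gen (fun i : Λ.OIndex => i.H) (Set.range Λ.oGen)))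

noncomputable instance : NonUnitalCStarAlgebra Λ.PAlg :=
  inferInstanceAs (NonUnitalCStarAlgebra
    (OpProd.gen (fun i : Λ.PIndex => i.H) (Set.range Λ.pGen)))

/-- The generator `x_l` of `𝒪_Λ`. -/
noncomputable def x (l : Λ.Path) : Λ.OAlg :=
  ⟨Λ.oGen l, NonUnitalStarSubalgebra.le_topologicalClosure _
    (NonUnitalStarAlgebra.subset_adjoin ℂ _ ⟨l, rfl⟩)⟩

/-- The generator `a_l` of `𝒫_Λ`. -/
noncomputable def aP (l : Λ.Path) : Λ.PAlg :=
  ⟨Λ.pGen l, NonUnitalStarSubalgebra.le_topologicalClosure _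
    (NonUnitalStarAlgebra.subset_adjoin ℂ _ ⟨l, rfl⟩)⟩

/-- The representation of `𝒪_Λ` determined by a family of operators that satisfies the relations. -/
noncomputable def oEval (i : Λ.OIndex) : Λ.OAlg →⋆ₙₐ[ℂ] (i.H →L[ℂ] i.H) where
  toFun f := OpProd.eval (fun i : Λ.OIndex => i.H) i f.1
  map_smul' _ _ := rfl
  map_zero' := rfl
  map_add' _ _ := rfl
  map_mul' _ _ := rfl
  map_star' _ := rfl

/-- The representation of `𝒫_Λ` determined by a family of operators that satisfies the relations. -/
noncomputable def pEval (i : Λ.PIndex) : Λ.PAlg →⋆ₙₐ[ℂ] (i.H →L[ℂ] i.H) where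
  toFun f := OpProd.eval (fun i : Λ.PIndex => i.H) i f.1
  map_smul' _ _ := rfl
  map_zero' := rfl
  map_add' _ _ := rfl
  map_mul' _ _ := rfl
  map_star' _ := rfl

section algebras

variable {Λ}

theorem oEval_x (i : Λ.OIndex) (l : Λ.Path) : Λ.oEval i (Λ.x l) = i.X l := rfl

theorem pEval_a (i : Λ.PIndex) (l : Λ.Path) : Λ.pEval i (Λ.aP l) = i.A l := rfl

theorem norm_oEval_le (i : Λ.OIndex) (f : Λ.OAlg) : ‖Λ.oEval i f‖ ≤ ‖f‖ :=
  OpProd.norm_eval_le (fun i : Λ.OIndex => i.H) i f.1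

theorem norm_pEval_le (i : Λ.PIndex) (f : Λ.PAlg) : ‖Λ.pEval i f‖ ≤ ‖f‖ :=
  OpProd.norm_eval_le (fun i : Λ.PIndex => i.H) i f.1

theorem OAlg.ext {f g : Λ.OAlg} (h : ∀ i, Λ.oEval i f = Λ.oEval i g) : f = g :=
  Subtype.ext (OpProd.ext h)

theorem PAlg.ext {f g : Λ.PAlg} (h : ∀ i, Λ.pEval i f = Λ.pEval i g) : f = g :=
  Subtype.ext (OpProd.ext h)

theorem x_isOFamily : Λ.IsOFamily Λ.x where
  proj v := ⟨OAlg.ext fun i => by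
    rw [map_mul]; exact (i.isOFamily.proj v).isIdempotentElem, OAlg.ext fun i => by
    rw [map_star]; exact (i.isOFamily.proj v).isSelfAdjoint⟩
  orth v w h := OAlg.ext fun i => by
    rw [map_mul, map_zero]; exact i.isOFamily.orth v w h
  star_mul_self l := OAlg.ext fun i => by
    rw [map_mul, map_star]; exact i.isOFamily.star_mul_self l
  sum v j h := OAlg.ext fun i => by
    rw [map_sum]; simp only [map_mul, map_star]; exact i.isOFamily.sum v j h
  mul l m h := OAlg.ext fun i => by
    rw [map_mul]; exact i.isOFamily.mul l m h

theorem aP_isPFamily : Λ.IsPFamily Λ.aP where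
  proj v := ⟨PAlg.ext fun i => by
    rw [map_mul]; exact (i.isPFamily.proj v).isIdempotentElem, PAlg.ext fun i => by
    rw [map_star]; exact (i.isPFamily.proj v).isSelfAdjoint⟩
  orth v w h := PAlg.ext fun i => by
    rw [map_mul, map_zero]; exact i.isPFamily.orth v w h
  sum v n := PAlg.ext fun i => by
    rw [map_sum]; simp only [map_mul, map_star]; exact i.isPFamily.sum v n
  mul l m h := PAlg.ext fun i => by
    rw [map_mul]; exact i.isPFamily.mul l m h

end algebras

/-- The non-self-adjoint algebra `𝒜_Λ`, the closed linear span of the generators `a_l` in `𝒫_Λ`. -/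
noncomputable def AAlg : NonUnitalSubalgebra ℂ Λ.PAlg where
  __ := (Submodule.span ℂ (Set.range Λ.aP)).topologicalClosure
  mul_mem' := by
    have h1 : ∀ f g : Λ.PAlg, f ∈ Submodule.span ℂ (Set.range Λ.aP) →
        g ∈ Submodule.span ℂ (Set.range Λ.aP) → f * g ∈ Submodule.span ℂ (Set.range Λ.aP) := by
      intro f g hf hg
      induction hf using Submodule.span_induction with
      | zero => rw [zero_mul]; exact zero_mem _
      | add _ _ _ _ h h' => rw [add_mul]; exact add_mem h h'
      | smul c _ _ h => rw [smul_mul_assoc]; exact Submodule.smul_mem _ c h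
      | mem f hf =>
        obtain ⟨l, rfl⟩ := hf
        induction hg using Submodule.span_induction with
        | zero => rw [mul_zero]; exact zero_mem _
        | add _ _ _ _ h h' => rw [mul_add]; exact add_mem h h'
        | smul c _ _ h => rw [mul_smul_comm]; exact Submodule.smul_mem _ c h
        | mem g hg =>
          obtain ⟨m, rfl⟩ := hg
          by_cases h : Λ.src m = Λ.rng l
          · rw [aP_isPFamily.mul l m h]
            exact Submodule.subset_span ⟨_, rfl⟩
          · rw [aP_isPFamily.mul_eq_zero h]
            exact zero_mem _
    intro f g hf hg
    exact map_mem_closure₂ continuous_mul hf hg fun f hf g hg => h1 f g hf hg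

/-- The generator `a_l` of `𝒜_Λ`. -/
noncomputable def a (l : Λ.Path) : Λ.AAlg :=
  ⟨Λ.aP l, Submodule.le_topologicalClosure _ (Submodule.subset_span ⟨l, rfl⟩)⟩

end KGraph

namespace KGraph
open CategoryTheory
variable {k : ℕ} (Λ : KGraph.{u} k) [Λ.RowFinite]

/-! ### Modules and representations -/

/-- A (nondegenerate) `𝒜_Λ`-module. -/
structure Mod : Type (u + 1) where
  H : Type u
  [normedAddCommGroup : NormedAddCommGroup H]
  [innerProductSpace : InnerProductSpace ℂ H]
  [completeSpace : CompleteSpace H]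
  /-- the action -/
  π : Λ.AAlg →ₙₐ[ℂ] (H →L[ℂ] H)
  continuous_π : Continuous π
  proj : ∀ v, IsStarProjection (π (Λ.a (Λ.vert v)))
  sum : ∀ v i, (Λ.edges v i).Nonempty →
    ∑ l ∈ Λ.edges v i, star (π (Λ.a l)) * π (Λ.a l) = π (Λ.a (Λ.vert v))
  /-- the net of finite sums of the `π (a_v)` converges to the identity in the weak operator
  topology -/
  nondegenerate : ∀ ξ η : H,
    HasSum (fun v => inner ℂ η (π (Λ.a (Λ.vert v)) ξ)) (inner ℂ η ξ)

/-- A (nondegenerate) representation of `𝒪_Λ`. -/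
structure Rep : Type (u + 1) where
  H : Type u
  [normedAddCommGroup : NormedAddCommGroup H]
  [innerProductSpace : InnerProductSpace ℂ H]
  [completeSpace : CompleteSpace H]
  /-- the action -/
  π : Λ.OAlg →⋆ₙₐ[ℂ] (H →L[ℂ] H)
  /-- the net of finite sums of the `π (x_v)` converges to the identity in the strong operator
  topology -/
  nondegenerate : ∀ ξ : H, HasSum (fun v => π (Λ.x (Λ.vert v)) ξ) ξ

attribute [instance] Mod.normedAddCommGroup Mod.innerProductSpace Mod.completeSpace
attribute [instance] Rep.normedAddCommGroup Rep.innerProductSpace Rep.completeSpace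

variable {Λ}

/-- The operator `A_l` by which `a_l` acts. -/
noncomputable def Mod.A (M : Λ.Mod) (l : Λ.Path) : M.H →L[ℂ] M.H := M.π (Λ.a l)

/-- The operator `X_l` by which `x_l` acts. -/
noncomputable def Rep.X (L : Λ.Rep) (l : Λ.Path) : L.H →L[ℂ] L.H := L.π (Λ.x l)

/-- A morphism of modules: a bounded linear map that intertwines the operators `A_l`. -/
@[ext]
structure Mod.Hom (M N : Λ.Mod) where
  f : M.H →L[ℂ] N.H
  comm : ∀ l, f ∘L M.A l = N.A l ∘L f

/-- A morphism of representations: a bounded linear map that intertwines the actions. -/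
@[ext]
structure Rep.Hom (L K : Λ.Rep) where
  f : L.H →L[ℂ] K.H
  comm : ∀ b : Λ.OAlg, f ∘L L.π b = K.π b ∘L f

instance : Category Λ.Mod where
  Hom := Mod.Hom
  id M := ⟨ContinuousLinearMap.id ℂ M.H, fun _ => rfl⟩
  comp φ ψ := ⟨ψ.f ∘L φ.f, fun l => by
    rw [ContinuousLinearMap.comp_assoc, φ.comm, ← ContinuousLinearMap.comp_assoc, ψ.comm,
      ContinuousLinearMap.comp_assoc]⟩

instance : Category Λ.Rep where
  Hom := Rep.Hom
  id L := ⟨ContinuousLinearMap.id ℂ L.H, fun _ => rfl⟩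
  comp φ ψ := ⟨ψ.f ∘L φ.f, fun l => by
    rw [ContinuousLinearMap.comp_assoc, φ.comm, ← ContinuousLinearMap.comp_assoc, ψ.comm,
      ContinuousLinearMap.comp_assoc]⟩

theorem Mod.isModFamily (M : Λ.Mod) : Λ.IsModFamily M.A where
  proj := M.proj
  orth v w h := by
    have : Λ.a (Λ.vert v) * Λ.a (Λ.vert w) = 0 := Subtype.ext (aP_isPFamily.orth v w h)
    rw [Mod.A, Mod.A, ← map_mul, this, map_zero]
  sum := M.sum
  mul l m h := by
    have : Λ.a l * Λ.a m = Λ.a (Λ.comp m l h) := Subtype.ext (aP_isPFamily.mul l m h)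
    rw [Mod.A, Mod.A, ← map_mul, this, Mod.A]

theorem Rep.isOFamily (L : Λ.Rep) : Λ.IsOFamily L.X where
  proj v := ⟨by
    rw [IsIdempotentElem, Rep.X, ← map_mul, (x_isOFamily.proj v).isIdempotentElem], by
    rw [IsSelfAdjoint, Rep.X, ← map_star, (x_isOFamily.proj v).isSelfAdjoint.star_eq]⟩
  orth v w h := by
    rw [Rep.X, Rep.X, ← map_mul, x_isOFamily.orth v w h, map_zero]
  star_mul_self l := by
    rw [Rep.X, ← map_star, ← map_mul, x_isOFamily.star_mul_self, Rep.X]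
  sum v j h := by
    simp only [Rep.X, ← map_star, ← map_mul, ← map_sum]
    rw [x_isOFamily.sum v j h]
  mul l m h := by
    rw [Rep.X, Rep.X, ← map_mul, x_isOFamily.mul l m h, Rep.X]

/-- The module given by a family of operators: `a_l` acts by `A l`. -/
noncomputable def Mod.ofFamily [Λ.LocallyConvex] {H : Type u} [NormedAddCommGroup H]
    [InnerProductSpace ℂ H] [CompleteSpace H] (A : Λ.Path → (H →L[ℂ] H)) (hA : Λ.IsModFamily A)
    (hn : ∀ ξ η : H, HasSum (fun v => inner ℂ η (A (Λ.vert v) ξ)) (inner ℂ η ξ)) : Λ.Mod where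
  H := H
  π := (Λ.pEval ⟨H, A, hA.isPFamily⟩ : Λ.PAlg →ₙₐ[ℂ] (H →L[ℂ] H)).comp
    (NonUnitalSubalgebraClass.subtype Λ.AAlg)
  continuous_π := by
    let i : Λ.PIndex := ⟨H, A, hA.isPFamily⟩
    have h1 : Continuous (Λ.pEval i) :=
      AddMonoidHomClass.continuous_of_bound (Λ.pEval i) 1 fun f => by
        rw [one_mul]; exact norm_pEval_le i f
    exact h1.comp continuous_subtype_val
  proj v := hA.proj v
  sum v i h := hA.sum v i h
  nondegenerate := hn

theorem IsOFamily.isModFamily {B : Type*} [NonUnitalRing B] [StarRing B] {X : Λ.Path → B}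
    (hX : Λ.IsOFamily X) : Λ.IsModFamily (fun l => star (X l)) where
  proj v := by
    rw [(hX.proj v).isSelfAdjoint.star_eq]; exact hX.proj v
  orth v w h := by rw [← star_mul, hX.orth w v h.symm, star_zero]
  sum v i h := by
    simp only [star_star]
    rw [(hX.proj v).isSelfAdjoint.star_eq, hX.sum v i h]
  mul l m h := by rw [← star_mul, hX.mul m l h]

/-- The representation given by a family of operators: `x_l` acts by `X l`. -/
noncomputable def Rep.ofFamily {H : Type u} [NormedAddCommGroup H]
    [InnerProductSpace ℂ H] [CompleteSpace H] (X : Λ.Path → (H →L[ℂ] H)) (hX : Λ.IsOFamily X)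
    (hn : ∀ ξ : H, HasSum (fun v => X (Λ.vert v) ξ) ξ) : Λ.Rep where
  H := H
  π := Λ.oEval ⟨H, X, hX⟩
  nondegenerate := hn

/-- The forgetful functor: `a_l` acts by `X_l^*`. -/
noncomputable def U (Λ : KGraph.{u} k) [Λ.RowFinite] [Λ.LocallyConvex] : Λ.Rep ⥤ Λ.Mod where
  obj L := Mod.ofFamily (fun l => star (L.X l)) L.isOFamily.isModFamily fun ξ η => by
    have h := (L.nondegenerate ξ).mapL (innerSL ℂ η)
    have h' : ∀ v, star (L.X (Λ.vert v)) = L.X (Λ.vert v) := fun v =>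
      (L.isOFamily.proj v).isSelfAdjoint.star_eq
    simp only [h']
    exact h
  map {L K} φ := ⟨φ.f, fun l => by
    have := φ.comm (star (Λ.x l))
    rw [map_star, map_star] at this
    exact this⟩

/-! ### Submodules -/

/-- `K` is a submodule of `M`: a closed subspace invariant under the operators `A_l`. -/
structure Mod.IsSubmodule (M : Λ.Mod) (K : Submodule ℂ M.H) : Prop where
  isClosed : IsClosed (K : Set M.H)
  map_mem : ∀ l, ∀ ξ ∈ K, M.A l ξ ∈ K

theorem Mod.IsSubmodule.π_mem {M : Λ.Mod} {K : Submodule ℂ M.H} (hK : M.IsSubmodule K)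
    (b : Λ.AAlg) {ξ : M.H} (hξ : ξ ∈ K) : M.π b ξ ∈ K := by
  have h1 : ∀ c : Λ.PAlg, c ∈ Submodule.span ℂ (Set.range Λ.aP) →
      ∀ hc : c ∈ Λ.AAlg, M.π ⟨c, hc⟩ ξ ∈ K := by
    intro c hc
    have hle : Submodule.span ℂ (Set.range Λ.aP) ≤ Λ.AAlg.toSubmodule :=
      Submodule.le_topologicalClosure _
    induction hc using Submodule.span_induction with
    | zero =>
      intro hc
      have : M.π ⟨0, hc⟩ = 0 := map_zero M.π
      rw [this]; exact zero_mem _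
    | add f g hf hg h h' =>
      intro hc
      have : M.π ⟨f + g, hc⟩ = M.π ⟨f, hle hf⟩ + M.π ⟨g, hle hg⟩ :=
        map_add M.π ⟨f, hle hf⟩ ⟨g, hle hg⟩
      rw [this]; exact add_mem (h _) (h' _)
    | smul r f hf h =>
      intro hc
      have : M.π ⟨r • f, hc⟩ = r • M.π ⟨f, hle hf⟩ := map_smul M.π r ⟨f, hle hf⟩
      rw [this]; exact K.smul_mem r (h _)
    | mem f hf =>
      obtain ⟨l, rfl⟩ := hf
      intro hc
      exact hK.map_mem l ξ hξ
  have hcl : IsClosed {b : Λ.AAlg | M.π b ξ ∈ K} :=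
    hK.isClosed.preimage ((ContinuousLinearMap.apply ℂ M.H ξ).continuous.comp M.continuous_π)
  have hd : b ∈ closure {b : Λ.AAlg | (b : Λ.PAlg) ∈ Submodule.span ℂ (Set.range Λ.aP)} := by
    rw [closure_subtype]
    refine closure_mono ?_ b.2
    intro c hc
    exact ⟨⟨c, Submodule.le_topologicalClosure _ hc⟩, hc, rfl⟩
  exact closure_minimal (fun c hc => h1 c.1 hc c.2) hcl hd

/-- The restriction of the action to a submodule. -/
noncomputable def Mod.restrictπ (M : Λ.Mod) (K : Submodule ℂ M.H) (hK : M.IsSubmodule K) :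
    Λ.AAlg →ₙₐ[ℂ] (K →L[ℂ] K) where
  toFun b := (M.π b ∘L K.subtypeL).codRestrict K fun ξ => hK.π_mem b ξ.2
  map_smul' c b := by
    ext ξ
    exact DFunLike.congr_fun (map_smul M.π c b) (ξ : M.H)
  map_zero' := by
    ext ξ
    exact DFunLike.congr_fun (map_zero M.π) (ξ : M.H)
  map_add' b c := by
    ext ξ
    exact DFunLike.congr_fun (map_add M.π b c) (ξ : M.H)
  map_mul' b c := by
    ext ξ
    exact DFunLike.congr_fun (map_mul M.π b c) (ξ : M.H)

theorem Mod.restrictπ_apply (M : Λ.Mod) (K : Submodule ℂ M.H) (hK : M.IsSubmodule K)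
    (b : Λ.AAlg) (ξ : K) : ((M.restrictπ K hK b ξ : K) : M.H) = M.π b ξ := rfl

theorem Mod.continuous_restrictπ (M : Λ.Mod) (K : Submodule ℂ M.H) (hK : M.IsSubmodule K) :
    Continuous (M.restrictπ K hK) := by
  have h : ∀ b c, ‖M.restrictπ K hK b - M.restrictπ K hK c‖ ≤ ‖M.π b - M.π c‖ := fun b c =>
    ContinuousLinearMap.opNorm_le_bound _ (norm_nonneg _) fun ξ =>
      (M.π b - M.π c).le_opNorm (ξ : M.H)
  refine continuous_iff_continuousAt.2 fun b => ?_
  have h1 : Filter.Tendsto (fun c => ‖M.π c - M.π b‖) (nhds b) (nhds 0) :=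
    (tendsto_iff_norm_sub_tendsto_zero (f := fun c => M.π c) (b := M.π b)).1
      (M.continuous_π.tendsto b)
  have h2 : Filter.Tendsto (fun c => ‖M.restrictπ K hK c - M.restrictπ K hK b‖) (nhds b) (nhds 0) :=
    squeeze_zero (fun c => norm_nonneg (M.restrictπ K hK c - M.restrictπ K hK b))
      (fun c => h c b) h1
  exact (tendsto_iff_norm_sub_tendsto_zero (f := fun c => M.restrictπ K hK c)
    (b := M.restrictπ K hK b)).2 h2

/-- A submodule as a module, with the restricted action. -/
noncomputable def Mod.restrict (M : Λ.Mod) (K : Submodule ℂ M.H) (hK : M.IsSubmodule K) :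
    Λ.Mod :=
  haveI : CompleteSpace K := hK.isClosed.completeSpace_coe
  { H := K
    π := M.restrictπ K hK
    continuous_π := M.continuous_restrictπ K hK
    proj := fun v => by
      refine ⟨?_, ?_⟩
      · ext ξ
        exact DFunLike.congr_fun (M.proj v).isIdempotentElem (ξ : M.H)
      · rw [ContinuousLinearMap.isSelfAdjoint_iff_isSymmetric]
        intro ξ η
        exact (ContinuousLinearMap.isSelfAdjoint_iff_isSymmetric.1 (M.proj v).isSelfAdjoint)
          (ξ : M.H) (η : M.H)
    sum := fun v i h => by
      refine ContinuousLinearMap.ext fun ξ => ext_inner_left ℂ fun η => ?_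
      rw [sum_apply, inner_sum]
      have h1 := congrArg (fun T : M.H →L[ℂ] M.H => inner ℂ (η : M.H) (T (ξ : M.H))) (M.sum v i h)
      simp only [sum_apply, inner_sum] at h1
      refine Eq.trans (Finset.sum_congr rfl fun l _ => ?_) h1
      rw [mul_apply_eq_comp, mul_apply_eq_comp, ContinuousLinearMap.star_eq_adjoint,
        ContinuousLinearMap.star_eq_adjoint, ContinuousLinearMap.adjoint_inner_right,
        ContinuousLinearMap.adjoint_inner_right]
      rfl
    nondegenerate := fun ξ η => M.nondegenerate ξ η }

/-- `Z` is a residual subspace of `M`: the orthogonal complement of a submodule, containing no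
nonzero submodule. -/
def Mod.IsResidual (M : Λ.Mod) (Z : Submodule ℂ M.H) : Prop :=
  (∃ K, M.IsSubmodule K ∧ Z = Kᗮ) ∧ ∀ N, M.IsSubmodule N → N ≤ Z → N = ⊥

/-- `M` is full: it contains no nonzero residual subspace. -/
def Mod.IsFull (M : Λ.Mod) : Prop := ∀ Z, M.IsResidual Z → Z = ⊥

/-- `K` is a complete submodule of `M`; here `M.A (Λ.vert v) ξ = ξ` says that `ξ ∈ H_v`. -/
def Mod.IsCompleteSubmodule (M : Λ.Mod) (K : Submodule ℂ M.H) : Prop :=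
  M.IsSubmodule K ∧ ∀ ε : ℝ, 0 < ε → ∀ v, ∀ ξ : M.H, M.A (Λ.vert v) ξ = ξ →
    ∃ t : Finset Λ.Path, Λ.IsTree v t ∧ ∃ η : Λ.Path → M.H, (∀ m ∈ t, η m ∈ K) ∧
      ∑ m ∈ t, ‖M.A m ξ - η m‖ ^ 2 < ε ^ 2

/-- `M` is irreducible: it is nonzero and has no submodule besides `0` and `M`. -/
def Mod.IsIrreducible (M : Λ.Mod) : Prop :=
  Nontrivial M.H ∧ ∀ K, M.IsSubmodule K → K = ⊥ ∨ K = ⊤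

/-- `L` is irreducible: it is nonzero and no closed subspace besides `0` and `L` is invariant. -/
def Rep.IsIrreducible (L : Λ.Rep) : Prop :=
  Nontrivial L.H ∧ ∀ K : Submodule ℂ L.H, IsClosed (K : Set L.H) →
    (∀ b : Λ.OAlg, ∀ ξ ∈ K, L.π b ξ ∈ K) → K = ⊥ ∨ K = ⊤

end KGraph

namespace KGraph
open CategoryTheory
variable {k : ℕ} {Λ : KGraph.{u} k} [Λ.RowFinite]

/-! ### The Pythagorean functor -/

open Classical in
/-- The operator `A_n` if `t = l ∘ n` and `0` if `t` does not start with `l`. -/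
noncomputable def Mod.quotOp (M : Λ.Mod) (l t : Λ.Path) : M.H →L[ℂ] M.H :=
  if h : ∃ n, Λ.src l = Λ.rng n ∧ Λ.mul l n = t then M.A h.choose else 0

namespace Mod

section form

variable (M : Λ.Mod)

theorem quotOp_mul {l n : Λ.Path} (h : Λ.src l = Λ.rng n) : M.quotOp l (Λ.mul l n) = M.A n := by
  have hex : ∃ n', Λ.src l = Λ.rng n' ∧ Λ.mul l n' = Λ.mul l n := ⟨n, h, rfl⟩
  rw [quotOp, dif_pos hex, mul_left_cancel' hex.choose_spec.1 h hex.choose_spec.2]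

theorem quotOp_eq_zero {l t : Λ.Path} (h : ¬ ∃ n, Λ.src l = Λ.rng n ∧ Λ.mul l n = t) :
    M.quotOp l t = 0 := by
  rw [quotOp, dif_neg h]

theorem quotOp_rng_ne {l t : Λ.Path} (h : Λ.rng l ≠ Λ.rng t) : M.quotOp l t = 0 := by
  refine M.quotOp_eq_zero ?_
  rintro ⟨n, -, rfl⟩
  exact h (rng_mul _ _).symm

theorem vert_mul_quotOp (l t : Λ.Path) :
    M.A (Λ.vert (Λ.src t)) * M.quotOp l t = M.quotOp l t := by
  by_cases h : ∃ n, Λ.src l = Λ.rng n ∧ Λ.mul l n = t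
  · obtain ⟨n, hn, rfl⟩ := h
    rw [M.quotOp_mul hn, src_mul hn, M.isModFamily.vert_src_mul]
  · rw [M.quotOp_eq_zero h, mul_zero]

theorem exists_of_mul_eq {v : Λ.Vertex} {n : Fin k → ℕ} {t m a b : Λ.Path} (ht : t ∈ Λ.le v n)
    (hm : Λ.deg m ≤ n) (ha : Λ.src t = Λ.rng a) (hb : Λ.src m = Λ.rng b)
    (h : Λ.mul t a = Λ.mul m b) : ∃ c, Λ.src m = Λ.rng c ∧ Λ.mul m c = t := by
  obtain ⟨h1, h2, h3⟩ := mem_le.1 ht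
  have hd : Λ.deg m ≤ Λ.deg t := by
    intro i
    by_contra hlt
    have hlt' : Λ.deg t i < Λ.deg m i := by simpa using hlt
    have hni : Λ.deg m i ≤ n i := hm i
    have e1 := congrArg (fun l => Λ.deg l i) h
    simp only [deg_mul ha, deg_mul hb, Pi.add_apply] at e1
    obtain ⟨c, d, hcd, hcd', hc⟩ := exists_factor_le a (e i) (e_le_iff.2 (by omega))
    refine h3 i (by omega) ⟨c, ?_, hc⟩
    rw [ha, ← hcd', rng_mul]
  obtain ⟨m', c, hc, hmc, hdm⟩ := exists_factor_le t _ hd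
  subst hmc
  rw [src_mul hc] at ha
  rw [mul_assoc' hc ha] at h
  obtain ⟨rfl, -⟩ := factor_unique (by rw [rng_mul, hc]) hb h hdm
  exact ⟨c, hc, rfl⟩

theorem quotOp_mul_right {v : Λ.Vertex} {n : Fin k → ℕ} {t l a : Λ.Path} (ht : t ∈ Λ.le v n)
    (hl : Λ.deg l ≤ n) (ha : Λ.src t = Λ.rng a) :
    M.quotOp l (Λ.mul t a) = M.A a * M.quotOp l t := by
  by_cases h : ∃ n, Λ.src l = Λ.rng n ∧ Λ.mul l n = t
  · obtain ⟨c, hc, rfl⟩ := h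
    rw [src_mul hc] at ha
    rw [mul_assoc' hc ha, M.quotOp_mul hc, M.quotOp_mul (by rw [rng_mul, hc]),
      M.isModFamily.mul' ha]
  · rw [M.quotOp_eq_zero h, mul_zero, quotOp_eq_zero]
    rintro ⟨b, hb, hab⟩
    exact h (exists_of_mul_eq ht hl ha hb hab.symm)

/-- The inner product of `[l, ξ]` and `[m, η]`: the sum of `⟨A_n ξ, A_p η⟩` over the paths
`l ∘ n = m ∘ p` in `Λ^{≤ d(l) + d(m)}`. -/
noncomputable def brInner (l : Λ.Path) (ξ : M.H) (m : Λ.Path) (η : M.H) : ℂ :=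
  ∑ t ∈ Λ.le (Λ.rng l) (Λ.deg l + Λ.deg m), inner ℂ (M.quotOp l t ξ) (M.quotOp m t η)

variable [Λ.LocallyConvex]

theorem level_step {v : Λ.Vertex} {n : Fin k → ℕ} {l m : Λ.Path} (hl : Λ.deg l ≤ n)
    (hm : Λ.deg m ≤ n) (i : Fin k) (ξ η : M.H) :
    ∑ t ∈ Λ.le v (n + e i), inner ℂ (M.quotOp l t ξ) (M.quotOp m t η) =
      ∑ t ∈ Λ.le v n, inner ℂ (M.quotOp l t ξ) (M.quotOp m t η) := by
  rw [sum_le_add]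
  refine Finset.sum_congr rfl fun t ht => ?_
  have h1 : ∀ a ∈ Λ.caret (Λ.src t) i,
      inner ℂ (M.quotOp l (Λ.mul t a) ξ) (M.quotOp m (Λ.mul t a) η) =
        inner ℂ (M.quotOp l t ξ) ((star (M.A a) * M.A a) (M.quotOp m t η)) := fun a ha => by
    have har := (rng_of_mem_caret ha).symm
    rw [M.quotOp_mul_right ht hl har, M.quotOp_mul_right ht hm har]
    exact (ContinuousLinearMap.adjoint_inner_right (M.A a) (M.quotOp l t ξ)
      (M.A a (M.quotOp m t η))).symm
  rw [Finset.sum_congr rfl h1, ← inner_sum, ← sum_apply, M.isModFamily.caret_sum,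
    ← mul_apply_eq_comp, M.vert_mul_quotOp]

theorem brInner_eq {l m : Λ.Path} {n : Fin k → ℕ} (hl : Λ.deg l ≤ n) (hm : Λ.deg m ≤ n)
    (ξ η : M.H) : M.brInner l ξ m η =
      ∑ t ∈ Λ.le (Λ.rng l) n, inner ℂ (M.quotOp l t ξ) (M.quotOp m t η) := by
  have key : ∀ n, Λ.deg l ⊔ Λ.deg m ≤ n →
      ∑ t ∈ Λ.le (Λ.rng l) n, inner ℂ (M.quotOp l t ξ) (M.quotOp m t η) =
      ∑ t ∈ Λ.le (Λ.rng l) (Λ.deg l ⊔ Λ.deg m), inner ℂ (M.quotOp l t ξ) (M.quotOp m t η) := by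
    refine nk_induction rfl ?_
    intro n i hn ih
    rw [M.level_step (le_sup_left.trans hn) (le_sup_right.trans hn), ih]
  rw [brInner, key _ (sup_le hl hm), key]
  exact sup_le (fun i => Nat.le_add_right _ _) (fun i => Nat.le_add_left _ _)

end form

/-- The space of finite sums `∑ (l, ξ_l)` of paths decorated by vectors. A vector `ξ` that is
not in `H_{s(l)}` is understood to be replaced by its projection `A_{s(l)} ξ`: the difference
has norm zero below, so it disappears in the completion. -/
def PreL (M : Λ.Mod) : Type u := Λ.Path →₀ M.H

namespace PreL

variable (M : Λ.Mod)

noncomputable instance : AddCommGroup M.PreL := inferInstanceAs (AddCommGroup (Λ.Path →₀ M.H))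

noncomputable instance : Module ℂ M.PreL := inferInstanceAs (Module ℂ (Λ.Path →₀ M.H))

variable {M} in
/-- The decorated path `(l, ξ)`. -/
noncomputable def br (l : Λ.Path) (ξ : M.H) : M.PreL := Finsupp.single l ξ

/-- The component at `t` of a sum of decorated paths after extending the paths to `t`. -/
noncomputable def ext (t : Λ.Path) : M.PreL →ₗ[ℂ] M.H :=
  Finsupp.lsum ℂ fun l => (M.quotOp l t : M.H →ₗ[ℂ] M.H)

theorem ext_br (t l : Λ.Path) (ξ : M.H) : ext M t (br l ξ) = M.quotOp l t ξ :=
  (Finsupp.lsum_single (R := ℂ) (S := ℂ) (M := M.H) (N := M.H) _ l ξ)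

variable {M} in
/-- The sesquilinear form on sums of decorated paths. -/
noncomputable def form (f g : M.PreL) : ℂ :=
  Finsupp.sum (M := M.H) f fun l ξ => Finsupp.sum (M := M.H) g fun m η => M.brInner l ξ m η

variable {M} in
theorem induction {p : M.PreL → Prop} (f : M.PreL) (h0 : p 0)
    (ha : ∀ f g, p f → p g → p (f + g)) (hb : ∀ l ξ, p (br l ξ)) : p f :=
  Finsupp.induction_linear (M := M.H) f h0 (fun f g => ha f g) hb

variable {M} in
/-- All paths in the support of `f` have degree at most `n` and range in `R`. -/
def Supp (f : M.PreL) (R : Finset Λ.Vertex) (n : Fin k → ℕ) : Prop :=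
  ∀ l ∈ Finsupp.support (M := M.H) f, Λ.rng l ∈ R ∧ Λ.deg l ≤ n

variable {M}

theorem Supp.mono {f : M.PreL} {R R' : Finset Λ.Vertex} {n n' : Fin k → ℕ} (h : f.Supp R n)
    (hR : R ⊆ R') (hn : n ≤ n') : f.Supp R' n' :=
  fun l hl => ⟨hR (h l hl).1, (h l hl).2.trans hn⟩

open Classical in
theorem exists_supp (f : M.PreL) : ∃ R n, f.Supp R n :=
  ⟨(Finsupp.support (M := M.H) f).image Λ.rng, (Finsupp.support (M := M.H) f).sup Λ.deg,
    fun _ hl => ⟨Finset.mem_image_of_mem _ hl, Finset.le_sup (f := Λ.deg) hl⟩⟩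

open Classical in
theorem exists_supp₂ (f g : M.PreL) (n₀ : Fin k → ℕ) :
    ∃ R n, f.Supp R n ∧ g.Supp R n ∧ n₀ ≤ n := by
  obtain ⟨R, n, h⟩ := exists_supp f
  obtain ⟨R', n', h'⟩ := exists_supp g
  exact ⟨R ∪ R', n ⊔ n' ⊔ n₀, h.mono Finset.subset_union_left (le_sup_left.trans le_sup_left),
    h'.mono Finset.subset_union_right (le_sup_right.trans le_sup_left), le_sup_right⟩

variable [Λ.LocallyConvex]

theorem form_eq {f g : M.PreL} {R : Finset Λ.Vertex} {n : Fin k → ℕ} (hf : f.Supp R n)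
    (hg : g.Supp R n) :
    form f g = ∑ v ∈ R, ∑ t ∈ Λ.le v n, inner ℂ (ext M t f) (ext M t g) := by
  have h1 : ∀ t, ∀ f : M.PreL, ext M t f =
      ∑ l ∈ Finsupp.support (M := M.H) f, M.quotOp l t (Finsupp.toFun (M := M.H) f l) := fun t f => rfl
  have h2 : ∀ l ∈ Finsupp.support (M := M.H) f, ∀ m ∈ Finsupp.support (M := M.H) g, ∀ ξ η,
      M.brInner l ξ m η =
        ∑ v ∈ R, ∑ t ∈ Λ.le v n, inner ℂ (M.quotOp l t ξ) (M.quotOp m t η) := by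
    intro l hl m hm ξ η
    rw [M.brInner_eq (hf l hl).2 (hg m hm).2]
    symm
    refine Finset.sum_eq_single_of_mem (Λ.rng l) (hf l hl).1 fun v _ hv => ?_
    refine Finset.sum_eq_zero fun t ht => ?_
    rw [M.quotOp_rng_ne (by rw [(mem_le.1 ht).1]; exact hv.symm)]
    simp
  simp only [h1, inner_sum, sum_inner]
  unfold form Finsupp.sum
  rw [Finset.sum_congr rfl fun l hl => Finset.sum_congr rfl fun m hm => h2 l hl m hm _ _]
  simp only [Finset.sum_comm (s := Finsupp.support (M := M.H) g)]
  simp only [Finset.sum_comm (s := Finsupp.support (M := M.H) f)]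
  rfl

noncomputable instance : PreInnerProductSpace.Core ℂ M.PreL where
  inner := form
  conj_inner_symm f g := by
    obtain ⟨R, n, hf, hg, -⟩ := exists_supp₂ f g 0
    rw [form_eq hf hg, form_eq hg hf, map_sum]
    refine Finset.sum_congr rfl fun v _ => ?_
    rw [map_sum]
    exact Finset.sum_congr rfl fun t _ => inner_conj_symm _ _
  re_inner_nonneg f := by
    obtain ⟨R, n, hf⟩ := exists_supp f
    rw [form_eq hf hf, map_sum]
    refine Finset.sum_nonneg fun v _ => ?_
    rw [map_sum]
    exact Finset.sum_nonneg fun t _ => inner_self_nonneg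
  add_left f g h := by
    classical
    obtain ⟨R, n, hf, hg, -⟩ := exists_supp₂ f g 0
    obtain ⟨R', n', hh⟩ := exists_supp h
    have hf' := hf.mono (R' := R ∪ R') (n' := n ⊔ n') Finset.subset_union_left le_sup_left
    have hg' := hg.mono (R' := R ∪ R') (n' := n ⊔ n') Finset.subset_union_left le_sup_left
    have hh' := hh.mono (R' := R ∪ R') (n' := n ⊔ n') Finset.subset_union_right le_sup_right
    have hfg : (f + g).Supp (R ∪ R') (n ⊔ n') := fun l hl => by
      rcases Finset.mem_union.1 (Finsupp.support_add hl) with h1 | h1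
      · exact hf' l h1
      · exact hg' l h1
    rw [form_eq hfg hh', form_eq hf' hh', form_eq hg' hh', ← Finset.sum_add_distrib]
    refine Finset.sum_congr rfl fun v _ => ?_
    rw [← Finset.sum_add_distrib]
    exact Finset.sum_congr rfl fun t _ => by rw [map_add, inner_add_left]
  smul_left f g c := by
    obtain ⟨R, n, hf, hg, -⟩ := exists_supp₂ f g 0
    have hcf : (c • f).Supp R n := fun l hl => hf l (Finsupp.support_smul hl)
    rw [form_eq hcf hg, form_eq hf hg, Finset.mul_sum]
    refine Finset.sum_congr rfl fun v _ => ?_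
    rw [Finset.mul_sum]
    exact Finset.sum_congr rfl fun t _ => by rw [map_smul, inner_smul_left]

noncomputable instance : SeminormedAddCommGroup M.PreL :=
  InnerProductSpace.Core.toSeminormedAddCommGroup (𝕜 := ℂ)

noncomputable instance : InnerProductSpace ℂ M.PreL := InnerProductSpace.ofCore inferInstance

theorem inner_eq_form (f g : M.PreL) : inner ℂ f g = form f g := rfl

theorem inner_br (l m : Λ.Path) (ξ η : M.H) :
    inner ℂ (br l ξ) (br m η) = M.brInner l ξ m η := by
  rw [inner_eq_form, form]
  unfold br
  rw [Finsupp.sum_single_index, Finsupp.sum_single_index]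
  · simp [brInner]
  · rw [Finsupp.sum_single_index] <;> simp [brInner]

end PreL

end Mod

end KGraph

namespace KGraph
open CategoryTheory
variable {k : ℕ} {Λ : KGraph.{u} k} [Λ.RowFinite]
namespace Mod

theorem quotOp_mul_mul (M : Λ.Mod) {m l t : Λ.Path} (hl : Λ.src m = Λ.rng l)
    (ht : Λ.src m = Λ.rng t) : M.quotOp (Λ.mul m l) (Λ.mul m t) = M.quotOp l t := by
  by_cases h : ∃ n, Λ.src l = Λ.rng n ∧ Λ.mul l n = t
  · obtain ⟨n, hn, rfl⟩ := h
    rw [← mul_assoc' hl hn, M.quotOp_mul hn, M.quotOp_mul (by rw [src_mul hl, hn])]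
  · rw [M.quotOp_eq_zero h, quotOp_eq_zero]
    rintro ⟨n, hn, hmn⟩
    rw [src_mul hl] at hn
    rw [mul_assoc' hl hn] at hmn
    exact h ⟨n, hn, mul_left_cancel' (by rw [rng_mul, hl]) ht hmn⟩

theorem brInner_rng_ne (M : Λ.Mod) {l m : Λ.Path} (h : Λ.rng l ≠ Λ.rng m) (ξ η : M.H) :
    M.brInner l ξ m η = 0 := by
  refine Finset.sum_eq_zero fun t ht => ?_
  rw [M.quotOp_rng_ne (l := m) (by rw [(mem_le.1 ht).1]; exact h.symm)]
  simp

variable [Λ.LocallyConvex]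

theorem brInner_mul_mul (M : Λ.Mod) {m l l' : Λ.Path} (hl : Λ.src m = Λ.rng l)
    (hl' : Λ.src m = Λ.rng l') (ξ η : M.H) :
    M.brInner (Λ.mul m l) ξ (Λ.mul m l') η = M.brInner l ξ l' η := by
  classical
  have h1 : Λ.deg l ≤ Λ.deg l + Λ.deg l' := fun i => Nat.le_add_right _ _
  have h2 : Λ.deg l' ≤ Λ.deg l + Λ.deg l' := fun i => Nat.le_add_left _ _
  rw [M.brInner_eq (n := Λ.deg m + (Λ.deg l + Λ.deg l')) (by rw [deg_mul hl]; gcongr)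
    (by rw [deg_mul hl']; gcongr), M.brInner_eq h1 h2, rng_mul, ← hl]
  have himg : (Λ.le (Λ.src m) (Λ.deg l + Λ.deg l')).image (Λ.mul m) ⊆
      Λ.le (Λ.rng m) (Λ.deg m + (Λ.deg l + Λ.deg l')) := by
    intro t ht
    obtain ⟨t', ht', rfl⟩ := Finset.mem_image.1 ht
    exact (mul_mem_le_iff (mem_le.1 ht').1.symm).2 ht'
  rw [← Finset.sum_subset himg, Finset.sum_image]
  · refine Finset.sum_congr rfl fun t ht => ?_
    rw [M.quotOp_mul_mul hl (mem_le.1 ht).1.symm, M.quotOp_mul_mul hl' (mem_le.1 ht).1.symm]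
  · intro t ht t' ht' heq
    exact mul_left_cancel' (mem_le.1 ht).1.symm (mem_le.1 ht').1.symm heq
  · intro t ht ht'
    rw [M.quotOp_eq_zero (l := Λ.mul m l)]
    · simp
    · rintro ⟨n, hn, rfl⟩
      rw [src_mul hl] at hn
      rw [mul_assoc' hl hn] at ht ht'
      refine ht' (Finset.mem_image.2 ⟨_, (mul_mem_le_iff (by rw [rng_mul, hl])).1 ht, rfl⟩)

namespace PreL

variable {M : Λ.Mod}

theorem br_add (l : Λ.Path) (ξ η : M.H) : br l (ξ + η) = br l ξ + br l η :=
  Finsupp.single_add l ξ η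

theorem br_smul (l : Λ.Path) (c : ℂ) (ξ : M.H) : br l (c • ξ) = c • br l ξ :=
  (Finsupp.smul_single c l ξ).symm

variable (M) in
/-- `ξ ↦ (l, ξ)` as a linear map. -/
noncomputable def brL (l : Λ.Path) : M.H →ₗ[ℂ] M.PreL where
  toFun ξ := br l ξ
  map_add' := br_add l
  map_smul' := br_smul l

open Classical in
variable (M) in
/-- The shift `(l, ξ) ↦ (m ∘ l, ξ)`, where `(l, ξ) ↦ 0` if `m` and `l` are not composable. -/
noncomputable def shift (m : Λ.Path) : M.PreL →ₗ[ℂ] M.PreL :=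
  Finsupp.lsum (M := M.H) ℂ fun l =>
    if Λ.src m = Λ.rng l then brL M (Λ.mul m l) else 0

theorem shift_br {m l : Λ.Path} (h : Λ.src m = Λ.rng l) (ξ : M.H) :
    shift M m (br l ξ) = br (Λ.mul m l) ξ := by
  refine (Finsupp.lsum_single (R := ℂ) (S := ℂ) (M := M.H) _ l ξ).trans ?_
  rw [if_pos h]; rfl

theorem shift_br_of_ne {m l : Λ.Path} (h : Λ.src m ≠ Λ.rng l) (ξ : M.H) :
    shift M m (br l ξ) = 0 := by
  refine (Finsupp.lsum_single (R := ℂ) (S := ℂ) (M := M.H) _ l ξ).trans ?_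
  rw [if_neg h]; rfl

theorem shift_vert_br (l : Λ.Path) (ξ : M.H) :
    shift M (Λ.vert (Λ.rng l)) (br l ξ) = br l ξ := by
  rw [shift_br (Λ.src_vert _), vert_mul rfl]

theorem shift_vert_br_of_ne {v : Λ.Vertex} {l : Λ.Path} (h : v ≠ Λ.rng l) (ξ : M.H) :
    shift M (Λ.vert v) (br l ξ) = 0 :=
  shift_br_of_ne (by rw [Λ.src_vert]; exact h) ξ

theorem linearMap_ext {N : Type*} [AddCommGroup N] [Module ℂ N] {f g : M.PreL →ₗ[ℂ] N}
    (h : ∀ l ξ, f (br l ξ) = g (br l ξ)) : f = g :=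
  Finsupp.lhom_ext (M := M.H) h

theorem sesq_ext {B B' : M.PreL → M.PreL → ℂ} (h0 : ∀ g, B 0 g = B' 0 g)
    (h0' : ∀ f, B f 0 = B' f 0)
    (ha : ∀ f f' g, B f g = B' f g → B f' g = B' f' g → B (f + f') g = B' (f + f') g)
    (ha' : ∀ f g g', B f g = B' f g → B f g' = B' f g' → B f (g + g') = B' f (g + g'))
    (hb : ∀ l ξ m η, B (br l ξ) (br m η) = B' (br l ξ) (br m η)) (f g : M.PreL) :
    B f g = B' f g := by
  refine induction f (h0 g) (fun f f' => ha f f' g) fun l ξ => ?_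
  exact induction g (h0' _) (fun g g' => ha' _ g g') fun m η => hb l ξ m η

theorem inner_shift_vert (v : Λ.Vertex) (f g : M.PreL) :
    inner ℂ (shift M (Λ.vert v) f) g = inner ℂ f (shift M (Λ.vert v) g) := by
  refine sesq_ext (B := fun f g => inner ℂ (shift M (Λ.vert v) f) g)
    (B' := fun f g => inner ℂ f (shift M (Λ.vert v) g)) ?_ ?_ ?_ ?_ ?_ f g
  · intro g; simp
  · intro f; simp
  · intro f f' g h h'; simp only [map_add, inner_add_left, h, h']
  · intro f g g' h h'; simp only [map_add, inner_add_right, h, h']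
  · intro l ξ m η
    by_cases h1 : v = Λ.rng l
    · subst h1
      rw [shift_vert_br]
      by_cases h2 : Λ.rng l = Λ.rng m
      · rw [h2, shift_vert_br]
      · rw [shift_vert_br_of_ne h2, inner_zero_right, inner_br, M.brInner_rng_ne h2]
    · rw [shift_vert_br_of_ne h1, inner_zero_left]
      by_cases h2 : v = Λ.rng m
      · subst h2
        rw [shift_vert_br, inner_br, M.brInner_rng_ne (Ne.symm h1)]
      · rw [shift_vert_br_of_ne h2, inner_zero_right]

theorem inner_shift_shift (m : Λ.Path) (f g : M.PreL) :
    inner ℂ (shift M m f) (shift M m g) = inner ℂ f (shift M (Λ.vert (Λ.src m)) g) := by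
  refine sesq_ext (B := fun f g => inner ℂ (shift M m f) (shift M m g))
    (B' := fun f g => inner ℂ f (shift M (Λ.vert (Λ.src m)) g)) ?_ ?_ ?_ ?_ ?_ f g
  · intro g; simp
  · intro f; simp
  · intro f f' g h h'; simp only [map_add, inner_add_left, h, h']
  · intro f g g' h h'; simp only [map_add, inner_add_right, h, h']
  · intro l ξ l' η
    by_cases h2 : Λ.src m = Λ.rng l'
    · rw [h2, shift_vert_br, shift_br h2]
      by_cases h1 : Λ.src m = Λ.rng l
      · rw [shift_br h1, inner_br, inner_br, M.brInner_mul_mul h1 h2]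
      · rw [shift_br_of_ne h1, inner_zero_left, inner_br, M.brInner_rng_ne]
        rw [← h2]; exact Ne.symm h1
    · rw [shift_br_of_ne h2, shift_vert_br_of_ne h2, inner_zero_right, inner_zero_right]

theorem shift_vert_idem (v : Λ.Vertex) (f : M.PreL) :
    shift M (Λ.vert v) (shift M (Λ.vert v) f) = shift M (Λ.vert v) f := by
  have : shift M (Λ.vert v) ∘ₗ shift M (Λ.vert v) = shift M (Λ.vert v) := by
    refine linearMap_ext fun l ξ => ?_
    rw [LinearMap.comp_apply]
    by_cases h1 : v = Λ.rng l
    · subst h1; rw [shift_vert_br, shift_vert_br]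
    · rw [shift_vert_br_of_ne h1, map_zero]
  exact LinearMap.congr_fun this f

theorem norm_shift_le (m : Λ.Path) (f : M.PreL) : ‖shift M m f‖ ≤ ‖f‖ := by
  have h1 : ‖shift M m f‖ ^ 2 = ‖shift M (Λ.vert (Λ.src m)) f‖ ^ 2 := by
    rw [← inner_self_eq_norm_sq (𝕜 := ℂ), ← inner_self_eq_norm_sq (𝕜 := ℂ), inner_shift_shift,
      inner_shift_vert, shift_vert_idem]
  have h2 : ‖shift M (Λ.vert (Λ.src m)) f‖ ^ 2 ≤ ‖f‖ * ‖shift M (Λ.vert (Λ.src m)) f‖ := by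
    rw [← inner_self_eq_norm_sq (𝕜 := ℂ), inner_shift_vert, shift_vert_idem]
    exact re_inner_le_norm _ _
  have h3 := norm_nonneg (shift M m f)
  have h4 := norm_nonneg (shift M (Λ.vert (Λ.src m)) f)
  have h5 := norm_nonneg f
  by_contra! h
  have : ‖shift M m f‖ = ‖shift M (Λ.vert (Λ.src m)) f‖ := by
    rwa [sq_eq_sq₀ h3 h4] at h1
  rw [this] at h
  nlinarith

variable (M) in
/-- The shift as a bounded operator. -/
noncomputable def shiftL (m : Λ.Path) : M.PreL →L[ℂ] M.PreL :=
  LinearMap.mkContinuous (shift M m) 1 fun f => by rw [one_mul]; exact norm_shift_le m f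

theorem shiftL_apply (m : Λ.Path) (f : M.PreL) : shiftL M m f = shift M m f := rfl

theorem shift_shift {l m : Λ.Path} (h : Λ.src l = Λ.rng m) (f : M.PreL) :
    shift M l (shift M m f) = shift M (Λ.mul l m) f := by
  have : shift M l ∘ₗ shift M m = shift M (Λ.mul l m) := by
    refine linearMap_ext fun n ξ => ?_
    rw [LinearMap.comp_apply]
    by_cases h1 : Λ.src m = Λ.rng n
    · rw [shift_br h1, shift_br (by rw [rng_mul, h]), shift_br (by rw [src_mul h, h1]),
        mul_assoc' h h1]
    · rw [shift_br_of_ne h1, map_zero, shift_br_of_ne (by rw [src_mul h]; exact h1)]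
  exact LinearMap.congr_fun this f

theorem inner_shift_ne {l m : Λ.Path} (hd : Λ.deg l = Λ.deg m) (h : l ≠ m) (f g : M.PreL) :
    inner ℂ (shift M l f) (shift M m g) = 0 := by
  refine sesq_ext (B := fun f g => inner ℂ (shift M l f) (shift M m g))
    (B' := fun f g => 0) ?_ ?_ ?_ ?_ ?_ f g
  · intro g; simp
  · intro f; simp
  · intro f f' g h h'; simp only [map_add, inner_add_left, h, h', add_zero]
  · intro f g g' h h'; simp only [map_add, inner_add_right, h, h', add_zero]
  · intro a ξ b η
    by_cases h1 : Λ.src l = Λ.rng a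
    · by_cases h2 : Λ.src m = Λ.rng b
      · rw [shift_br h1, shift_br h2, inner_br]
        refine Finset.sum_eq_zero fun t _ => ?_
        by_cases h3 : ∃ n, Λ.src (Λ.mul l a) = Λ.rng n ∧ Λ.mul (Λ.mul l a) n = t
        · rw [M.quotOp_eq_zero (l := Λ.mul m b), zero_apply, inner_zero_right]
          rintro ⟨p, hp, rfl⟩
          obtain ⟨n, hn, hnp⟩ := h3
          rw [src_mul h1] at hn
          rw [src_mul h2] at hp
          rw [mul_assoc' h1 hn, mul_assoc' h2 hp] at hnp
          exact h (factor_unique (by rw [rng_mul, h1]) (by rw [rng_mul, h2]) hnp hd).1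
        · rw [M.quotOp_eq_zero h3, zero_apply, inner_zero_left]
      · rw [shift_br_of_ne h2, inner_zero_right]
    · rw [shift_br_of_ne h1, inner_zero_left]

theorem norm_sq_eq {f : M.PreL} {R : Finset Λ.Vertex} {n : Fin k → ℕ} (hf : f.Supp R n) :
    ‖f‖ ^ 2 = ∑ v ∈ R, ∑ t ∈ Λ.le v n, ‖ext M t f‖ ^ 2 := by
  rw [← inner_self_eq_norm_sq (𝕜 := ℂ), inner_eq_form, form_eq hf hf, map_sum]
  refine Finset.sum_congr rfl fun v _ => ?_
  rw [map_sum]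
  exact Finset.sum_congr rfl fun t _ => inner_self_eq_norm_sq _

theorem quotOp_caret {v : Λ.Vertex} {n : Fin k → ℕ} {l t : Λ.Path} {i : Fin k}
    (hn : Λ.deg l + e i ≤ n) (ht : t ∈ Λ.le v n) :
    ∑ a ∈ Λ.caret (Λ.src l) i, M.quotOp (Λ.mul l a) t * M.A a = M.quotOp l t := by
  by_cases hE : Λ.HasEdge (Λ.src l) i
  · by_cases h : ∃ n, Λ.src l = Λ.rng n ∧ Λ.mul l n = t
    · obtain ⟨p, hp, rfl⟩ := h
      have hle : Λ.deg l ≤ n := le_trans (fun i => Nat.le_add_right _ _) hn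
      have hv : v = Λ.rng l := by rw [← (mem_le.1 ht).1, rng_mul]
      have hp' : p ∈ Λ.le (Λ.src l) (n - Λ.deg l) := by
        rw [← mul_mem_le_iff hp, add_tsub_cancel_of_le hle, ← hv]; exact ht
      have hpos : 0 < Λ.deg p i := by
        refine deg_pos_of_mem_le hp' ?_ hE
        have : Λ.deg l i + (e i : Fin k → ℕ) i ≤ n i := hn i
        rw [e_self] at this
        simp only [Pi.sub_apply]
        omega
      obtain ⟨a, b, hab, rfl, ha⟩ := exists_factor_le p (e i) (e_le_iff.2 hpos)
      rw [rng_mul] at hp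
      have hmem : a ∈ Λ.caret (Λ.src l) i := mem_caret.2 ⟨hp.symm, Or.inl ha⟩
      rw [Finset.sum_eq_single_of_mem a hmem]
      · rw [← mul_assoc' hp hab, M.quotOp_mul (by rw [src_mul hp, hab]), mul_assoc' hp hab,
          M.quotOp_mul (by rw [rng_mul, hp]), M.isModFamily.mul' hab]
      · intro a' ha' hne
        obtain ⟨h1, h2⟩ := mem_caret.1 ha'
        have h3 : Λ.deg a' = e i := by
          rcases h2 with h2 | h2
          · exact h2
          · exact absurd hE h2.1
        rw [M.quotOp_eq_zero, zero_mul]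
        rintro ⟨q, hq, hqe⟩
        rw [src_mul h1.symm] at hq
        rw [mul_assoc' h1.symm hq] at hqe
        have := mul_left_cancel' (by rw [rng_mul, h1]) (by rw [rng_mul, hp]) hqe
        exact hne (factor_unique hq hab this (by rw [h3, ha])).1
    · rw [M.quotOp_eq_zero h]
      refine Finset.sum_eq_zero fun a ha => ?_
      have h1 := rng_of_mem_caret ha
      rw [M.quotOp_eq_zero, zero_mul]
      rintro ⟨q, hq, rfl⟩
      rw [src_mul h1.symm] at hq
      exact h ⟨Λ.mul a q, by rw [rng_mul, h1], (mul_assoc' h1.symm hq).symm⟩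
  · have hc : Λ.caret (Λ.src l) i = {Λ.vert (Λ.src l)} := by
      rw [caret, if_neg]; rwa [edges_nonempty]
    rw [hc, Finset.sum_singleton, mul_vert rfl]
    by_cases h : ∃ n, Λ.src l = Λ.rng n ∧ Λ.mul l n = t
    · obtain ⟨p, hp, rfl⟩ := h
      rw [M.quotOp_mul hp, hp, M.isModFamily.mul_vert_rng]
    · rw [M.quotOp_eq_zero h, zero_mul]

theorem norm_caret (l : Λ.Path) (i : Fin k) (ξ : M.H) :
    ‖br l ξ - ∑ a ∈ Λ.caret (Λ.src l) i, br (Λ.mul l a) (M.A a ξ)‖ = 0 := by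
  obtain ⟨R, n, hf, -, hn⟩ := exists_supp₂
    (br l ξ - ∑ a ∈ Λ.caret (Λ.src l) i, br (Λ.mul l a) (M.A a ξ)) 0 (Λ.deg l + e i)
  rw [← sq_eq_zero_iff, norm_sq_eq hf]
  refine Finset.sum_eq_zero fun v _ => Finset.sum_eq_zero fun t ht => ?_
  rw [map_sub, map_sum]
  simp only [ext_br]
  have h1 := congrArg (fun T : M.H →L[ℂ] M.H => T ξ) (quotOp_caret (M := M) hn ht)
  simp only [sum_apply, mul_apply_eq_comp] at h1
  rw [h1, sub_self, norm_zero, zero_pow two_ne_zero]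

/-- The map `(l, ξ) ↦ (l, θ ξ)`. -/
noncomputable def map {M N : Λ.Mod} (θ : M ⟶ N) : M.PreL →ₗ[ℂ] N.PreL :=
  Finsupp.mapRange.linearMap (M := M.H) (N := N.H) (θ.f : M.H →ₗ[ℂ] N.H)

theorem map_br {M N : Λ.Mod} (θ : M ⟶ N) (l : Λ.Path) (ξ : M.H) :
    map θ (br l ξ) = br l (θ.f ξ) :=
  Finsupp.mapRange_single (M := M.H) (N := N.H) (hf := map_zero θ.f)

theorem quotOp_hom {M N : Λ.Mod} (θ : M ⟶ N) (l t : Λ.Path) (ξ : M.H) :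
    N.quotOp l t (θ.f ξ) = θ.f (M.quotOp l t ξ) := by
  by_cases h : ∃ n, Λ.src l = Λ.rng n ∧ Λ.mul l n = t
  · obtain ⟨p, hp, rfl⟩ := h
    rw [N.quotOp_mul hp, M.quotOp_mul hp]
    exact (DFunLike.congr_fun (θ.comm p) ξ).symm
  · rw [N.quotOp_eq_zero h, M.quotOp_eq_zero h, zero_apply, zero_apply, map_zero]

theorem ext_map {M N : Λ.Mod} (θ : M ⟶ N) (t : Λ.Path) (f : M.PreL) :
    ext N t (map θ f) = θ.f (ext M t f) := by
  have : ext N t ∘ₗ map θ = (θ.f : M.H →ₗ[ℂ] N.H) ∘ₗ ext M t := by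
    refine linearMap_ext fun l ξ => ?_
    simp only [LinearMap.comp_apply, map_br, ext_br]
    exact quotOp_hom θ l t ξ
  exact LinearMap.congr_fun this f

theorem norm_map_le {M N : Λ.Mod} (θ : M ⟶ N) (f : M.PreL) : ‖map θ f‖ ≤ ‖θ.f‖ * ‖f‖ := by
  classical
  obtain ⟨R, n, hf⟩ := exists_supp f
  have hf' : (map θ f).Supp R n := fun l hl =>
    hf l (Finsupp.support_mapRange (M := M.H) (N := N.H) (hf := map_zero θ.f) hl)
  refine le_of_sq_le_sq ?_ (by positivity)
  rw [mul_pow, norm_sq_eq hf, norm_sq_eq hf', Finset.mul_sum]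
  refine Finset.sum_le_sum fun v _ => ?_
  rw [Finset.mul_sum]
  refine Finset.sum_le_sum fun t _ => ?_
  rw [ext_map, ← mul_pow]
  gcongr
  exact θ.f.le_opNorm _

/-- The map `(l, ξ) ↦ (l, θ ξ)` as a bounded operator. -/
noncomputable def mapL {M N : Λ.Mod} (θ : M ⟶ N) : M.PreL →L[ℂ] N.PreL :=
  LinearMap.mkContinuous (map θ) ‖θ.f‖ (norm_map_le θ)

theorem mapL_apply {M N : Λ.Mod} (θ : M ⟶ N) (f : M.PreL) : mapL θ f = map θ f := rfl

end PreL
end Mod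
end KGraph

namespace KGraph
open CategoryTheory
variable {k : ℕ} {Λ : KGraph.{u} k} [Λ.RowFinite] [Λ.LocallyConvex]
namespace Mod

open UniformSpace

/-- The Hilbert space `L` of the dilation of `M`: the Hausdorff completion of the space of sums of
decorated paths, i.e. the completion of its quotient by the vectors of norm zero. -/
abbrev Dil (M : Λ.Mod) : Type u := Completion M.PreL

variable (M : Λ.Mod)

variable {M} in
/-- The class `[l, ξ]` of a decorated path. -/
noncomputable def cls (l : Λ.Path) (ξ : M.H) : M.Dil := ((PreL.br l ξ : M.PreL) : Completion M.PreL)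

/-- The operator `X_m` on `L`, with `X_m [l, ξ] = [m ∘ l, ξ]` if `m` and `l` are composable and
`X_m [l, ξ] = 0` otherwise. -/
noncomputable def dilX (m : Λ.Path) : M.Dil →L[ℂ] M.Dil := (PreL.shiftL M m).completion

theorem dilX_coe (m : Λ.Path) (f : M.PreL) :
    M.dilX m (f : Completion M.PreL) = ((PreL.shift M m f : M.PreL) : Completion M.PreL) :=
  ContinuousLinearMap.completion_apply_coe _ _

theorem dilX_cls {m l : Λ.Path} (h : Λ.src m = Λ.rng l) (ξ : M.H) :
    M.dilX m (cls l ξ) = cls (Λ.mul m l) ξ := by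
  rw [cls, dilX_coe, PreL.shift_br h, cls]

theorem dilX_cls_of_ne {m l : Λ.Path} (h : Λ.src m ≠ Λ.rng l) (ξ : M.H) :
    M.dilX m (cls l ξ) = 0 := by
  rw [cls, dilX_coe, PreL.shift_br_of_ne h, Completion.coe_zero]

variable {M} in
theorem dil_induction {p : M.Dil → Prop} (x : M.Dil) (hc : IsClosed {x | p x}) (h0 : p 0)
    (ha : ∀ x y, p x → p y → p (x + y)) (hb : ∀ l ξ, p (cls l ξ)) : p x := by
  refine Completion.induction_on x hc fun f => ?_
  refine PreL.induction (p := fun f : M.PreL => p (f : Completion M.PreL)) f ?_ ?_ hb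
  · rw [Completion.coe_zero]; exact h0
  · intro f g hf hg; rw [Completion.coe_add]; exact ha _ _ hf hg

variable {M} in
theorem dil_ext {F : Type*} [NormedAddCommGroup F] [NormedSpace ℂ F] {S T : M.Dil →L[ℂ] F}
    (h : ∀ l ξ, S (cls l ξ) = T (cls l ξ)) : S = T := by
  ext x
  refine dil_induction x (isClosed_eq S.continuous T.continuous) ?_ ?_ h
  · rw [map_zero, map_zero]
  · intro x y hx hy; rw [map_add, map_add, hx, hy]

variable {M} in
theorem dil_inner_ext {S T S' T' : M.Dil →L[ℂ] M.Dil}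
    (h : ∀ f g : M.PreL, inner ℂ (S (f : Completion M.PreL)) (T (g : Completion M.PreL)) =
      inner ℂ (S' (f : Completion M.PreL)) (T' (g : Completion M.PreL))) (x y : M.Dil) :
    inner ℂ (S x) (T y) = inner ℂ (S' x) (T' y) := by
  refine Completion.induction_on₂ x y (isClosed_eq ?_ ?_) h
  · exact Continuous.inner (S.continuous.comp continuous_fst) (T.continuous.comp continuous_snd)
  · exact Continuous.inner (S'.continuous.comp continuous_fst) (T'.continuous.comp continuous_snd)

theorem star_dilX_mul_dilX (m : Λ.Path) :
    star (M.dilX m) * M.dilX m = M.dilX (Λ.vert (Λ.src m)) := by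
  refine ContinuousLinearMap.ext fun y => ext_inner_left ℂ fun x => ?_
  rw [mul_apply_eq_comp, ContinuousLinearMap.star_eq_adjoint,
    ContinuousLinearMap.adjoint_inner_right]
  refine dil_inner_ext (S := M.dilX m) (T := M.dilX m) (S' := ContinuousLinearMap.id ℂ M.Dil)
    (T' := M.dilX (Λ.vert (Λ.src m))) (fun f g => ?_) x y
  rw [ContinuousLinearMap.id_apply, dilX_coe, dilX_coe, dilX_coe, Completion.inner_coe,
    Completion.inner_coe, PreL.inner_shift_shift]

theorem star_dilX_mul_ne {l m : Λ.Path} (hd : Λ.deg l = Λ.deg m) (h : l ≠ m) :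
    star (M.dilX l) * M.dilX m = 0 := by
  refine ContinuousLinearMap.ext fun y => ext_inner_left ℂ fun x => ?_
  rw [mul_apply_eq_comp, ContinuousLinearMap.star_eq_adjoint,
    ContinuousLinearMap.adjoint_inner_right]
  refine dil_inner_ext (S := M.dilX l) (T := M.dilX m) (S' := ContinuousLinearMap.id ℂ M.Dil)
    (T' := 0) (fun f g => ?_) x y
  rw [ContinuousLinearMap.id_apply, dilX_coe, dilX_coe, zero_apply, inner_zero_right,
    Completion.inner_coe, PreL.inner_shift_ne hd h]

theorem dilX_mul {l m : Λ.Path} (h : Λ.src l = Λ.rng m) :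
    M.dilX l * M.dilX m = M.dilX (Λ.mul l m) := by
  refine ContinuousLinearMap.ext fun x => ?_
  refine Completion.induction_on x (isClosed_eq (ContinuousLinearMap.continuous _)
    (ContinuousLinearMap.continuous _)) fun f => ?_
  rw [mul_apply_eq_comp, dilX_coe, dilX_coe, dilX_coe, PreL.shift_shift h]

theorem dilX_vert_proj (v : Λ.Vertex) : IsStarProjection (M.dilX (Λ.vert v)) := by
  have h := M.star_dilX_mul_dilX (Λ.vert v)
  rw [Λ.src_vert] at h
  refine ⟨?_, ?_⟩
  · rw [IsIdempotentElem, M.dilX_mul (by rw [Λ.src_vert, Λ.rng_vert]),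
      vert_mul (Λ.rng_vert _).symm]
  · rw [IsSelfAdjoint, ← h, star_mul, star_star]

variable {M} in
theorem coe_eq_of_norm_sub {f g : M.PreL} (h : ‖f - g‖ = 0) :
    (f : Completion M.PreL) = (g : Completion M.PreL) := by
  have h' : ‖((f - g : M.PreL) : Completion M.PreL)‖ = 0 := by
    rw [Completion.norm_coe]; exact h
  rw [Completion.coe_sub] at h'
  exact sub_eq_zero.1 (norm_eq_zero.1 h')

/-- The caret relation. -/
theorem cls_caret (l : Λ.Path) (i : Fin k) (ξ : M.H) :
    (cls l ξ : M.Dil) = ∑ a ∈ Λ.caret (Λ.src l) i, cls (Λ.mul l a) (M.A a ξ) := by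
  have h := PreL.norm_caret (M := M) l i ξ
  have h2 := coe_eq_of_norm_sub h
  rw [cls, h2]
  exact map_sum (Completion.toComplL (𝕜 := ℂ) (E := M.PreL)) _ _

variable {M} in
theorem cls_add (l : Λ.Path) (ξ η : M.H) : (cls l (ξ + η) : M.Dil) = cls l ξ + cls l η := by
  rw [cls, PreL.br_add, Completion.coe_add]; rfl

theorem cls_vert (l : Λ.Path) (ξ : M.H) :
    (cls l (M.A (Λ.vert (Λ.src l)) ξ) : M.Dil) = cls l ξ := by
  have h : ‖(PreL.br l (M.A (Λ.vert (Λ.src l)) ξ) : M.PreL) - PreL.br l ξ‖ = 0 := by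
    obtain ⟨R, n, hf⟩ := PreL.exists_supp
      ((PreL.br l (M.A (Λ.vert (Λ.src l)) ξ) : M.PreL) - PreL.br l ξ)
    rw [← sq_eq_zero_iff, PreL.norm_sq_eq hf]
    refine Finset.sum_eq_zero fun v _ => Finset.sum_eq_zero fun t ht => ?_
    have h1 : M.quotOp l t * M.A (Λ.vert (Λ.src l)) = M.quotOp l t := by
      by_cases h : ∃ n, Λ.src l = Λ.rng n ∧ Λ.mul l n = t
      · obtain ⟨p, hp, rfl⟩ := h
        rw [M.quotOp_mul hp, hp, M.isModFamily.mul_vert_rng]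
      · rw [M.quotOp_eq_zero h, zero_mul]
    rw [map_sub, PreL.ext_br, PreL.ext_br, ← mul_apply_eq_comp, h1, sub_self, norm_zero,
      zero_pow two_ne_zero]
  exact coe_eq_of_norm_sub h

theorem cls_expand (l : Λ.Path) (n : Fin k → ℕ) (ξ : M.H) :
    (cls l ξ : M.Dil) = ∑ a ∈ Λ.le (Λ.src l) n, cls (Λ.mul l a) (M.A a ξ) := by
  refine nk_induction (n₀ := 0) (p := fun n => (cls l ξ : M.Dil) =
    ∑ a ∈ Λ.le (Λ.src l) n, cls (Λ.mul l a) (M.A a ξ)) ?_ ?_ n (fun _ => Nat.zero_le _)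
  · rw [le_zero, Finset.sum_singleton, mul_vert rfl, cls_vert]
  · intro n i _ ih
    rw [sum_le_add, ih]
    refine Finset.sum_congr rfl fun t ht => ?_
    have hr := (mem_le.1 ht).1
    rw [M.cls_caret (Λ.mul l t) i, src_mul hr.symm]
    refine Finset.sum_congr rfl fun a ha => ?_
    rw [mul_assoc' hr.symm (rng_of_mem_caret ha).symm,
      M.isModFamily.mul' (rng_of_mem_caret ha).symm]
    rfl

theorem star_dilX_eq (m : Λ.Path) :
    star (M.dilX m) = star (M.dilX m) * M.dilX (Λ.vert (Λ.rng m)) := by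
  have h : M.dilX m = M.dilX (Λ.vert (Λ.rng m)) * M.dilX m := by
    rw [M.dilX_mul (Λ.src_vert _), vert_mul rfl]
  conv_lhs => rw [h]
  rw [star_mul, (M.dilX_vert_proj _).isSelfAdjoint.star_eq]

theorem dilX_sum (v : Λ.Vertex) (i : Fin k) (h : (Λ.edges v i).Nonempty) :
    M.dilX (Λ.vert v) = ∑ l ∈ Λ.edges v i, M.dilX l * star (M.dilX l) := by
  have hE := edges_nonempty.1 h
  have key : ∀ m ∈ Λ.edges v i,
      (∑ l ∈ Λ.edges v i, M.dilX l * star (M.dilX l)) * M.dilX m = M.dilX m := by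
    intro m hm
    rw [Finset.sum_mul, Finset.sum_eq_single_of_mem m hm]
    · rw [mul_assoc, star_dilX_mul_dilX, M.dilX_mul (Λ.rng_vert _).symm, mul_vert rfl]
    · intro l hl hlm
      rw [mul_assoc, M.star_dilX_mul_ne _ hlm, mul_zero]
      rw [(mem_edges.1 hl).2, (mem_edges.1 hm).2]
  refine dil_ext fun l ξ => ?_
  by_cases hv : v = Λ.rng l
  · rw [M.dilX_cls (by rw [Λ.src_vert, hv]), vert_mul hv, M.cls_caret l i, map_sum]
    refine Finset.sum_congr rfl fun a ha => ?_
    have hr := (rng_of_mem_caret ha).symm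
    have hmem : Λ.mul l a ∈ Λ.le v (Λ.deg l + e i) := by
      rw [hv]; exact mul_mem_le (self_mem_le l) ha
    obtain ⟨m, b, hmb, hmb', hm⟩ := exists_factor_le (Λ.mul l a) (e i)
      (e_le_iff.2 (deg_pos_of_mem_le hmem (by simp [e_self]) hE))
    have hm' : m ∈ Λ.edges v i :=
      mem_edges.2 ⟨by rw [hv, ← rng_mul l a, ← hmb', rng_mul], hm⟩
    rw [← hmb', ← M.dilX_cls hmb, ← mul_apply_eq_comp, key m hm']
  · rw [M.dilX_cls_of_ne (by rw [Λ.src_vert]; exact hv), sum_apply]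
    refine (Finset.sum_eq_zero fun m hm => ?_).symm
    rw [star_dilX_eq, (mem_edges.1 hm).1]
    simp only [mul_apply_eq_comp]
    rw [M.dilX_cls_of_ne (by rw [Λ.src_vert]; exact hv), map_zero, map_zero]

theorem dilX_isOFamily : Λ.IsOFamily M.dilX where
  proj := M.dilX_vert_proj
  orth v w h := by
    refine dil_ext fun l ξ => ?_
    rw [mul_apply_eq_comp, zero_apply]
    by_cases hw : w = Λ.rng l
    · rw [M.dilX_cls (by rw [Λ.src_vert, hw]), vert_mul hw, M.dilX_cls_of_ne]
      rw [Λ.src_vert, ← hw]; exact h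
    · rw [M.dilX_cls_of_ne (by rw [Λ.src_vert]; exact hw), map_zero]
  star_mul_self := M.star_dilX_mul_dilX
  sum := M.dilX_sum
  mul l m h := by rw [M.dilX_mul h, mul_eq h]

theorem sum_dilX_proj (F : Finset Λ.Vertex) :
    IsStarProjection (∑ v ∈ F, M.dilX (Λ.vert v)) := by
  refine ⟨?_, ?_⟩
  · rw [IsIdempotentElem, Finset.sum_mul]
    refine Finset.sum_congr rfl fun v hv => ?_
    rw [Finset.mul_sum, Finset.sum_eq_single_of_mem v hv, (M.dilX_vert_proj v).isIdempotentElem]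
    intro w _ hw
    exact M.dilX_isOFamily.orth _ _ hw.symm
  · rw [IsSelfAdjoint, star_sum]
    exact Finset.sum_congr rfl fun v _ => (M.dilX_vert_proj v).isSelfAdjoint.star_eq

theorem dil_nondegenerate (x : M.Dil) : HasSum (fun v => M.dilX (Λ.vert v) x) x := by
  refine dil_induction (p := fun x : M.Dil => HasSum (fun v => M.dilX (Λ.vert v) x) x) x
    ?_ ?_ ?_ ?_
  · refine isClosed_of_closure_subset fun x hx => ?_
    refine Metric.tendsto_nhds.2 fun ε hε => ?_
    obtain ⟨y, hy, hxy⟩ := Metric.mem_closure_iff.1 hx (ε / 3) (by positivity)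
    filter_upwards [Metric.tendsto_nhds.1 hy (ε / 3) (by positivity)] with F hF
    have h1 := norm_proj_le (M.sum_dilX_proj F) (x - y)
    rw [map_sub, sum_apply, sum_apply] at h1
    rw [dist_eq_norm] at hF hxy ⊢
    have h2 : (∑ v ∈ F, M.dilX (Λ.vert v) x) - x =
        ((∑ v ∈ F, M.dilX (Λ.vert v) x) - ∑ v ∈ F, M.dilX (Λ.vert v) y) +
        ((∑ v ∈ F, M.dilX (Λ.vert v) y) - y) - (x - y) := by abel
    rw [h2]
    refine lt_of_le_of_lt (norm_sub_le _ _) ?_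
    refine lt_of_le_of_lt (add_le_add_left (norm_add_le _ _) _) ?_
    linarith
  · simp
  · intro x y hx hy
    simpa using hx.add hy
  · intro l ξ
    have h := hasSum_single (f := fun v => M.dilX (Λ.vert v) (cls l ξ : M.Dil)) (Λ.rng l)
      fun v hv => M.dilX_cls_of_ne (by rw [Λ.src_vert]; exact hv) ξ
    rwa [M.dilX_cls (Λ.src_vert _), vert_mul rfl] at h

/-- The representation `Π(M)` of `𝒪_Λ` on the dilation of `M`. -/
noncomputable def dilRep (M : Λ.Mod) : Λ.Rep :=
  Rep.ofFamily M.dilX M.dilX_isOFamily M.dil_nondegenerate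

/-- The operator `[l, ξ] ↦ [l, θ ξ]`. -/
noncomputable def dilMap {M N : Λ.Mod} (θ : M ⟶ N) : M.Dil →L[ℂ] N.Dil :=
  (PreL.mapL θ).completion

theorem dilMap_cls {M N : Λ.Mod} (θ : M ⟶ N) (l : Λ.Path) (ξ : M.H) :
    dilMap θ (cls l ξ) = cls l (θ.f ξ) := by
  rw [cls, dilMap, ContinuousLinearMap.completion_apply_coe, PreL.mapL_apply, PreL.map_br, cls]

theorem dilMap_comm {M N : Λ.Mod} (θ : M ⟶ N) (m : Λ.Path) :
    dilMap θ ∘L M.dilX m = N.dilX m ∘L dilMap θ := by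
  refine dil_ext fun l ξ => ?_
  rw [ContinuousLinearMap.comp_apply, ContinuousLinearMap.comp_apply, dilMap_cls]
  by_cases h : Λ.src m = Λ.rng l
  · rw [M.dilX_cls h, N.dilX_cls h, dilMap_cls]
  · rw [M.dilX_cls_of_ne h, N.dilX_cls_of_ne h, map_zero]

theorem star_dilX_cls {m l : Λ.Path} (h : Λ.src m = Λ.rng l) (ξ : M.H) :
    star (M.dilX m) (cls (Λ.mul m l) ξ) = cls l ξ := by
  rw [← M.dilX_cls h, ← mul_apply_eq_comp, star_dilX_mul_dilX,
    M.dilX_cls (by rw [Λ.src_vert, h]), vert_mul h]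

theorem star_dilX_cls_of_not {v : Λ.Vertex} {n : Fin k → ℕ} {m t : Λ.Path} (ht : t ∈ Λ.le v n)
    (hm : Λ.deg m ≤ n) (h : ¬ ∃ c, Λ.src m = Λ.rng c ∧ Λ.mul m c = t) (ξ : M.H) :
    star (M.dilX m) (cls t ξ) = 0 := by
  refine ext_inner_left ℂ fun x => ?_
  rw [ContinuousLinearMap.star_eq_adjoint, ContinuousLinearMap.adjoint_inner_right,
    inner_zero_right]
  refine dil_induction (p := fun x => inner ℂ (M.dilX m x) (cls t ξ) = 0) x
    (isClosed_eq ((M.dilX m).continuous.inner continuous_const) continuous_const) ?_ ?_ ?_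
  · simp
  · intro x y hx hy; rw [map_add, inner_add_left, hx, hy, add_zero]
  · intro l η
    by_cases hl : Λ.src m = Λ.rng l
    · rw [M.dilX_cls hl, cls, cls, Completion.inner_coe, PreL.inner_br]
      refine Finset.sum_eq_zero fun s _ => ?_
      by_cases h1 : ∃ n, Λ.src t = Λ.rng n ∧ Λ.mul t n = s
      · obtain ⟨a, ha, rfl⟩ := h1
        rw [M.quotOp_eq_zero (l := Λ.mul m l), zero_apply, inner_zero_left]
        rintro ⟨b, hb, hab⟩
        rw [src_mul hl] at hb
        rw [mul_assoc' hl hb] at hab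
        exact h (exists_of_mul_eq ht hm ha (by rw [rng_mul, hl]) hab.symm)
      · rw [M.quotOp_eq_zero h1, zero_apply, inner_zero_right]
    · rw [M.dilX_cls_of_ne hl, inner_zero_left]

theorem dilMap_comm_star {M N : Λ.Mod} (θ : M ⟶ N) (m : Λ.Path) :
    dilMap θ ∘L star (M.dilX m) = star (N.dilX m) ∘L dilMap θ := by
  refine dil_ext fun l ξ => ?_
  rw [M.cls_expand l (Λ.deg m), map_sum, map_sum]
  refine Finset.sum_congr rfl fun a ha => ?_
  have hr := (mem_le.1 ha).1
  have hmem : Λ.mul l a ∈ Λ.le (Λ.rng l) (Λ.deg l + Λ.deg m) := (mul_mem_le_iff hr.symm).2 ha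
  have hle : Λ.deg m ≤ Λ.deg l + Λ.deg m := fun i => Nat.le_add_left _ _
  rw [ContinuousLinearMap.comp_apply, ContinuousLinearMap.comp_apply, dilMap_cls]
  by_cases h : ∃ c, Λ.src m = Λ.rng c ∧ Λ.mul m c = Λ.mul l a
  · obtain ⟨c, hc, hcm⟩ := h
    rw [← hcm, M.star_dilX_cls hc, N.star_dilX_cls hc, dilMap_cls]
  · rw [M.star_dilX_cls_of_not hmem hle h, N.star_dilX_cls_of_not hmem hle h, map_zero]

theorem dilMap_comm_all {M N : Λ.Mod} (θ : M ⟶ N) (b : Λ.OAlg) :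
    dilMap θ ∘L M.dilRep.π b = N.dilRep.π b ∘L dilMap θ := by
  let i : Λ.OIndex := ⟨M.Dil, M.dilX, M.dilX_isOFamily⟩
  let j : Λ.OIndex := ⟨N.Dil, N.dilX, N.dilX_isOFamily⟩
  let Φ : M.Dil →L[ℂ] N.Dil := dilMap θ
  have hci : Continuous (OpProd.eval (fun i : Λ.OIndex => i.H) i) :=
    AddMonoidHomClass.continuous_of_bound (OpProd.eval (fun i : Λ.OIndex => i.H) i) 1 fun f => by
      rw [one_mul]; exact OpProd.norm_eval_le _ i f
  have hcj : Continuous (OpProd.eval (fun i : Λ.OIndex => i.H) j) :=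
    AddMonoidHomClass.continuous_of_bound (OpProd.eval (fun i : Λ.OIndex => i.H) j) 1 fun f => by
      rw [one_mul]; exact OpProd.norm_eval_le _ j f
  let E : OpProd (fun i : Λ.OIndex => i.H) → (M.Dil →L[ℂ] M.Dil) :=
    fun f => OpProd.eval (fun i : Λ.OIndex => i.H) i f
  let F : OpProd (fun i : Λ.OIndex => i.H) → (N.Dil →L[ℂ] N.Dil) :=
    fun f => OpProd.eval (fun i : Λ.OIndex => i.H) j f
  have hE : Continuous E := hci
  have hF : Continuous F := hcj
  have hEm : ∀ f g, E (f * g) = E f ∘L E g := fun f g => rfl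
  have hFm : ∀ f g, F (f * g) = F f ∘L F g := fun f g => rfl
  have hEa : ∀ f g, E (f + g) = E f + E g := fun f g => rfl
  have hFa : ∀ f g, F (f + g) = F f + F g := fun f g => rfl
  have hEs : ∀ (c : ℂ) f, E (c • f) = c • E f := fun c f => rfl
  have hFs : ∀ (c : ℂ) f, F (c • f) = c • F f := fun c f => rfl
  have key : Φ ∘L E b.1 = F b.1 ∘L Φ ∧ Φ ∘L E (star b.1) = F (star b.1) ∘L Φ := by
    refine OpProd.gen_induction (p := fun f => Φ ∘L E f = F f ∘L Φ ∧
      Φ ∘L E (star f) = F (star f) ∘L Φ) ?_ ?_ ?_ ?_ ?_ ?_ ?_ b.2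
    · refine (isClosed_eq ?_ ?_).inter (isClosed_eq ?_ ?_)
      · exact continuous_const.clm_comp hE
      · exact hF.clm_comp continuous_const
      · exact continuous_const.clm_comp (hE.comp continuous_star)
      · exact (hF.comp continuous_star).clm_comp continuous_const
    · rintro f ⟨l, rfl⟩
      exact ⟨dilMap_comm θ l, dilMap_comm_star θ l⟩
    · have h0 : Φ ∘L E 0 = F 0 ∘L Φ := by
        have h1 : E 0 = 0 := rfl
        have h2 : F 0 = 0 := rfl
        rw [h1, h2, ContinuousLinearMap.comp_zero, ContinuousLinearMap.zero_comp]
      rw [star_zero]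
      exact ⟨h0, h0⟩
    · rintro f g ⟨h1, h2⟩ ⟨h3, h4⟩
      rw [star_add, hEa, hEa, hFa, hFa]
      simp only [ContinuousLinearMap.comp_add, ContinuousLinearMap.add_comp, h1, h2, h3, h4,
        and_self]
    · rintro f g ⟨h1, h2⟩ ⟨h3, h4⟩
      rw [star_mul, hEm, hEm, hFm, hFm]
      constructor
      · rw [← ContinuousLinearMap.comp_assoc, h1, ContinuousLinearMap.comp_assoc, h3,
          ContinuousLinearMap.comp_assoc]
      · rw [← ContinuousLinearMap.comp_assoc, h4, ContinuousLinearMap.comp_assoc, h2,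
          ContinuousLinearMap.comp_assoc]
    · rintro c f ⟨h1, h2⟩
      rw [star_smul, hEs, hEs, hFs, hFs]
      simp only [ContinuousLinearMap.comp_smul, ContinuousLinearMap.smul_comp, h1, h2, and_self]
    · rintro f ⟨h1, h2⟩
      rw [star_star]
      exact ⟨h2, h1⟩
  exact key.1

theorem dilMap_comp {M N P : Λ.Mod} (φ : M ⟶ N) (ψ : N ⟶ P) :
    dilMap (φ ≫ ψ) = dilMap ψ ∘L dilMap φ := by
  refine dil_ext fun l ξ => ?_
  rw [ContinuousLinearMap.comp_apply, dilMap_cls, dilMap_cls, dilMap_cls]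
  rfl

end Mod

/-- The Pythagorean functor `Π`. -/
noncomputable def Pyth (Λ : KGraph.{u} k) [Λ.RowFinite] [Λ.LocallyConvex] : Λ.Mod ⥤ Λ.Rep where
  obj M := M.dilRep
  map θ := ⟨Mod.dilMap θ, Mod.dilMap_comm_all θ⟩
  map_id _ := Rep.Hom.ext (Mod.dil_ext fun l ξ => Mod.dilMap_cls _ l ξ)
  map_comp φ ψ := Rep.Hom.ext (Mod.dilMap_comp φ ψ)

end KGraph

namespace KGraph
open CategoryTheory
variable {k : ℕ} {Λ : KGraph.{u} k} [Λ.RowFinite] [Λ.LocallyConvex]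

/-! ### The two categories and the two functors -/

/-- `L` has finite Pythagorean dimension. -/
def Rep.HasFinitePDim (L : Λ.Rep) : Prop :=
  ∃ K : Λ.Mod, FiniteDimensional ℂ K.H ∧ Nonempty (L ≅ (Pyth Λ).obj K)

variable (Λ)

/-- The property of modules of being full and finite dimensional. -/
def fullFd : ObjectProperty Λ.Mod := fun M => M.IsFull ∧ FiniteDimensional ℂ M.H

/-- The property of representations of having finite Pythagorean dimension. -/
def pFd : ObjectProperty Λ.Rep := fun L => L.HasFinitePDim

/-- The full subcategory of full finite-dimensional modules. -/
abbrev ModFullFd : Type (u + 1) := Λ.fullFd.FullSubcategory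

/-- The full subcategory of representations of finite Pythagorean dimension. -/
abbrev RepPFd : Type (u + 1) := Λ.pFd.FullSubcategory

/-- The restriction of `Π` to full finite-dimensional modules, with values in the representations of
finite Pythagorean dimension. -/
noncomputable def PythFullFd : Λ.ModFullFd ⥤ Λ.RepPFd :=
  Λ.pFd.lift (Λ.fullFd.ι ⋙ Pyth Λ) fun M => ⟨M.obj, M.property.2, ⟨Iso.refl _⟩⟩

variable {Λ}

/-- The intersection of all complete submodules of `M`; it is the smallest complete submodule of
`M` as soon as `M` has one. -/
def Mod.smallest (M : Λ.Mod) : Submodule ℂ M.H := sInf {K | M.IsCompleteSubmodule K}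

theorem Mod.smallest_isSubmodule (M : Λ.Mod) : M.IsSubmodule M.smallest where
  isClosed := by
    rw [Mod.smallest, Submodule.coe_sInf]
    exact isClosed_biInter fun K hK => hK.1.isClosed
  map_mem l ξ hξ := by
    rw [Mod.smallest, Submodule.mem_sInf] at hξ ⊢
    exact fun K hK => hK.1.map_mem l ξ (hξ K hK)

theorem Mod.smallest_eq {M : Λ.Mod} {K : Submodule ℂ M.H}
    (h : IsLeast {K | M.IsCompleteSubmodule K} K) : M.smallest = K :=
  h.isGLB.sInf_eq

variable (Λ)

/-- `Σ` is well defined: for a representation `L` of finite Pythagorean dimension, regarded as a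
module, there is a smallest complete submodule, this is a full finite-dimensional module, and
morphisms of representations map smallest complete submodules into one another. -/
structure SigmaWellDefined : Prop where
  isLeast : ∀ L : Λ.Rep, L.HasFinitePDim →
    IsLeast {K | ((U Λ).obj L).IsCompleteSubmodule K} ((U Λ).obj L).smallest
  full : ∀ L : Λ.Rep, L.HasFinitePDim →
    (((U Λ).obj L).restrict _ ((U Λ).obj L).smallest_isSubmodule).IsFull
  finiteDimensional : ∀ L : Λ.Rep, L.HasFinitePDim →
    FiniteDimensional ℂ (((U Λ).obj L).restrict _ ((U Λ).obj L).smallest_isSubmodule).H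
  map_mem : ∀ (L K : Λ.Rep) (θ : L ⟶ K), L.HasFinitePDim → K.HasFinitePDim →
    ∀ ξ ∈ ((U Λ).obj L).smallest, ((U Λ).map θ).f ξ ∈ ((U Λ).obj K).smallest

variable {Λ}

/-- The restriction of a morphism of modules to submodules. -/
noncomputable def Mod.restrictMap {M N : Λ.Mod} (θ : M ⟶ N) {K : Submodule ℂ M.H}
    {K' : Submodule ℂ N.H} (hK : M.IsSubmodule K) (hK' : N.IsSubmodule K')
    (h : ∀ ξ ∈ K, θ.f ξ ∈ K') : M.restrict K hK ⟶ N.restrict K' hK' where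
  f := (θ.f ∘L K.subtypeL).codRestrict K' fun ξ => h ξ ξ.2
  comm l := by
    refine ContinuousLinearMap.ext fun ξ => Subtype.ext ?_
    exact DFunLike.congr_fun (θ.comm l) (K.subtype ξ)

/-- The functor `Σ`, which sends a representation `L` to the smallest complete submodule of `L`
regarded as a module, and restricts morphisms. -/
noncomputable def Sigma (h : Λ.SigmaWellDefined) : Λ.RepPFd ⥤ Λ.ModFullFd where
  obj L := ⟨((U Λ).obj L.obj).restrict _ ((U Λ).obj L.obj).smallest_isSubmodule,
    h.full L.obj L.property, h.finiteDimensional L.obj L.property⟩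
  map {L K} θ := ObjectProperty.homMk (Mod.restrictMap ((U Λ).map θ.hom) _ _
    (h.map_mem L.obj K.obj θ.hom L.property K.property))
  map_id _ := rfl
  map_comp _ _ := rfl

end KGraph

open CategoryTheory

/-! The proof rests on the levels `Λ^{≤ n}`. Local convexity makes each level a tree, and a tree `t`
at `v` satisfies Parseval's identity `∑_{m ∈ t} ‖A_m ξ‖² = ‖A_v ξ‖²`. When the module `N` comes from
a representation (`IsDilated`), the adjoints `A_m*` are partial isometries, and those of one level
have orthogonal ranges. Hence, as soon as the level of `t` dominates `d(l)`, the operator `A_t A_l*`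
is `A_c` if `t = l ∘ c` and `0` otherwise.

Consequently a submodule `K` of such an `N` is complete exactly when it generates `N`, that is, when
the vectors `A_l* ξ` with `ξ ∈ K` have dense span (`gen_eq_top_of_isCompleteSubmodule`,
`isCompleteSubmodule_of_gen_eq_top`). The inner product defining `Π` is the one that the vectors
`A_l* ξ` have in `N`, so a generating submodule `K` of `U L` gives `Π(K) ≅ L` (`Rep.isIso_lift`). In
the other direction, a finite-dimensional module `M` embeds in `Π(M)` by `ξ ↦ ∑ [v, ξ]`, with
generating image (`gen_range_unit`).

Two facts bring in fullness. First, a morphism from a full finite-dimensional module takes its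
values in every complete submodule of the target (`map_mem_of_isFull`): the orthogonal complement of
the preimage of the complete submodule is residual. Second, a residual subspace can be discarded
without losing generation (`gen_eq_top_of_isResidual`): the projection away from the part still
generated is a morphism, and a nonzero morphism from a finite-dimensional module attains its norm on
a nonzero submodule orthogonal to its kernel; this submodule would lie in the residual subspace.

By induction on the dimension, the second fact yields a full finite-dimensional generating submodule
of every `L` of finite Pythagorean dimension. By the first it lies in every complete submodule, so
it is the smallest one, and it is preserved by morphisms: this is `Σ(L)`. The canonical maps `M →
Σ(Π(M))` and `Π(Σ(L)) → L` are then natural isomorphisms. Irreducibility is transferred by comparing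
a submodule with the invariant subspace that it generates, and an invariant subspace with the
morphism obtained by projecting onto it. -/

namespace KGraph
open CategoryTheory

/-! ### Trees, and sums over their leaves -/

section trees

variable {k : ℕ} {Λ : KGraph.{u} k} [Λ.RowFinite]

/-- A caret consists of edges of a single colour or is reduced to the vertex. Equality of degrees is
what lets unique factorisation separate its elements. -/
theorem caret_deg_eq {v : Λ.Vertex} {i : Fin k} {a b : Λ.Path} (ha : a ∈ Λ.caret v i)
    (hb : b ∈ Λ.caret v i) : Λ.deg a = Λ.deg b := by
  obtain ⟨h1, h2⟩ := mem_caret.1 ha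
  obtain ⟨h3, h4⟩ := mem_caret.1 hb
  rcases h2 with h2 | ⟨h2, rfl⟩ <;> rcases h4 with h4 | ⟨h4, rfl⟩
  · rw [h2, h4]
  · exact absurd ⟨a, h1, h2⟩ h4
  · exact absurd ⟨b, h3, h4⟩ h2
  · rfl

/-- Distinct elements of a tree have no common extension. -/
theorem IsTree.eq_of_mul_eq {v : Λ.Vertex} {t : Finset Λ.Path} (ht : Λ.IsTree v t)
    {m m' a a' : Λ.Path} (hm : m ∈ t) (hm' : m' ∈ t) (ha : Λ.src m = Λ.rng a)
    (ha' : Λ.src m' = Λ.rng a') (h : Λ.mul m a = Λ.mul m' a') : m = m' := by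
  classical
  induction ht generalizing m m' a a' with
  | trivial =>
    rw [Finset.mem_singleton] at hm hm'
    rw [hm, hm']
  | graft t n i _ hn ih =>
    simp only [Finset.mem_union, Finset.mem_erase, Finset.mem_image] at hm hm'
    rcases hm with ⟨hm1, hm2⟩ | ⟨c, hc, rfl⟩ <;> rcases hm' with ⟨hm1', hm2'⟩ | ⟨c', hc', rfl⟩
    · exact ih hm2 hm2' ha ha' h
    · have hr := (rng_of_mem_caret hc').symm
      rw [src_mul hr] at ha'
      rw [mul_assoc' hr ha'] at h
      exact absurd (ih hm2 hn ha (by rw [rng_mul, hr]) h) hm1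
    · have hr := (rng_of_mem_caret hc).symm
      rw [src_mul hr] at ha
      rw [mul_assoc' hr ha] at h
      exact absurd (ih hn hm2' (by rw [rng_mul, hr]) ha' h).symm hm1'
    · have hr := (rng_of_mem_caret hc).symm
      have hr' := (rng_of_mem_caret hc').symm
      rw [src_mul hr] at ha
      rw [src_mul hr'] at ha'
      rw [mul_assoc' hr ha, mul_assoc' hr' ha'] at h
      have h1 := mul_left_cancel' (by rw [rng_mul, hr]) (by rw [rng_mul, hr']) h
      rw [(factor_unique ha ha' h1 (caret_deg_eq hc hc')).1]

theorem IsTree.eq_of_eq_mul {v : Λ.Vertex} {t : Finset Λ.Path} (ht : Λ.IsTree v t)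
    {m m' a : Λ.Path} (hm : m ∈ t) (hm' : m' ∈ t) (ha : Λ.src m = Λ.rng a)
    (h : Λ.mul m a = m') : m = m' :=
  ht.eq_of_mul_eq hm hm' ha (Λ.rng_vert (Λ.src m')).symm (by rw [h, mul_vert rfl])

/-- Grafting a caret at the leaf `m` replaces `A_m* A_m` by `A_m* (∑ A_a* A_a) A_m`, which is the
same operator. All norm and inner product identities over trees come from this one. -/
theorem IsModFamily.tree_sum {B : Type*} [NonUnitalRing B] [StarRing B] {A : Λ.Path → B}
    (hA : Λ.IsModFamily A) {v : Λ.Vertex} {t : Finset Λ.Path} (ht : Λ.IsTree v t) :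
    ∑ m ∈ t, star (A m) * A m = A (Λ.vert v) := by
  classical
  induction ht with
  | trivial =>
    rw [Finset.sum_singleton, (hA.proj v).isSelfAdjoint.star_eq, (hA.proj v).isIdempotentElem]
  | graft t m i ht hm ih =>
    rw [Finset.sum_union, Finset.sum_image]
    · have h1 : ∀ a ∈ Λ.caret (Λ.src m) i, star (A (Λ.mul m a)) * A (Λ.mul m a) =
          star (A m) * (star (A a) * A a) * A m := fun a ha => by
        rw [hA.mul' (rng_of_mem_caret ha).symm, star_mul]
        simp only [mul_assoc]
      rw [Finset.sum_congr rfl h1, ← Finset.sum_mul, ← Finset.mul_sum, hA.caret_sum, mul_assoc,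
        hA.vert_src_mul, Finset.sum_erase_add _ _ hm, ih]
    · intro a ha b hb h
      exact mul_left_cancel' (rng_of_mem_caret ha).symm (rng_of_mem_caret hb).symm h
    -- No path is counted twice: a remaining leaf cannot extend the leaf `m` that was removed.
    · rw [Finset.disjoint_left]
      intro p hp hp'
      obtain ⟨c, hc, rfl⟩ := Finset.mem_image.1 hp'
      obtain ⟨h1, h2⟩ := Finset.mem_erase.1 hp
      exact h1 (ht.eq_of_eq_mul hm h2 (rng_of_mem_caret hc).symm rfl).symm

-- The grafts are made one leaf at a time. A leaf still to be treated is never among the paths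
-- already grafted, because no leaf of `t` extends another.
open Classical in
theorem IsTree.graft_subset {v : Λ.Vertex} {t : Finset Λ.Path} (ht : Λ.IsTree v t) (i : Fin k)
    (S : Finset Λ.Path) (hS : S ⊆ t) :
    Λ.IsTree v ((t \ S) ∪ S.biUnion fun m => (Λ.caret (Λ.src m) i).image (Λ.mul m)) := by
  induction S using Finset.induction_on with
  | empty => simpa using ht
  | insert m S hm ih =>
    have hmt : m ∈ t := hS (Finset.mem_insert_self _ _)
    have hSt : S ⊆ t := fun a ha => hS (Finset.mem_insert_of_mem ha)
    have h1 := IsTree.graft _ m i (ih hSt)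
      (Finset.mem_union_left _ (Finset.mem_sdiff.2 ⟨hmt, hm⟩))
    convert h1 using 1
    have h2 : m ∉ S.biUnion fun m => (Λ.caret (Λ.src m) i).image (Λ.mul m) := by
      intro h
      obtain ⟨m', hm', hc⟩ := Finset.mem_biUnion.1 h
      obtain ⟨c, hc, hcm⟩ := Finset.mem_image.1 hc
      have := ht.eq_of_eq_mul (hSt hm') hmt (rng_of_mem_caret hc).symm hcm
      exact hm (this ▸ hm')
    rw [Finset.biUnion_insert, Finset.erase_union_distrib, Finset.erase_eq_of_notMem h2,
      Finset.union_comm (Finset.image _ _), ← Finset.union_assoc]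
    congr 2
    ext p
    simp only [Finset.mem_sdiff, Finset.mem_insert, Finset.mem_erase]
    tauto

/-- Passing from level `n` to `n + e_i` grafts the caret of colour `i` at every leaf; by local
convexity (`exists_of_mem_le`) every path of the new level arises in this way. -/
theorem isTree_le [Λ.LocallyConvex] (v : Λ.Vertex) (n : Fin k → ℕ) : Λ.IsTree v (Λ.le v n) := by
  classical
  refine nk_induction (n₀ := 0) (p := fun n => Λ.IsTree v (Λ.le v n)) ?_ ?_ n
    (fun _ => Nat.zero_le _)
  · rw [le_zero]; exact IsTree.trivial
  · intro n i _ ih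
    convert ih.graft_subset i _ subset_rfl using 1
    ext l
    simp only [sdiff_self, Finset.mem_union, Finset.mem_biUnion, Finset.mem_image]
    constructor
    · intro h
      obtain ⟨t, ht, a, ha, rfl⟩ := exists_of_mem_le h
      exact Or.inr ⟨t, ht, a, ha, rfl⟩
    · rintro (h | ⟨t, ht, a, ha, rfl⟩)
      · simp at h
      · exact mul_mem_le ht ha

end trees

namespace Mod

variable {k : ℕ} {Λ : KGraph.{u} k} [Λ.RowFinite]

/-! ### Elementary identities in a module -/

section basic

variable (M : Λ.Mod)

theorem A_mul_apply {l m : Λ.Path} (h : Λ.src m = Λ.rng l) (ξ : M.H) :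
    M.A (Λ.mul m l) ξ = M.A l (M.A m ξ) := by
  rw [M.isModFamily.mul' h]; rfl

theorem A_vert_src_apply (l : Λ.Path) (ξ : M.H) : M.A (Λ.vert (Λ.src l)) (M.A l ξ) = M.A l ξ :=
  DFunLike.congr_fun (M.isModFamily.vert_src_mul l) ξ

theorem A_vert_rng_apply (l : Λ.Path) (ξ : M.H) : M.A l (M.A (Λ.vert (Λ.rng l)) ξ) = M.A l ξ :=
  DFunLike.congr_fun (M.isModFamily.mul_vert_rng l) ξ

theorem A_vert_idem (v : Λ.Vertex) (ξ : M.H) :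
    M.A (Λ.vert v) (M.A (Λ.vert v) ξ) = M.A (Λ.vert v) ξ :=
  DFunLike.congr_fun (M.proj v).isIdempotentElem ξ

theorem A_vert_of_ne {v w : Λ.Vertex} (h : v ≠ w) (ξ : M.H) :
    M.A (Λ.vert v) (M.A (Λ.vert w) ξ) = 0 :=
  DFunLike.congr_fun (M.isModFamily.orth v w h) ξ

theorem star_A_vert (v : Λ.Vertex) : star (M.A (Λ.vert v)) = M.A (Λ.vert v) :=
  (M.proj v).isSelfAdjoint.star_eq

theorem inner_A_vert (v : Λ.Vertex) (ξ η : M.H) :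
    inner ℂ (M.A (Λ.vert v) ξ) η = inner ℂ ξ (M.A (Λ.vert v) η) := by
  conv_rhs => rw [← M.star_A_vert v, ContinuousLinearMap.star_eq_adjoint,
    ContinuousLinearMap.adjoint_inner_right]

theorem inner_star_A_left (l : Λ.Path) (ξ η : M.H) :
    inner ℂ (star (M.A l) ξ) η = inner ℂ ξ (M.A l η) :=
  ContinuousLinearMap.adjoint_inner_left _ _ _

theorem inner_star_A_right (l : Λ.Path) (ξ η : M.H) :
    inner ℂ ξ (star (M.A l) η) = inner ℂ (M.A l ξ) η :=
  ContinuousLinearMap.adjoint_inner_right _ _ _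

theorem tree_sum_inner {v : Λ.Vertex} {t : Finset Λ.Path} (ht : Λ.IsTree v t) (ξ η : M.H) :
    ∑ m ∈ t, inner ℂ (M.A m ξ) (M.A m η) = inner ℂ (M.A (Λ.vert v) ξ) η := by
  rw [inner_A_vert, ← M.isModFamily.tree_sum ht, sum_apply, inner_sum]
  exact Finset.sum_congr rfl fun m _ => (M.inner_star_A_right m _ _).symm

theorem tree_sum_norm_sq {v : Λ.Vertex} {t : Finset Λ.Path} (ht : Λ.IsTree v t) (ξ : M.H) :
    ∑ m ∈ t, ‖M.A m ξ‖ ^ 2 = ‖M.A (Λ.vert v) ξ‖ ^ 2 := by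
  have h := congrArg (RCLike.re : ℂ → ℝ) (M.tree_sum_inner ht ξ ξ)
  rw [map_sum, inner_A_vert, ← A_vert_idem, ← inner_A_vert] at h
  simp only [inner_self_eq_norm_sq] at h
  exact h

/-- Weak nondegeneracy suffices: `⟨ξ, ξ⟩` is the sum of the `⟨ξ, A_v ξ⟩`. Questions about vectors
thereby reduce to one vertex at a time. -/
theorem eq_zero_of_A_vert {ξ : M.H} (h : ∀ v, M.A (Λ.vert v) ξ = 0) : ξ = 0 := by
  have h1 : HasSum (fun v => inner ℂ ξ (M.A (Λ.vert v) ξ)) (inner ℂ ξ ξ) := M.nondegenerate ξ ξ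
  simp only [h, inner_zero_right] at h1
  exact inner_self_eq_zero.1 (h1.unique hasSum_zero)

theorem ext_of_A_vert {ξ η : M.H} (h : ∀ v, M.A (Λ.vert v) ξ = M.A (Λ.vert v) η) : ξ = η := by
  rw [← sub_eq_zero]
  exact M.eq_zero_of_A_vert fun v => by rw [map_sub, h, sub_self]

theorem norm_A_vert_le (v : Λ.Vertex) (ξ : M.H) : ‖M.A (Λ.vert v) ξ‖ ≤ ‖ξ‖ :=
  norm_proj_le (M.proj v) ξ

/-- The ranges of the projections `A_v` are mutually orthogonal, so nonzero vectors chosen in them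
are linearly independent. This keeps the sum `∑ [v, ξ]` finite in the embedding into the dilation.
-/
theorem finite_vert [FiniteDimensional ℂ M.H] : {v | M.A (Λ.vert v) ≠ 0}.Finite := by
  have h : ∀ v : {v | M.A (Λ.vert v) ≠ 0}, ∃ ξ, M.A (Λ.vert v.1) ξ ≠ 0 := fun v => by
    by_contra! hc
    exact v.2 (ContinuousLinearMap.ext hc)
  choose f hf using h
  have hli : LinearIndependent ℂ fun v : {v | M.A (Λ.vert v) ≠ 0} => M.A (Λ.vert v.1) (f v) := by
    refine linearIndependent_of_ne_zero_of_inner_eq_zero hf fun v w hvw => ?_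
    change inner ℂ (M.A (Λ.vert v.1) (f v)) (M.A (Λ.vert w.1) (f w)) = 0
    rw [inner_A_vert, M.A_vert_of_ne (fun h => hvw (Subtype.ext h)), inner_zero_right]
  exact Set.finite_coe_iff.1 hli.finite_of_isNoetherian

end basic

/-! ### Morphisms, complete submodules and norm-attaining vectors -/

theorem Hom.apply_A {M N : Λ.Mod} (θ : M ⟶ N) (l : Λ.Path) (ξ : M.H) :
    θ.f (M.A l ξ) = N.A l (θ.f ξ) :=
  DFunLike.congr_fun (θ.comm l) ξ

/-- The inclusion of a submodule. -/
noncomputable def incl (M : Λ.Mod) (K : Submodule ℂ M.H) (hK : M.IsSubmodule K) :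
    M.restrict K hK ⟶ M where
  f := K.subtypeL
  comm _ := rfl

theorem isSubmodule_comap {M N : Λ.Mod} (θ : M ⟶ N) {C : Submodule ℂ N.H}
    (hC : N.IsSubmodule C) : M.IsSubmodule (C.comap (θ.f : M.H →ₗ[ℂ] N.H)) where
  isClosed := hC.isClosed.preimage θ.f.continuous
  map_mem l ξ hξ := by
    change θ.f (M.A l ξ) ∈ C
    rw [Hom.apply_A]
    exact hC.map_mem l _ hξ

theorem isSubmodule_ker {M N : Λ.Mod} (θ : M ⟶ N) :
    M.IsSubmodule (LinearMap.ker (θ.f : M.H →ₗ[ℂ] N.H)) where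
  isClosed := θ.f.isClosed_ker
  map_mem l ξ hξ := by
    change θ.f (M.A l ξ) = 0
    rw [Hom.apply_A, show θ.f ξ = 0 from hξ, map_zero]

theorem isSubmodule_map {M N : Λ.Mod} (θ : M ⟶ N) {K : Submodule ℂ M.H} (hK : M.IsSubmodule K)
    [FiniteDimensional ℂ K] : N.IsSubmodule (K.map (θ.f : M.H →ₗ[ℂ] N.H)) where
  isClosed := Submodule.closed_of_finiteDimensional _
  map_mem l := by
    rintro _ ⟨ξ, hξ, rfl⟩
    exact ⟨M.A l ξ, hK.map_mem l ξ hξ, Hom.apply_A θ l ξ⟩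

theorem isSubmodule_top (M : Λ.Mod) : M.IsSubmodule ⊤ := ⟨isClosed_univ, fun _ _ _ => trivial⟩

/-- A finite-dimensional submodule that meets a complete submodule trivially is zero. -/
theorem IsCompleteSubmodule.eq_bot_of_inf_eq_bot {N : Λ.Mod} {C S : Submodule ℂ N.H}
    (hC : N.IsCompleteSubmodule C) (hS : N.IsSubmodule S) [FiniteDimensional ℂ S]
    (h : S ⊓ C = ⊥) : S = ⊥ := by
  have : CompleteSpace C := hC.1.isClosed.completeSpace_coe
  let P : S →ₗ[ℂ] N.H := (Cᗮ.starProjection : N.H →ₗ[ℂ] N.H) ∘ₗ S.subtype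
  have hP : LinearMap.ker P = ⊥ := by
    rw [LinearMap.ker_eq_bot']
    intro ξ hξ
    have h1 : (ξ : N.H) ∈ C := by
      have h2 : Cᗮ.starProjection (ξ : N.H) = 0 := hξ
      rw [Submodule.starProjection_apply_eq_zero_iff, Submodule.orthogonal_orthogonal] at h2
      exact h2
    have h3 : (ξ : N.H) ∈ S ⊓ C := ⟨ξ.2, h1⟩
    rw [h, Submodule.mem_bot] at h3
    exact Subtype.ext h3
  -- The projection onto `Cᗮ` is injective on `S`; since `S` is finite dimensional, it is bounded
  -- below there. Thus the distance to `C` is at least `‖ξ‖ / c`, uniformly in `ξ ∈ S`.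
  obtain ⟨c, hc, hcP⟩ := P.exists_antilipschitzWith hP
  have hdist : ∀ ξ ∈ S, ∀ η ∈ C, ‖ξ‖ ≤ c * ‖ξ - η‖ := by
    intro ξ hξ η hη
    have h1 : ‖ξ‖ ≤ c * ‖Cᗮ.starProjection ξ‖ := by
      have := hcP.le_mul_dist ⟨ξ, hξ⟩ 0
      rwa [map_zero, dist_zero_right, dist_zero_right] at this
    have h2 : Cᗮ.starProjection ξ = Cᗮ.starProjection (ξ - η) := by
      rw [map_sub, (Submodule.starProjection_apply_eq_zero_iff Cᗮ).2
        (Submodule.le_orthogonal_orthogonal C hη), sub_zero]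
    rw [h2] at h1
    refine h1.trans ?_
    gcongr
    exact Submodule.norm_starProjection_apply_le _ _
  rw [Submodule.eq_bot_iff]
  intro ξ hξ
  refine N.eq_zero_of_A_vert fun v => ?_
  by_contra hne
  have hpos : 0 < ‖N.A (Λ.vert v) ξ‖ := norm_pos_iff.2 hne
  have hc' : (0 : ℝ) < c := hc
  -- All the vectors `A_m A_v ξ` lie in `S`, so by Parseval their squared distances to `C` add up to
  -- at least `‖A_v ξ‖² / c²` over any tree. With this `ε`, completeness contradicts that bound.
  obtain ⟨t, ht, η, hη, hlt⟩ := hC.2 (‖N.A (Λ.vert v) ξ‖ / c) (by positivity) v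
    (N.A (Λ.vert v) ξ) (N.A_vert_idem v ξ)
  have h1 := N.tree_sum_norm_sq ht (N.A (Λ.vert v) ξ)
  rw [A_vert_idem] at h1
  have h2 : ∑ m ∈ t, ‖N.A m (N.A (Λ.vert v) ξ)‖ ^ 2 ≤
      c ^ 2 * ∑ m ∈ t, ‖N.A m (N.A (Λ.vert v) ξ) - η m‖ ^ 2 := by
    rw [Finset.mul_sum]
    refine Finset.sum_le_sum fun m hm => ?_
    rw [← mul_pow]
    have := hdist _ (hS.map_mem m _ (hS.map_mem (Λ.vert v) ξ hξ)) (η m) (hη m hm)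
    gcongr
  rw [h1] at h2
  have h3 : (c : ℝ) ^ 2 * ∑ m ∈ t, ‖N.A m (N.A (Λ.vert v) ξ) - η m‖ ^ 2 <
      c ^ 2 * (‖N.A (Λ.vert v) ξ‖ / c) ^ 2 := by gcongr
  rw [← mul_pow, mul_div_cancel₀ _ hc'.ne'] at h3
  linarith

/-- Morphisms from a full finite-dimensional module take values in every complete submodule. -/
theorem IsCompleteSubmodule.map_mem_of_isFull {M N : Λ.Mod} (hM : M.IsFull)
    [FiniteDimensional ℂ M.H] (θ : M ⟶ N) {C : Submodule ℂ N.H}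
    (hC : N.IsCompleteSubmodule C) (ξ : M.H) : θ.f ξ ∈ C := by
  set K : Submodule ℂ M.H := C.comap (θ.f : M.H →ₗ[ℂ] N.H) with hKdef
  have hK : M.IsSubmodule K := isSubmodule_comap θ hC.1
  -- If a submodule `S` lies in `Kᗮ`, then `θ(S)` meets `C` only in `0`, since `θ s ∈ C` puts `s` in
  -- `K ∩ Kᗮ`. Hence `θ(S) = 0` by the preceding result, so `S` lies in `ker θ ⊆ K` as well as in
  -- `Kᗮ`.
  have hres : M.IsResidual Kᗮ := by
    refine ⟨⟨K, hK, rfl⟩, fun S hS hSK => ?_⟩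
    have hdis : ∀ s ∈ S, s ∈ K → s = 0 := fun s hs hsK =>
      inner_self_eq_zero.1 ((Submodule.mem_orthogonal _ _).1 (hSK hs) s hsK)
    have h1 : S.map (θ.f : M.H →ₗ[ℂ] N.H) = ⊥ := by
      refine hC.eq_bot_of_inf_eq_bot (isSubmodule_map θ hS) ?_
      rw [Submodule.eq_bot_iff]
      rintro _ ⟨⟨s, hs, rfl⟩, hsC⟩
      rw [hdis s hs hsC, map_zero]
    rw [Submodule.eq_bot_iff]
    intro s hs
    refine hdis s hs ?_
    have h2 : θ.f s ∈ S.map (θ.f : M.H →ₗ[ℂ] N.H) := ⟨s, hs, rfl⟩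
    rw [h1, Submodule.mem_bot] at h2
    change θ.f s ∈ C
    rw [h2]
    exact zero_mem _
  have htop : K = ⊤ := by
    have := hM _ hres
    rwa [Submodule.orthogonal_eq_bot_iff] at this
  have : ξ ∈ K := by rw [htop]; trivial
  exact this

/-- The norm of an operator is attained exactly on the eigenvectors of `T* T` for `‖T‖ ^ 2`. -/
theorem adjoint_apply_apply_eq_iff {E F : Type*} [NormedAddCommGroup E] [InnerProductSpace ℂ E]
    [CompleteSpace E] [NormedAddCommGroup F] [InnerProductSpace ℂ F] [CompleteSpace F]
    (T : E →L[ℂ] F) (ξ : E) :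
    T.adjoint (T ξ) = ((‖T‖ : ℂ) ^ 2) • ξ ↔ ‖T ξ‖ ^ 2 = ‖T‖ ^ 2 * ‖ξ‖ ^ 2 := by
  have hn : ‖T.adjoint (T ξ)‖ ≤ ‖T‖ * ‖T ξ‖ := by
    refine (ContinuousLinearMap.le_opNorm _ _).trans_eq ?_
    rw [LinearIsometryEquiv.norm_map]
  have hre : RCLike.re (inner ℂ (T.adjoint (T ξ)) ξ) = ‖T ξ‖ ^ 2 := by
    rw [ContinuousLinearMap.adjoint_inner_left, inner_self_eq_norm_sq]
  constructor
  · intro h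
    rw [← hre, h, inner_smul_left, ← inner_self_eq_norm_sq (𝕜 := ℂ) ξ]
    simp [← Complex.ofReal_pow]
  · intro h
    -- Expand `‖T*Tξ - ‖T‖² ξ‖² = ‖T*Tξ‖² - 2‖T‖² ‖Tξ‖² + ‖T‖⁴ ‖ξ‖²`. The first term is at most
    -- `‖T‖² ‖Tξ‖²`, and `‖Tξ‖² = ‖T‖² ‖ξ‖²` makes the total at most `0`.
    rw [← sub_eq_zero, ← norm_eq_zero, ← sq_eq_zero_iff]
    refine le_antisymm ?_ (sq_nonneg _)
    rw [@norm_sub_sq ℂ, inner_smul_right, norm_smul]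
    have h1 : RCLike.re ((‖T‖ : ℂ) ^ 2 * inner ℂ (T.adjoint (T ξ)) ξ) =
        ‖T‖ ^ 2 * ‖T ξ‖ ^ 2 := by
      rw [← hre, ← Complex.ofReal_pow]
      exact Complex.re_ofReal_mul _ _
    have h2 : ‖(‖T‖ : ℂ) ^ 2‖ = ‖T‖ ^ 2 := by
      rw [norm_pow, Complex.norm_real, norm_norm]
    have h3 : ‖T.adjoint (T ξ)‖ ^ 2 ≤ ‖T‖ ^ 2 * ‖T ξ‖ ^ 2 := by
      rw [← mul_pow]
      exact pow_le_pow_left₀ (norm_nonneg _) hn 2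
    rw [h1, h2, mul_pow]
    rw [h] at h3 ⊢
    linarith

theorem exists_norm_apply_eq {E F : Type*} [NormedAddCommGroup E] [NormedSpace ℂ E]
    [FiniteDimensional ℂ E] [Nontrivial E] [NormedAddCommGroup F] [NormedSpace ℂ F]
    (T : E →L[ℂ] F) : ∃ ξ, ‖ξ‖ = 1 ∧ ‖T ξ‖ = ‖T‖ := by
  have : ProperSpace E := FiniteDimensional.proper ℂ E
  let : NormedSpace ℝ E := NormedSpace.restrictScalars ℝ ℂ E
  obtain ⟨ξ, hξ, hmax⟩ := (isCompact_sphere (0 : E) 1).exists_isMaxOn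
    (NormedSpace.sphere_nonempty.2 zero_le_one) (T.continuous.norm.continuousOn)
  have hξ1 : ‖ξ‖ = 1 := by simpa using hξ
  refine ⟨ξ, hξ1, le_antisymm ?_ ?_⟩
  · simpa [hξ1] using T.le_opNorm ξ
  · exact ContinuousLinearMap.opNorm_le_of_unit_norm (𝕜 := ℂ) (norm_nonneg _) fun x hx =>
      hmax (by simpa using hx)

/-- A nonzero morphism from a finite-dimensional module attains its norm on a nonzero submodule,
which is orthogonal to the kernel. -/
theorem exists_isSubmodule_orthogonal_ker [Λ.LocallyConvex] {M N : Λ.Mod}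
    [FiniteDimensional ℂ M.H] (θ : M ⟶ N) (hθ : θ.f ≠ 0) :
    ∃ E, M.IsSubmodule E ∧ E ≠ ⊥ ∧ E ≤ (LinearMap.ker (θ.f : M.H →ₗ[ℂ] N.H))ᗮ := by
  have hc0 : 0 < ‖θ.f‖ := norm_pos_iff.2 hθ
  have hle : ∀ ξ, ‖θ.f ξ‖ ^ 2 ≤ ‖θ.f‖ ^ 2 * ‖ξ‖ ^ 2 := fun ξ => by
    rw [← mul_pow]; gcongr; exact θ.f.le_opNorm ξ
  -- The submodule sought is the top eigenspace of `θ*θ`. Its description as an eigenspace shows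
  -- that it is linear, its description as the set where the norm is attained that it is invariant.
  let S : M.H →L[ℂ] M.H :=
    θ.f.adjoint ∘L θ.f - ((‖θ.f‖ : ℂ) ^ 2) • ContinuousLinearMap.id ℂ M.H
  have hE : ∀ ξ, ξ ∈ LinearMap.ker (S : M.H →ₗ[ℂ] M.H) ↔
      θ.f.adjoint (θ.f ξ) = ((‖θ.f‖ : ℂ) ^ 2) • ξ := fun ξ => by
    change θ.f.adjoint (θ.f ξ) - ((‖θ.f‖ : ℂ) ^ 2) • ξ = 0 ↔ _
    rw [sub_eq_zero]
  -- The operator `θ*θ` commutes with the vertex operators because these are self-adjoint on both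
  -- sides.
  have hvert : ∀ v, ∀ ξ, θ.f.adjoint (θ.f (M.A (Λ.vert v) ξ)) =
      M.A (Λ.vert v) (θ.f.adjoint (θ.f ξ)) := fun v ξ => by
    refine ext_inner_right ℂ fun η => ?_
    rw [inner_A_vert, ContinuousLinearMap.adjoint_inner_left,
      ContinuousLinearMap.adjoint_inner_left, Hom.apply_A, Hom.apply_A, inner_A_vert]
  refine ⟨LinearMap.ker (S : M.H →ₗ[ℂ] M.H), ⟨S.isClosed_ker, fun l ξ hξ => ?_⟩, ?_, ?_⟩
  · rw [hE] at hξ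
    have h1 : θ.f.adjoint (θ.f (M.A (Λ.vert (Λ.rng l)) ξ)) =
        ((‖θ.f‖ : ℂ) ^ 2) • M.A (Λ.vert (Λ.rng l)) ξ := by
      rw [hvert, hξ, map_smul]
    rw [adjoint_apply_apply_eq_iff] at h1
    rw [hE, adjoint_apply_apply_eq_iff]
    -- Expand both sides of `‖θ A_v ξ‖² = ‖θ‖² ‖A_v ξ‖²`, with `v = r(l)`, over the level of `l`.
    -- The inequality `‖θ A_m ξ‖² ≤ ‖θ‖² ‖A_m ξ‖²` holds for each `m` and the sums agree, so it is
    -- an equality for each `m`, in particular for `m = l`.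
    have h2 := M.tree_sum_norm_sq (isTree_le (Λ.rng l) (Λ.deg l)) ξ
    have h3 := N.tree_sum_norm_sq (isTree_le (Λ.rng l) (Λ.deg l)) (θ.f ξ)
    rw [← Hom.apply_A, h1, ← h2, Finset.mul_sum] at h3
    have h4 := (Finset.sum_eq_sum_iff_of_le fun m _ => by
      rw [← Hom.apply_A]; exact hle (M.A m ξ)).1 h3 l (self_mem_le l)
    rwa [← Hom.apply_A] at h4
  · have : Nontrivial M.H := by
      by_contra hn
      rw [not_nontrivial_iff_subsingleton] at hn
      exact hθ (ContinuousLinearMap.ext fun x => by rw [Subsingleton.elim x 0]; simp)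
    obtain ⟨ξ, hξ, hmax⟩ := exists_norm_apply_eq θ.f
    intro hbot
    have : ξ ∈ LinearMap.ker (S : M.H →ₗ[ℂ] M.H) := by
      rw [hE, adjoint_apply_apply_eq_iff, hξ, one_pow, mul_one, hmax]
    rw [hbot, Submodule.mem_bot] at this
    rw [this, norm_zero] at hξ
    exact zero_ne_one hξ
  · intro ξ hξ
    rw [hE] at hξ
    rw [Submodule.mem_orthogonal']
    intro η hη
    -- For `η` in the kernel, `‖θ‖² ⟨ξ, η⟩ = ⟨θ*θ ξ, η⟩ = ⟨θ ξ, θ η⟩ = 0`.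
    have h1 : inner ℂ (θ.f.adjoint (θ.f ξ)) η = 0 := by
      rw [ContinuousLinearMap.adjoint_inner_left, show θ.f η = 0 from hη, inner_zero_right]
    rw [hξ, inner_smul_left] at h1
    refine (mul_eq_zero.1 h1).resolve_left fun h2 => ?_
    rw [map_eq_zero] at h2
    exact hc0.ne' (by exact_mod_cast (pow_eq_zero_iff two_ne_zero).1 h2)

end Mod
end KGraph

namespace KGraph
open CategoryTheory
namespace Mod

variable {k : ℕ} {Λ : KGraph.{u} k} [Λ.RowFinite]

/-! ### The adjoint operators and the subspaces they generate -/

section adjoints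

variable (N : Λ.Mod)

theorem star_A_mul_apply {l m : Λ.Path} (h : Λ.src l = Λ.rng m) (ξ : N.H) :
    star (N.A (Λ.mul l m)) ξ = star (N.A l) (star (N.A m) ξ) := by
  rw [N.isModFamily.mul' h, star_mul]; rfl

theorem star_A_vert_src_apply (l : Λ.Path) (ξ : N.H) :
    star (N.A l) (N.A (Λ.vert (Λ.src l)) ξ) = star (N.A l) ξ := by
  conv_rhs => rw [← N.isModFamily.vert_src_mul l, star_mul, star_A_vert]
  rfl

theorem A_vert_rng_star_A_apply (l : Λ.Path) (ξ : N.H) :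
    N.A (Λ.vert (Λ.rng l)) (star (N.A l) ξ) = star (N.A l) ξ := by
  conv_rhs => rw [← N.isModFamily.mul_vert_rng l, star_mul, star_A_vert]
  rfl

theorem A_vert_star_A_of_ne {v : Λ.Vertex} {l : Λ.Path} (h : v ≠ Λ.rng l) (ξ : N.H) :
    N.A (Λ.vert v) (star (N.A l) ξ) = 0 := by
  rw [← A_vert_rng_star_A_apply, N.A_vert_of_ne h]

theorem star_A_mul_of_ne {l m : Λ.Path} (h : Λ.src l ≠ Λ.rng m) (ξ : N.H) :
    star (N.A l) (star (N.A m) ξ) = 0 := by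
  rw [← A_vert_rng_star_A_apply N m, ← star_A_vert_src_apply N l, N.A_vert_of_ne h, map_zero]

/-- Insert `A_{s(l)} = ∑ A_a* A_a` behind `A_l*`. This moves a path to a higher level, where paths
can be compared. -/
theorem star_A_expand [Λ.LocallyConvex] (l : Λ.Path) (n : Fin k → ℕ) (ξ : N.H) :
    star (N.A l) ξ = ∑ a ∈ Λ.le (Λ.src l) n, star (N.A (Λ.mul l a)) (N.A a ξ) := by
  rw [← star_A_vert_src_apply, ← N.isModFamily.tree_sum (isTree_le (Λ.src l) n), sum_apply,
    map_sum]
  refine Finset.sum_congr rfl fun a ha => ?_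
  rw [N.star_A_mul_apply (mem_le.1 ha).1.symm]
  rfl

/-- The closed subspace generated by `K` under the adjoints of the operators `A_l`. -/
noncomputable def gen (K : Submodule ℂ N.H) : Submodule ℂ N.H :=
  (Submodule.span ℂ {x | ∃ l, ∃ ξ ∈ K, star (N.A l) ξ = x}).topologicalClosure

variable {N}

theorem star_A_mem_gen {K : Submodule ℂ N.H} {ξ : N.H} (hξ : ξ ∈ K) (l : Λ.Path) :
    star (N.A l) ξ ∈ N.gen K :=
  Submodule.le_topologicalClosure _ (Submodule.subset_span ⟨l, ξ, hξ, rfl⟩)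

theorem isClosed_gen (K : Submodule ℂ N.H) : IsClosed (N.gen K : Set N.H) :=
  Submodule.isClosed_topologicalClosure _

/-- Each `A_v ξ = A_v* ξ` belongs to the generated subspace. Since the sum of the `A_v` is only
known to converge weakly, membership of `ξ` is tested against vectors of the orthogonal complement.
-/
theorem le_gen (K : Submodule ℂ N.H) : K ≤ N.gen K := by
  have : CompleteSpace (N.gen K) := (isClosed_gen K).completeSpace_coe
  intro ξ hξ
  rw [← (N.gen K).orthogonal_orthogonal, Submodule.mem_orthogonal]
  intro ζ hζ
  have h1 : HasSum (fun v => inner ℂ ζ (N.A (Λ.vert v) ξ)) (inner ℂ ζ ξ) := N.nondegenerate ξ ζ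
  have h2 : ∀ v, inner ℂ ζ (N.A (Λ.vert v) ξ) = 0 := fun v => by
    rw [← star_A_vert]
    exact (Submodule.mem_orthogonal' _ _).1 hζ _ (star_A_mem_gen hξ _)
  simp only [h2] at h1
  exact h1.unique hasSum_zero

theorem gen_le {K V : Submodule ℂ N.H} (hV : IsClosed (V : Set N.H))
    (h : ∀ l, ∀ ξ ∈ K, star (N.A l) ξ ∈ V) : N.gen K ≤ V := by
  refine Submodule.topologicalClosure_minimal _ (Submodule.span_le.2 ?_) hV
  rintro _ ⟨l, ξ, hξ, rfl⟩
  exact h l ξ hξ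

theorem star_A_mem_gen_of_mem_gen {K : Submodule ℂ N.H} (m : Λ.Path) {x : N.H}
    (hx : x ∈ N.gen K) : star (N.A m) x ∈ N.gen K := by
  have h : N.gen K ≤ (N.gen K).comap (star (N.A m) : N.H →L[ℂ] N.H).toLinearMap := by
    refine gen_le ((isClosed_gen K).preimage (star (N.A m)).continuous) fun l ξ hξ => ?_
    change star (N.A m) (star (N.A l) ξ) ∈ N.gen K
    by_cases hml : Λ.src m = Λ.rng l
    · rw [← star_A_mul_apply N hml]
      exact star_A_mem_gen hξ _
    · rw [star_A_mul_of_ne N hml]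
      exact zero_mem _
  exact h hx

end adjoints

theorem apply_mem_orthogonal {H : Type*} [NormedAddCommGroup H] [InnerProductSpace ℂ H]
    [CompleteSpace H] {W : Submodule ℂ H} {T : H →L[ℂ] H} (h : ∀ x ∈ W, star T x ∈ W) :
    ∀ x ∈ Wᗮ, T x ∈ Wᗮ := by
  intro x hx
  rw [Submodule.mem_orthogonal]
  intro y hy
  rw [← ContinuousLinearMap.adjoint_inner_left]
  exact (Submodule.mem_orthogonal _ _).1 hx _ (h y hy)

theorem starProjection_apply_comm {H : Type*} [NormedAddCommGroup H] [InnerProductSpace ℂ H]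
    [CompleteSpace H] {W : Submodule ℂ H} [W.HasOrthogonalProjection] {T : H →L[ℂ] H}
    (h : ∀ x ∈ W, T x ∈ W) (h' : ∀ x ∈ W, star T x ∈ W) (x : H) :
    W.starProjection (T x) = T (W.starProjection x) := by
  have h1 : T (W.starProjection x) ∈ W := h _ (Submodule.starProjection_apply_mem _ _)
  have h2 : T (Wᗮ.starProjection x) ∈ Wᗮ :=
    apply_mem_orthogonal h' _ (Submodule.starProjection_apply_mem _ _)
  conv_lhs => rw [← Submodule.starProjection_add_starProjection_orthogonal (K := W) x, map_add,
    map_add]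
  rw [Submodule.starProjection_eq_self_iff.2 h1,
    (Submodule.starProjection_apply_eq_zero_iff _).2 h2, add_zero]

/-- The adjoints of the operators of `N` form a representation of `𝒪_Λ`. -/
def IsDilated (N : Λ.Mod) : Prop := Λ.IsOFamily fun l => star (N.A l)

/-! ### Dilated modules: generation and completeness -/

namespace IsDilated

variable {N : Λ.Mod}

theorem A_star_A (hN : N.IsDilated) (l : Λ.Path) (ξ : N.H) :
    N.A l (star (N.A l) ξ) = N.A (Λ.vert (Λ.src l)) ξ := by
  have h := hN.star_mul_self l
  simp only [star_star] at h
  rw [star_A_vert] at h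
  exact DFunLike.congr_fun h ξ

variable [Λ.LocallyConvex]

/-- Parseval over the level, applied to `A_s* ξ`, has total `‖A_s* ξ‖²`, and the term of `s` alone
already contributes this much. All other terms vanish. -/
theorem A_star_A_of_ne (hN : N.IsDilated) {v : Λ.Vertex} {n : Fin k → ℕ} {s t : Λ.Path}
    (hs : s ∈ Λ.le v n) (ht : t ∈ Λ.le v n) (h : t ≠ s) (ξ : N.H) :
    N.A t (star (N.A s) ξ) = 0 := by
  classical
  have h1 := N.tree_sum_norm_sq (isTree_le v n) (star (N.A s) ξ)
  rw [← (mem_le.1 hs).1, A_vert_rng_star_A_apply, (mem_le.1 hs).1,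
    ← Finset.add_sum_erase _ _ hs, hN.A_star_A] at h1
  have h2 : ‖N.A (Λ.vert (Λ.src s)) ξ‖ ^ 2 = ‖star (N.A s) ξ‖ ^ 2 := by
    rw [← inner_self_eq_norm_sq (𝕜 := ℂ), ← inner_self_eq_norm_sq (𝕜 := ℂ), inner_A_vert,
      inner_star_A_left, hN.A_star_A, A_vert_idem]
  rw [h2, add_eq_left, Finset.sum_eq_zero_iff_of_nonneg fun _ _ => sq_nonneg _] at h1
  simpa using h1 t (Finset.mem_erase.2 ⟨h, ht⟩)

/-- If `t = l ∘ c`, then `A_t A_l* = A_c A_l A_l* = A_c`. Otherwise expand `A_l*` to the level `n`: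
every path that occurs extends `l`, hence differs from `t`, and orthogonality within the level
applies. -/
theorem A_star_A_eq_quotOp (hN : N.IsDilated) {v : Λ.Vertex} {n : Fin k → ℕ} {l t : Λ.Path}
    (ht : t ∈ Λ.le v n) (hl : Λ.deg l ≤ n) (ξ : N.H) :
    N.A t (star (N.A l) ξ) = N.quotOp l t ξ := by
  by_cases h : ∃ c, Λ.src l = Λ.rng c ∧ Λ.mul l c = t
  · obtain ⟨c, hc, rfl⟩ := h
    rw [N.quotOp_mul hc, N.A_mul_apply hc, hN.A_star_A, hc, A_vert_rng_apply]
  · rw [N.quotOp_eq_zero h, zero_apply]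
    by_cases hv : v = Λ.rng l
    · rw [N.star_A_expand l (n - Λ.deg l), map_sum]
      refine Finset.sum_eq_zero fun a ha => ?_
      have hr := (mem_le.1 ha).1.symm
      have hmem : Λ.mul l a ∈ Λ.le v n := by
        have := (mul_mem_le_iff hr).2 ha
        rwa [add_tsub_cancel_of_le hl, ← hv] at this
      exact hN.A_star_A_of_ne hmem ht (fun h' => h ⟨a, hr, h'.symm⟩) _
    · rw [← A_vert_rng_apply, (mem_le.1 ht).1, A_vert_star_A_of_ne N hv, map_zero]

theorem quotOp_mem {K : Submodule ℂ N.H} (hK : N.IsSubmodule K) (l t : Λ.Path) {ξ : N.H}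
    (hξ : ξ ∈ K) : N.quotOp l t ξ ∈ K := by
  by_cases h : ∃ c, Λ.src l = Λ.rng c ∧ Λ.mul l c = t
  · obtain ⟨c, hc, rfl⟩ := h
    rw [N.quotOp_mul hc]
    exact hK.map_mem c ξ hξ
  · rw [N.quotOp_eq_zero h]
    exact zero_mem _

/-- After expansion to the level `d(l) + d(m)`, the product `A_m A_{la}*` is the adjoint of `A_{la}
A_m*`, hence is some `A_c*` or `0`. As `A_a ξ` stays in `K`, the result is a sum of generators. So a
submodule generates a subspace that reduces the representation. -/
theorem A_mem_gen (hN : N.IsDilated) {K : Submodule ℂ N.H} (hK : N.IsSubmodule K) (m : Λ.Path)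
    {x : N.H} (hx : x ∈ N.gen K) : N.A m x ∈ N.gen K := by
  have h : N.gen K ≤ (N.gen K).comap (N.A m).toLinearMap := by
    refine gen_le ((isClosed_gen K).preimage (N.A m).continuous) fun l ξ hξ => ?_
    change N.A m (star (N.A l) ξ) ∈ N.gen K
    rw [N.star_A_expand l (Λ.deg m), map_sum]
    refine Submodule.sum_mem _ fun a ha => ?_
    have hr := (mem_le.1 ha).1.symm
    have hmem : Λ.mul l a ∈ Λ.le (Λ.rng l) (Λ.deg l + Λ.deg m) := (mul_mem_le_iff hr).2 ha
    have hle : Λ.deg m ≤ Λ.deg l + Λ.deg m := fun i => Nat.le_add_left _ _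
    have h1 : N.A m * star (N.A (Λ.mul l a)) = star (N.quotOp m (Λ.mul l a)) := by
      have h2 : N.A (Λ.mul l a) * star (N.A m) = N.quotOp m (Λ.mul l a) :=
        ContinuousLinearMap.ext fun ζ => hN.A_star_A_eq_quotOp hmem hle ζ
      rw [← h2, star_mul, star_star]
    have h3 : N.A m (star (N.A (Λ.mul l a)) (N.A a ξ)) =
        star (N.quotOp m (Λ.mul l a)) (N.A a ξ) := DFunLike.congr_fun h1 _
    rw [h3]
    by_cases h : ∃ c, Λ.src m = Λ.rng c ∧ Λ.mul m c = Λ.mul l a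
    · obtain ⟨c, hc, hca⟩ := h
      rw [← hca, N.quotOp_mul hc]
      exact star_A_mem_gen (hK.map_mem a ξ hξ) c
    · rw [N.quotOp_eq_zero h, star_zero]
      exact zero_mem _
  exact h hx

/-- If `ζ` is orthogonal to the generated subspace, then every `A_m ζ` is orthogonal to `K`. With `ξ
= A_v ζ`, one gets `‖ξ‖² = ∑ ⟨A_m ξ - η_m, A_m ζ⟩` over any tree. Cauchy–Schwarz bounds this by
`‖ξ‖` times the approximation error, so an error below `‖ξ‖` is impossible. -/
theorem gen_eq_top_of_isCompleteSubmodule {K : Submodule ℂ N.H}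
    (hK : N.IsCompleteSubmodule K) : N.gen K = ⊤ := by
  have : CompleteSpace (N.gen K) := (isClosed_gen K).completeSpace_coe
  rw [← Submodule.orthogonal_eq_bot_iff, Submodule.eq_bot_iff]
  intro ζ hζ
  refine N.eq_zero_of_A_vert fun v => ?_
  set ξ := N.A (Λ.vert v) ζ with hξ
  have hξv : N.A (Λ.vert v) ξ = ξ := N.A_vert_idem v ζ
  have hperp : ∀ m, ∀ η ∈ K, inner ℂ η (N.A m ζ) = 0 := fun m η hη => by
    rw [← inner_star_A_left]
    exact (Submodule.mem_orthogonal _ _).1 hζ _ (star_A_mem_gen hη m)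
  have hself : ‖ξ‖ ^ 2 = ‖(inner ℂ ξ ζ : ℂ)‖ := by
    have h : (inner ℂ ξ ζ : ℂ) = inner ℂ ξ ξ := by
      conv_lhs => rw [← hξv, inner_A_vert]
    rw [h, inner_self_eq_norm_sq_to_K]
    simp
  by_contra hne
  have hpos : 0 < ‖ξ‖ := norm_pos_iff.2 hne
  obtain ⟨t, ht, η, hη, hlt⟩ := hK.2 ‖ξ‖ hpos v ξ hξv
  have h1 : (inner ℂ ξ ζ : ℂ) = ∑ m ∈ t, inner ℂ (N.A m ξ - η m) (N.A m ζ) := by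
    rw [← hξv, ← N.tree_sum_inner ht, hξv]
    refine Finset.sum_congr rfl fun m hm => ?_
    rw [inner_sub_left, hperp m _ (hη m hm), sub_zero]
  have h2 := N.tree_sum_norm_sq ht ζ
  rw [← hξ] at h2
  have h3 : ‖(inner ℂ ξ ζ : ℂ)‖ ≤ ∑ m ∈ t, ‖N.A m ξ - η m‖ * ‖N.A m ζ‖ := by
    rw [h1]
    exact (norm_sum_le _ _).trans (Finset.sum_le_sum fun m _ => norm_inner_le_norm _ _)
  have h4 := Finset.sum_mul_sq_le_sq_mul_sq t (fun m => ‖N.A m ξ - η m‖) fun m => ‖N.A m ζ‖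
  rw [h2] at h4
  rw [← hself] at h3
  have h5 : (‖ξ‖ ^ 2) ^ 2 ≤ (∑ m ∈ t, ‖N.A m ξ - η m‖ * ‖N.A m ζ‖) ^ 2 :=
    pow_le_pow_left₀ (sq_nonneg _) h3 2
  have h6 := mul_lt_mul_of_pos_right hlt (pow_pos hpos 2)
  nlinarith

/-- A finite combination of vectors `A_l* ξ` is carried into `K` by all paths of a sufficiently high
level, namely one that dominates every `d(l)` involved. -/
theorem exists_A_mem_of_mem_span (hN : N.IsDilated) {K : Submodule ℂ N.H}
    (hK : N.IsSubmodule K) {x : N.H}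
    (hx : x ∈ Submodule.span ℂ {x | ∃ l, ∃ ξ ∈ K, star (N.A l) ξ = x}) :
    ∃ n₀ : Fin k → ℕ, ∀ n, n₀ ≤ n → ∀ v, ∀ t ∈ Λ.le v n, N.A t x ∈ K := by
  induction hx using Submodule.span_induction with
  | zero => exact ⟨0, fun n _ v t _ => by rw [map_zero]; exact zero_mem _⟩
  | add x y _ _ hx hy =>
    obtain ⟨n, hn⟩ := hx
    obtain ⟨n', hn'⟩ := hy
    refine ⟨n ⊔ n', fun p hp v t ht => ?_⟩
    rw [map_add]
    exact add_mem (hn p (le_sup_left.trans hp) v t ht) (hn' p (le_sup_right.trans hp) v t ht)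
  | smul c x _ hx =>
    obtain ⟨n, hn⟩ := hx
    refine ⟨n, fun p hp v t ht => ?_⟩
    rw [map_smul]
    exact K.smul_mem c (hn p hp v t ht)
  | mem x hx =>
    obtain ⟨l, ξ, hξ, rfl⟩ := hx
    refine ⟨Λ.deg l, fun n hn v t ht => ?_⟩
    rw [hN.A_star_A_eq_quotOp ht hn]
    exact quotOp_mem hK l t hξ

/-- Approximate `ξ` by a finite combination `x` and take a level whose paths carry `x` into `K`.
With `η_t = A_t x`, the error is `∑ ‖A_t (ξ - x)‖² = ‖A_v (ξ - x)‖² ≤ ‖ξ - x‖²`. -/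
theorem isCompleteSubmodule_of_gen_eq_top (hN : N.IsDilated) {K : Submodule ℂ N.H}
    (hK : N.IsSubmodule K) (h : N.gen K = ⊤) : N.IsCompleteSubmodule K := by
  refine ⟨hK, fun ε hε v ξ hξ => ?_⟩
  have hmem : ξ ∈ closure (Submodule.span ℂ {x | ∃ l, ∃ ξ ∈ K, star (N.A l) ξ = x} : Set N.H) := by
    have : ξ ∈ N.gen K := by rw [h]; trivial
    exact this
  obtain ⟨x, hx, hdist⟩ := Metric.mem_closure_iff.1 hmem ε hε
  obtain ⟨n, hn⟩ := hN.exists_A_mem_of_mem_span hK hx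
  refine ⟨Λ.le v n, isTree_le v n, fun t => N.A t x, fun t ht => hn n le_rfl v t ht, ?_⟩
  simp only [← map_sub]
  rw [N.tree_sum_norm_sq (isTree_le v n)]
  refine pow_lt_pow_left₀ ?_ (norm_nonneg _) two_ne_zero
  rw [dist_eq_norm] at hdist
  exact (N.norm_A_vert_le v _).trans_lt hdist

theorem starProjection_gen_orthogonal_comm (hN : N.IsDilated) {K : Submodule ℂ N.H}
    (hK : N.IsSubmodule K) (l : Λ.Path) (x : N.H) :
    (N.gen K)ᗮ.starProjection (N.A l x) = N.A l ((N.gen K)ᗮ.starProjection x) := by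
  have : CompleteSpace (N.gen K) := (isClosed_gen K).completeSpace_coe
  refine starProjection_apply_comm
    (apply_mem_orthogonal fun y hy => star_A_mem_gen_of_mem_gen l hy)
    (apply_mem_orthogonal fun y hy => ?_) x
  rw [star_star]
  exact hN.A_mem_gen hK l hy

/-- Following `ι` by the projection onto the complement of the subspace generated by `K` gives a
morphism that kills the preimage of `K`. If it were nonzero, there would be a nonzero submodule
orthogonal to its kernel, and thus inside the residual subspace. So the image of `ι` lies in what
`K` generates. -/
theorem gen_eq_top_of_isResidual (hN : N.IsDilated) {M : Λ.Mod} [FiniteDimensional ℂ M.H]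
    (ι : M ⟶ N) {K : Submodule ℂ N.H} (hK : N.IsSubmodule K)
    (h : N.gen (LinearMap.range ι.f.toLinearMap) = ⊤)
    (hres : M.IsResidual (K.comap ι.f.toLinearMap)ᗮ) : N.gen K = ⊤ := by
  have : CompleteSpace (N.gen K) := (isClosed_gen K).completeSpace_coe
  let θ : M ⟶ N :=
    { f := (N.gen K)ᗮ.starProjection ∘L ι.f
      comm := fun l => ContinuousLinearMap.ext fun ξ => by
        change (N.gen K)ᗮ.starProjection (ι.f (M.A l ξ)) =
          N.A l ((N.gen K)ᗮ.starProjection (ι.f ξ))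
        rw [Hom.apply_A, hN.starProjection_gen_orthogonal_comm hK] }
  have hθ : θ.f = 0 := by
    by_contra hne
    obtain ⟨E, hE, hE0, hker⟩ := exists_isSubmodule_orthogonal_ker θ hne
    refine hE0 (hres.2 E hE (hker.trans (Submodule.orthogonal_le fun ξ hξ => ?_)))
    change (N.gen K)ᗮ.starProjection (ι.f ξ) = 0
    exact (Submodule.starProjection_apply_eq_zero_iff _).2
      (Submodule.le_orthogonal_orthogonal _ (le_gen K hξ))
  rw [eq_top_iff, ← h]
  refine gen_le (isClosed_gen K) ?_
  rintro l _ ⟨ξ, rfl⟩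
  refine star_A_mem_gen_of_mem_gen l ?_
  have h1 : (N.gen K)ᗮ.starProjection (ι.f ξ) = 0 := DFunLike.congr_fun hθ ξ
  rw [Submodule.starProjection_apply_eq_zero_iff, Submodule.orthogonal_orthogonal] at h1
  exact h1

/-- As long as the submodule is not full, it has a nonzero residual subspace `Qᗮ`, and `Q` still
generates. The dimension drops strictly, so the process ends at a full submodule. -/
theorem exists_isFull_of_gen_eq_top (hN : N.IsDilated) {K : Submodule ℂ N.H}
    (hK : N.IsSubmodule K) [FiniteDimensional ℂ K] (h : N.gen K = ⊤) :
    ∃ (K' : Submodule ℂ N.H) (hK' : N.IsSubmodule K'), FiniteDimensional ℂ K' ∧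
      N.gen K' = ⊤ ∧ (N.restrict K' hK').IsFull := by
  induction hd : Module.finrank ℂ K using Nat.strong_induction_on generalizing K with
  | _ d ih =>
  by_cases hfull : (N.restrict K hK).IsFull
  · exact ⟨K, hK, inferInstance, h, hfull⟩
  simp only [IsFull, not_forall] at hfull
  obtain ⟨Z, hZ, hZ0⟩ := hfull
  obtain ⟨Q, hQ, rfl⟩ := hZ.1
  have : FiniteDimensional ℂ (N.restrict K hK).H := inferInstanceAs (FiniteDimensional ℂ K)
  set K' : Submodule ℂ N.H := Submodule.map (N.incl K hK).f.toLinearMap Q with hK'def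
  have hK' : N.IsSubmodule K' := isSubmodule_map (N.incl K hK) hQ
  have hcomap : Submodule.comap (N.incl K hK).f.toLinearMap K' = Q :=
    Submodule.comap_map_eq_of_injective K.injective_subtype Q
  have hle : K' ≤ K := by
    rintro _ ⟨ξ, _, rfl⟩
    exact Subtype.property (p := (· ∈ K)) ξ
  have hgen : N.gen K' = ⊤ := by
    refine hN.gen_eq_top_of_isResidual (N.incl K hK) hK' ?_ ?_
    · have hr : LinearMap.range (N.incl K hK).f.toLinearMap = K := K.range_subtype
      rw [hr, h]
    · rw [hcomap]
      exact hZ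
  have hlt : K' < K := by
    refine lt_of_le_of_ne hle fun heq => hZ0 ?_
    have : Q = ⊤ := by
      rw [← hcomap, heq]
      exact Submodule.comap_subtype_self K
    rw [this]
    exact Submodule.top_orthogonal_eq_bot
  have : FiniteDimensional ℂ K' := Submodule.finiteDimensional_of_le hle
  exact ih _ (hd ▸ Submodule.finrank_lt_finrank_of_lt hlt) hK' hgen rfl

end IsDilated

end Mod
end KGraph

namespace KGraph
open CategoryTheory UniformSpace

variable {k : ℕ} {Λ : KGraph.{u} k} [Λ.RowFinite]

/-! ### Isomorphisms and morphisms of representations -/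

/-- The inverse is bounded by the open mapping theorem, and it intertwines automatically. -/
theorem Mod.isIso_of_bijective {M N : Λ.Mod} (θ : M ⟶ N) (h : Function.Bijective θ.f) :
    IsIso θ := by
  let e := ContinuousLinearEquiv.ofBijective θ.f (LinearMap.ker_eq_bot.2 h.1)
    (LinearMap.range_eq_top.2 h.2)
  have he : ∀ ξ, e ξ = θ.f ξ := fun _ => rfl
  refine ⟨⟨e.symm.toContinuousLinearMap, fun l => ContinuousLinearMap.ext fun ξ => ?_⟩,
    Mod.Hom.ext (ContinuousLinearMap.ext fun ξ => e.symm_apply_apply ξ),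
    Mod.Hom.ext (ContinuousLinearMap.ext fun ξ => e.apply_symm_apply ξ)⟩
  refine e.injective ?_
  change e (e.symm (N.A l ξ)) = e (M.A l (e.symm ξ))
  rw [e.apply_symm_apply, he, Mod.Hom.apply_A, ← he, e.apply_symm_apply]

theorem Rep.Hom.apply_π {L K : Λ.Rep} (θ : L ⟶ K) (b : Λ.OAlg) (ξ : L.H) :
    θ.f (L.π b ξ) = K.π b (θ.f ξ) :=
  DFunLike.congr_fun (θ.comm b) ξ

theorem Rep.Hom.apply_X {L K : Λ.Rep} (θ : L ⟶ K) (l : Λ.Path) (ξ : L.H) :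
    θ.f (L.X l ξ) = K.X l (θ.f ξ) :=
  θ.apply_π (Λ.x l) ξ

theorem Rep.isIso_of_bijective {L K : Λ.Rep} (θ : L ⟶ K) (h : Function.Bijective θ.f) :
    IsIso θ := by
  let e := ContinuousLinearEquiv.ofBijective θ.f (LinearMap.ker_eq_bot.2 h.1)
    (LinearMap.range_eq_top.2 h.2)
  have he : ∀ ξ, e ξ = θ.f ξ := fun _ => rfl
  refine ⟨⟨e.symm.toContinuousLinearMap, fun b => ContinuousLinearMap.ext fun ξ => ?_⟩,
    Rep.Hom.ext (ContinuousLinearMap.ext fun ξ => e.symm_apply_apply ξ),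
    Rep.Hom.ext (ContinuousLinearMap.ext fun ξ => e.apply_symm_apply ξ)⟩
  refine e.injective ?_
  change e (e.symm (K.π b ξ)) = e (L.π b (e.symm ξ))
  rw [e.apply_symm_apply, he, Rep.Hom.apply_π, ← he, e.apply_symm_apply]

/-- The principle is carried over from the ambient product of operator algebras. Since `𝒪_Λ` is
closed there, the closed condition `p` remains closed when viewed in the product. -/
theorem OAlg.induction {p : Λ.OAlg → Prop} (hc : IsClosed {b | p b}) (hx : ∀ l, p (Λ.x l))
    (h0 : p 0) (ha : ∀ b c, p b → p c → p (b + c)) (hm : ∀ b c, p b → p c → p (b * c))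
    (hsm : ∀ (z : ℂ) b, p b → p (z • b)) (hst : ∀ b, p b → p (star b)) (b : Λ.OAlg) : p b := by
  have hemb : Topology.IsClosedEmbedding (Subtype.val :
      OpProd.gen (fun i : Λ.OIndex => i.H) (Set.range Λ.oGen) →
        OpProd (fun i : Λ.OIndex => i.H)) :=
    IsClosed.isClosedEmbedding_subtypeVal (NonUnitalStarSubalgebra.isClosed_topologicalClosure _)
  have key : ∃ c : Λ.OAlg, c.1 = b.1 ∧ p c := by
    refine OpProd.gen_induction (p := fun g => ∃ c : Λ.OAlg, c.1 = g ∧ p c) ?_ ?_ ?_ ?_ ?_ ?_ ?_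
      b.2
    · have h1 : {g | ∃ c : Λ.OAlg, c.1 = g ∧ p c} = Subtype.val '' {b : Λ.OAlg | p b} := by
        ext g
        exact ⟨fun ⟨c, h1, h2⟩ => ⟨c, h2, h1⟩, fun ⟨c, h1, h2⟩ => ⟨c, h2, h1⟩⟩
      rw [h1]
      exact hemb.isClosedMap _ hc
    · rintro _ ⟨l, rfl⟩
      exact ⟨Λ.x l, rfl, hx l⟩
    · exact ⟨0, rfl, h0⟩
    · rintro _ _ ⟨c, rfl, h1⟩ ⟨d, rfl, h2⟩
      exact ⟨c + d, rfl, ha c d h1 h2⟩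
    · rintro _ _ ⟨c, rfl, h1⟩ ⟨d, rfl, h2⟩
      exact ⟨c * d, rfl, hm c d h1 h2⟩
    · rintro z _ ⟨c, rfl, h1⟩
      exact ⟨z • c, rfl, hsm z c h1⟩
    · rintro _ ⟨c, rfl, h1⟩
      exact ⟨star c, rfl, hst c h1⟩
  obtain ⟨c, hc, hcp⟩ := key
  rwa [← (Subtype.ext hc : c = b)]

theorem Rep.continuous_π (L : Λ.Rep) : Continuous L.π :=
  AddMonoidHomClass.continuous_of_bound L.π 1 fun b => by
    rw [one_mul]; exact NonUnitalStarAlgHom.norm_apply_le L.π b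

/-- An operator that intertwines the generators and their adjoints intertwines the actions. -/
theorem Rep.comm_of_generators {L K : Λ.Rep} (f : L.H →L[ℂ] K.H)
    (h : ∀ l, f ∘L L.X l = K.X l ∘L f) (h' : ∀ l, f ∘L star (L.X l) = star (K.X l) ∘L f)
    (b : Λ.OAlg) : f ∘L L.π b = K.π b ∘L f := by
  have hL := L.continuous_π
  have hK := K.continuous_π
  -- The adjoint relation is carried along, because intertwining `b` alone says nothing about `star
  -- b`, and the inductive property must be stable under `star`.
  refine (OAlg.induction (p := fun b => f ∘L L.π b = K.π b ∘L f ∧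
    f ∘L star (L.π b) = star (K.π b) ∘L f) ?_ ?_ ?_ ?_ ?_ ?_ ?_ b).1
  · refine (isClosed_eq ?_ ?_).inter (isClosed_eq ?_ ?_)
    · exact continuous_const.clm_comp hL
    · exact hK.clm_comp continuous_const
    · exact continuous_const.clm_comp (continuous_star.comp hL)
    · exact (continuous_star.comp hK).clm_comp continuous_const
  · exact fun l => ⟨h l, h' l⟩
  · rw [map_zero, map_zero, star_zero, star_zero, ContinuousLinearMap.comp_zero,
      ContinuousLinearMap.zero_comp]
    exact ⟨rfl, rfl⟩
  · rintro c d ⟨h1, h2⟩ ⟨h3, h4⟩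
    simp only [map_add, star_add, ContinuousLinearMap.comp_add, ContinuousLinearMap.add_comp, h1,
      h2, h3, h4, and_self]
  · rintro c d ⟨h1, h2⟩ ⟨h3, h4⟩
    simp only [map_mul, star_mul]
    simp only [ContinuousLinearMap.mul_def]
    constructor
    · rw [← ContinuousLinearMap.comp_assoc, h1, ContinuousLinearMap.comp_assoc, h3,
        ContinuousLinearMap.comp_assoc]
    · rw [← ContinuousLinearMap.comp_assoc, h4, ContinuousLinearMap.comp_assoc, h2,
        ContinuousLinearMap.comp_assoc]
  · rintro z c ⟨h1, h2⟩
    simp only [map_smul, star_smul, ContinuousLinearMap.comp_smul, ContinuousLinearMap.smul_comp,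
      h1, h2, and_self]
  · rintro c ⟨h1, h2⟩
    simp only [map_star, star_star]
    exact ⟨h2, h1⟩

variable [Λ.LocallyConvex]

theorem star_U_A (L : Λ.Rep) (l : Λ.Path) : star (((U Λ).obj L).A l) = L.X l :=
  star_star (L.X l)

theorem isDilated_U (L : Λ.Rep) : ((U Λ).obj L).IsDilated := by
  have h : (fun l => star (((U Λ).obj L).A l)) = L.X := funext (star_U_A L)
  rw [Mod.IsDilated, h]
  exact L.isOFamily

namespace Mod

/-! ### The canonical isometry from the dilation of a dilated module -/

section counit

variable (N : Λ.Mod)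

/-- The map `(l, ξ) ↦ A_l* ξ`. -/
noncomputable def evalPre : N.PreL →ₗ[ℂ] N.H :=
  Finsupp.lsum (M := N.H) ℂ fun l => (star (N.A l) : N.H →L[ℂ] N.H).toLinearMap

theorem evalPre_br (l : Λ.Path) (ξ : N.H) : N.evalPre (PreL.br l ξ) = star (N.A l) ξ :=
  Finsupp.lsum_single (R := ℂ) (S := ℂ) (M := N.H) (N := N.H) _ l ξ

variable {N}

/-- Parseval over the level `d(l) + d(m)` turns `⟨A_l* ξ, A_m* η⟩` into the sum of `⟨A_t A_l* ξ, A_t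
A_m* η⟩`. By `A_star_A_eq_quotOp` this is the sum defining the inner product of `[l, ξ]` and `[m,
η]`. -/
theorem IsDilated.inner_evalPre (hN : N.IsDilated) (f g : N.PreL) :
    inner ℂ (N.evalPre f) (N.evalPre g) = inner ℂ f g := by
  refine PreL.sesq_ext (B := fun f g => inner ℂ (N.evalPre f) (N.evalPre g))
    (B' := fun f g => inner ℂ f g) ?_ ?_ ?_ ?_ ?_ f g
  · intro g; simp
  · intro f; simp
  · intro f f' g h h'; simp only [map_add, inner_add_left, h, h']
  · intro f g g' h h'; simp only [map_add, inner_add_right, h, h']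
  · intro l ξ m η
    rw [evalPre_br, evalPre_br, PreL.inner_br, brInner, ← A_vert_rng_star_A_apply,
      ← N.tree_sum_inner (isTree_le (Λ.rng l) (Λ.deg l + Λ.deg m))]
    refine Finset.sum_congr rfl fun t ht => ?_
    rw [hN.A_star_A_eq_quotOp ht (fun i => Nat.le_add_right _ _),
      hN.A_star_A_eq_quotOp ht (fun i => Nat.le_add_left _ _)]

theorem IsDilated.norm_evalPre (hN : N.IsDilated) (f : N.PreL) : ‖N.evalPre f‖ = ‖f‖ := by
  have h := hN.inner_evalPre f f
  rw [← sq_eq_sq₀ (norm_nonneg _) (norm_nonneg _), ← inner_self_eq_norm_sq (𝕜 := ℂ),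
    ← inner_self_eq_norm_sq (𝕜 := ℂ), h]

/-- The canonical map `[l, ξ] ↦ A_l* ξ` from the dilation of a dilated module. -/
noncomputable def IsDilated.counit (hN : N.IsDilated) : N.Dil →L[ℂ] N.H :=
  (LinearMap.mkContinuous N.evalPre 1 fun f => by
    rw [one_mul]; exact (hN.norm_evalPre f).le).fromCompletion

theorem IsDilated.counit_coe (hN : N.IsDilated) (f : N.PreL) :
    hN.counit (f : Completion N.PreL) = N.evalPre f :=
  ContinuousLinearMap.fromCompletion_apply_coe _ f

theorem IsDilated.counit_cls (hN : N.IsDilated) (l : Λ.Path) (ξ : N.H) :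
    hN.counit (cls l ξ) = star (N.A l) ξ := by
  rw [cls, counit_coe, evalPre_br]

theorem IsDilated.norm_counit (hN : N.IsDilated) (x : N.Dil) : ‖hN.counit x‖ = ‖x‖ := by
  refine Completion.induction_on x (isClosed_eq hN.counit.continuous.norm continuous_norm)
    fun f => ?_
  rw [counit_coe, Completion.norm_coe, hN.norm_evalPre]

end counit

/-- The squared norm of a sum of decorated paths is the sum of the squared norms of its components
at a common level, and `θ` acts on each component separately. -/
theorem norm_dilMap {M N : Λ.Mod} (θ : M ⟶ N) (hθ : ∀ ξ, ‖θ.f ξ‖ = ‖ξ‖) (x : M.Dil) :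
    ‖dilMap θ x‖ = ‖x‖ := by
  refine Completion.induction_on x
    (isClosed_eq (dilMap θ).continuous.norm continuous_norm) fun f => ?_
  rw [dilMap, ContinuousLinearMap.completion_apply_coe, PreL.mapL_apply, Completion.norm_coe,
    Completion.norm_coe, ← sq_eq_sq₀ (norm_nonneg _) (norm_nonneg _)]
  obtain ⟨R, n, hf⟩ := PreL.exists_supp f
  have hf' : (PreL.map θ f).Supp R n := fun l hl =>
    hf l (Finsupp.support_mapRange (M := M.H) (N := N.H) (hf := map_zero θ.f) hl)
  rw [PreL.norm_sq_eq hf, PreL.norm_sq_eq hf']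
  simp only [PreL.ext_map, hθ]

/-! ### The embedding of a finite-dimensional module into its dilation -/

section unit

variable (M : Λ.Mod)

/-- The inner product may be computed at the level `d(l)`. There `l` itself is the only path
starting with `l`, so a single term is left. -/
theorem norm_cls (l : Λ.Path) (ξ : M.H) :
    ‖(cls l ξ : M.Dil)‖ = ‖M.A (Λ.vert (Λ.src l)) ξ‖ := by
  have hvert : Λ.mul l (Λ.vert (Λ.src l)) = l := mul_vert rfl
  have hq : M.quotOp l l = M.A (Λ.vert (Λ.src l)) := by
    have := M.quotOp_mul (l := l) (n := Λ.vert (Λ.src l)) (Λ.rng_vert _).symm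
    rwa [hvert] at this
  rw [cls, Completion.norm_coe, ← sq_eq_sq₀ (norm_nonneg _) (norm_nonneg _),
    ← inner_self_eq_norm_sq (𝕜 := ℂ), PreL.inner_br, M.brInner_eq le_rfl le_rfl,
    Finset.sum_eq_single_of_mem l (self_mem_le l), hq, inner_self_eq_norm_sq]
  intro t ht htl
  rw [M.quotOp_eq_zero, zero_apply, inner_zero_left]
  rintro ⟨c, hc, hct⟩
  exact htl ((isTree_le _ _).eq_of_eq_mul (self_mem_le l) ht hc hct).symm

theorem cls_smul (l : Λ.Path) (c : ℂ) (ξ : M.H) : (cls l (c • ξ) : M.Dil) = c • cls l ξ := by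
  rw [cls, PreL.br_smul, Completion.coe_smul]; rfl

theorem cls_zero (l : Λ.Path) : (cls l (0 : M.H) : M.Dil) = 0 := by
  rw [← norm_eq_zero, norm_cls, map_zero, norm_zero]

theorem cls_vert_of_ne {v w : Λ.Vertex} (h : v ≠ w) (ξ : M.H) :
    (cls (Λ.vert v) (M.A (Λ.vert w) ξ) : M.Dil) = 0 := by
  rw [← norm_eq_zero, norm_cls, Λ.src_vert, M.A_vert_of_ne h, norm_zero]

variable [FiniteDimensional ℂ M.H]

/-- The canonical map `ξ ↦ ∑ [v, ξ]` from a finite-dimensional module to its dilation. -/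
noncomputable def unitL : M.H →L[ℂ] M.Dil :=
  LinearMap.toContinuousLinearMap
    { toFun := fun ξ => ∑ v ∈ M.finite_vert.toFinset, cls (Λ.vert v) ξ
      map_add' := fun ξ η => by simp only [cls_add, Finset.sum_add_distrib]
      map_smul' := fun c ξ => by simp only [cls_smul, Finset.smul_sum, RingHom.id_apply] }

theorem unitL_apply (ξ : M.H) :
    M.unitL ξ = ∑ v ∈ M.finite_vert.toFinset, cls (Λ.vert v) ξ := rfl

theorem unitL_of_vert (v : Λ.Vertex) (ξ : M.H) :
    M.unitL (M.A (Λ.vert v) ξ) = cls (Λ.vert v) ξ := by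
  rw [unitL_apply]
  by_cases hv : v ∈ M.finite_vert.toFinset
  · rw [Finset.sum_eq_single_of_mem v hv fun w _ hw => M.cls_vert_of_ne hw ξ]
    have := M.cls_vert (Λ.vert v) ξ
    rwa [Λ.src_vert] at this
  · have h0 : M.A (Λ.vert v) = 0 := by simpa using hv
    have h1 : (cls (Λ.vert v) ξ : M.Dil) = 0 := by
      rw [← norm_eq_zero, norm_cls, Λ.src_vert, h0, zero_apply, norm_zero]
    rw [h0, zero_apply, h1]
    exact Finset.sum_eq_zero fun w _ => M.cls_zero _

theorem dilX_vert_unitL (v : Λ.Vertex) (ξ : M.H) :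
    M.dilX (Λ.vert v) (M.unitL ξ) = cls (Λ.vert v) ξ := by
  have h1 : M.dilX (Λ.vert v) (cls (Λ.vert v) ξ) = cls (Λ.vert v) ξ := by
    rw [M.dilX_cls (by rw [Λ.src_vert, Λ.rng_vert]), vert_mul (Λ.rng_vert _).symm]
  have h2 : ∀ w, w ≠ v → M.dilX (Λ.vert v) (cls (Λ.vert w) ξ) = 0 := fun w hw =>
    M.dilX_cls_of_ne (by rw [Λ.src_vert, Λ.rng_vert]; exact hw.symm) ξ
  rw [unitL_apply, map_sum]
  by_cases hv : v ∈ M.finite_vert.toFinset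
  · rw [Finset.sum_eq_single_of_mem v hv fun w _ hw => h2 w hw, h1]
  · have h0 : M.A (Λ.vert v) = 0 := by simpa using hv
    have h3 : (cls (Λ.vert v) ξ : M.Dil) = 0 := by
      rw [← norm_eq_zero, norm_cls, Λ.src_vert, h0, zero_apply, norm_zero]
    rw [h3]
    exact Finset.sum_eq_zero fun w hw => h2 w fun h => hv (h ▸ hw)

theorem dilX_unitL (l : Λ.Path) (ξ : M.H) : M.dilX l (M.unitL ξ) = cls l ξ := by
  have h : M.dilX l = M.dilX l * M.dilX (Λ.vert (Λ.src l)) := by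
    rw [M.dilX_mul (Λ.rng_vert _).symm, mul_vert rfl]
  rw [h, mul_apply_eq_comp, dilX_vert_unitL, M.dilX_cls (Λ.rng_vert _).symm, mul_vert rfl]

/-- Up to terms killed by `X_l*`, the image of `ξ` is `[r(l), ξ] = ∑ [a, A_a ξ]` over `r(l)Λ^{≤
d(l)}`. Applying `X_l*` leaves the term `a = l`, which becomes `[s(l), A_l ξ]`. -/
theorem star_dilX_unitL (l : Λ.Path) (ξ : M.H) :
    star (M.dilX l) (M.unitL ξ) = M.unitL (M.A l ξ) := by
  rw [star_dilX_eq, mul_apply_eq_comp, dilX_vert_unitL, M.cls_expand _ (Λ.deg l), map_sum,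
    Λ.src_vert, Finset.sum_eq_single_of_mem l (self_mem_le l)]
  · rw [vert_mul rfl]
    have h := M.star_dilX_cls (m := l) (l := Λ.vert (Λ.src l)) (Λ.rng_vert _).symm (M.A l ξ)
    rw [mul_vert rfl] at h
    rw [h, ← unitL_of_vert, A_vert_src_apply]
  · intro a ha hal
    rw [vert_mul (mem_le.1 ha).1.symm]
    refine M.star_dilX_cls_of_not ha le_rfl ?_ _
    rintro ⟨c, hc, hca⟩
    exact hal ((isTree_le _ _).eq_of_eq_mul (self_mem_le l) ha hc hca).symm

/-- Applying `X_v` to the image of `ξ` recovers `[v, ξ]`, whose norm is `‖A_v ξ‖`. -/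
theorem unitL_injective : Function.Injective M.unitL := by
  rw [injective_iff_map_eq_zero]
  intro ξ hξ
  refine M.eq_zero_of_A_vert fun v => ?_
  have h := M.dilX_vert_unitL v ξ
  rw [hξ, map_zero] at h
  rw [← norm_eq_zero, ← Λ.src_vert v, ← norm_cls, ← h, norm_zero]

/-- The canonical embedding of a finite-dimensional module into its dilation. -/
noncomputable def unit : M ⟶ (U Λ).obj ((Pyth Λ).obj M) where
  f := M.unitL
  comm l := ContinuousLinearMap.ext fun ξ => (M.star_dilX_unitL l ξ).symm

/-- Each `[l, ξ]` is `X_l` applied to the image of `ξ`, and these classes span a dense subspace of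
the dilation. -/
theorem gen_range_unit :
    ((U Λ).obj ((Pyth Λ).obj M)).gen (LinearMap.range M.unit.f.toLinearMap) = ⊤ := by
  rw [eq_top_iff]
  intro x _
  let V : Submodule ℂ M.Dil :=
    ((U Λ).obj ((Pyth Λ).obj M)).gen (LinearMap.range M.unit.f.toLinearMap)
  have hV : IsClosed (V : Set M.Dil) := isClosed_gen (N := (U Λ).obj ((Pyth Λ).obj M)) _
  refine dil_induction (p := fun x : M.Dil => x ∈ V) x hV V.zero_mem
    (fun x y hx hy => V.add_mem hx hy) fun l ξ => ?_
  have h1 := star_A_mem_gen (N := (U Λ).obj ((Pyth Λ).obj M))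
    (K := LinearMap.range M.unit.f.toLinearMap) ⟨ξ, rfl⟩ l
  rw [star_U_A] at h1
  have h2 : M.dilX l (M.unitL ξ) = cls l ξ := M.dilX_unitL l ξ
  rw [← h2]
  exact h1

end unit
end Mod
end KGraph

namespace KGraph
open CategoryTheory

variable {k : ℕ} {Λ : KGraph.{u} k} [Λ.RowFinite] [Λ.LocallyConvex]

/-! ### The counit -/

/-- Write `A_{r(l)} ξ = ∑ A_t* A_t ξ` over the level of `l`, move `f` past the adjoints and apply
`A_l` in `N`. Orthogonality within the level, needed in the target only, leaves the term `t = l`,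
which is `f (A_l ξ)`. -/
theorem Mod.IsDilated.comm_of_star_comm {M N : Λ.Mod} (hN : N.IsDilated)
    (f : M.H →L[ℂ] N.H) (h : ∀ l ξ, f (star (M.A l) ξ) = star (N.A l) (f ξ)) (l : Λ.Path)
    (ξ : M.H) : f (M.A l ξ) = N.A l (f ξ) := by
  have hv : ∀ v ζ, f (M.A (Λ.vert v) ζ) = N.A (Λ.vert v) (f ζ) := fun v ζ => by
    have := h (Λ.vert v) ζ
    rwa [M.star_A_vert, N.star_A_vert] at this
  rw [← N.A_vert_rng_apply, ← hv, ← M.star_A_vert,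
    M.star_A_expand (Λ.vert (Λ.rng l)) (Λ.deg l), map_sum, map_sum, Λ.src_vert,
    Finset.sum_eq_single_of_mem l (self_mem_le l)]
  · rw [vert_mul rfl, h, hN.A_star_A, ← hv, M.A_vert_src_apply]
  · intro t ht htl
    rw [vert_mul (mem_le.1 ht).1.symm, h, hN.A_star_A_of_ne ht (self_mem_le l) htl.symm]

/-- The canonical morphism `Π(U L) → L`, `[l, ξ] ↦ X_l ξ`. -/
noncomputable def Rep.counit (L : Λ.Rep) : (Pyth Λ).obj ((U Λ).obj L) ⟶ L where
  f := (isDilated_U L).counit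
  comm := by
    have h : ∀ (m : Λ.Path) (x : ((U Λ).obj L).Dil),
        (isDilated_U L).counit (((U Λ).obj L).dilX m x) =
          star (((U Λ).obj L).A m) ((isDilated_U L).counit x) := fun m x => by
      have h1 : (isDilated_U L).counit ∘L ((U Λ).obj L).dilX m =
          star (((U Λ).obj L).A m) ∘L (isDilated_U L).counit := by
        refine Mod.dil_ext fun l ξ => ?_
        rw [ContinuousLinearMap.comp_apply, ContinuousLinearMap.comp_apply,
          Mod.IsDilated.counit_cls]
        by_cases hml : Λ.src m = Λ.rng l
        · rw [Mod.dilX_cls _ hml, Mod.IsDilated.counit_cls, Mod.star_A_mul_apply _ hml]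
        · rw [Mod.dilX_cls_of_ne _ hml, map_zero, Mod.star_A_mul_of_ne _ hml]
      exact DFunLike.congr_fun h1 x
    refine Rep.comm_of_generators _ (fun l => ContinuousLinearMap.ext fun x => ?_)
      (fun l => ContinuousLinearMap.ext fun x => ?_)
    · refine (h l x).trans ?_
      rw [star_U_A]
      rfl
    · exact Mod.IsDilated.comm_of_star_comm (M := (U Λ).obj ((Pyth Λ).obj ((U Λ).obj L)))
        (isDilated_U L) (isDilated_U L).counit (fun m x => by
          rw [star_U_A]
          exact h m x) l x

/-- The morphism `Π(M) → L`, `[l, ξ] ↦ X_l θ(ξ)`, induced by `θ : M → U L`. -/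
noncomputable def Rep.lift {M : Λ.Mod} {L : Λ.Rep} (θ : M ⟶ (U Λ).obj L) :
    (Pyth Λ).obj M ⟶ L :=
  (Pyth Λ).map θ ≫ L.counit

theorem Rep.lift_cls {M : Λ.Mod} {L : Λ.Rep} (θ : M ⟶ (U Λ).obj L) (l : Λ.Path) (ξ : M.H) :
    (Rep.lift θ).f (Mod.cls l ξ) = L.X l (θ.f ξ) := by
  change (isDilated_U L).counit (Mod.dilMap θ (Mod.cls l ξ)) = _
  rw [Mod.dilMap_cls, Mod.IsDilated.counit_cls, star_U_A]
  rfl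

/-- The lift is an isometry, being composed of two isometries, so its range is closed. The range
contains every `X_l θ(ξ)`, and these generate. -/
theorem Rep.isIso_lift {M : Λ.Mod} {L : Λ.Rep} (θ : M ⟶ (U Λ).obj L)
    (hθ : ∀ ξ, ‖θ.f ξ‖ = ‖ξ‖)
    (hgen : ((U Λ).obj L).gen (LinearMap.range θ.f.toLinearMap) = ⊤) : IsIso (Rep.lift θ) := by
  have hnorm : ∀ x, ‖(Rep.lift θ).f x‖ = ‖x‖ := fun x => by
    change ‖(isDilated_U L).counit (Mod.dilMap θ x)‖ = ‖x‖
    rw [Mod.IsDilated.norm_counit]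
    exact Mod.norm_dilMap θ hθ x
  have hiso : Isometry (Rep.lift θ).f := AddMonoidHomClass.isometry_of_norm _ hnorm
  refine Rep.isIso_of_bijective _ ⟨hiso.injective, ?_⟩
  let V : Submodule ℂ ((U Λ).obj L).H := LinearMap.range (Rep.lift θ).f.toLinearMap
  have hV : IsClosed (V : Set ((U Λ).obj L).H) := hiso.isClosedEmbedding.isClosed_range
  have hle := Mod.gen_le (K := LinearMap.range θ.f.toLinearMap) hV (by
    rintro l _ ⟨ξ, rfl⟩
    rw [star_U_A]
    exact ⟨Mod.cls l ξ, Rep.lift_cls θ l ξ⟩)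
  rw [hgen] at hle
  intro y
  exact hle (trivial : y ∈ (⊤ : Submodule ℂ ((U Λ).obj L).H))

/-! ### The smallest complete submodule -/

/-- The vectors carried by `φ` into the subspace generated by the image of `V` form a closed
subspace containing every `X_l ξ` with `ξ ∈ V`, hence everything; surjectivity concludes. -/
theorem gen_map_eq_top {L K : Λ.Rep} (φ : L ⟶ K) (hφ : Function.Surjective φ.f)
    {V : Submodule ℂ ((U Λ).obj L).H} (hV : ((U Λ).obj L).gen V = ⊤) :
    ((U Λ).obj K).gen (V.map ((U Λ).map φ).f.toLinearMap) = ⊤ := by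
  set W := ((U Λ).obj K).gen (V.map ((U Λ).map φ).f.toLinearMap) with hW
  have hle : ((U Λ).obj L).gen V ≤ W.comap ((U Λ).map φ).f.toLinearMap := by
    refine Mod.gen_le ((Mod.isClosed_gen _).preimage ((U Λ).map φ).f.continuous)
      fun l ξ hξ => ?_
    have h1 : ((U Λ).map φ).f (star (((U Λ).obj L).A l) ξ) =
        star (((U Λ).obj K).A l) (((U Λ).map φ).f ξ) := by
      rw [star_U_A, star_U_A]
      exact φ.apply_X l ξ
    change ((U Λ).map φ).f (star (((U Λ).obj L).A l) ξ) ∈ W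
    rw [h1]
    exact Mod.star_A_mem_gen (Submodule.mem_map_of_mem hξ) l
  rw [hV] at hle
  rw [eq_top_iff]
  intro y _
  obtain ⟨x, hx⟩ := hφ y
  have h2 : ((U Λ).map φ).f x ∈ W := hle (trivial : x ∈ (⊤ : Submodule ℂ ((U Λ).obj L).H))
  have h3 : ((U Λ).map φ).f x = y := hx
  rwa [h3] at h2

/-- Transport the canonical copy of `M` in `Π(M)` to `L`. It is finite dimensional and generating,
and can be shrunk to a full submodule. -/
theorem Rep.HasFinitePDim.exists_isFull {L : Λ.Rep} (hL : L.HasFinitePDim) :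
    ∃ (V : Submodule ℂ ((U Λ).obj L).H) (hV : ((U Λ).obj L).IsSubmodule V),
      FiniteDimensional ℂ V ∧ ((U Λ).obj L).gen V = ⊤ ∧ (((U Λ).obj L).restrict V hV).IsFull := by
  obtain ⟨M, hM, ⟨i⟩⟩ := hL
  have hsurj : Function.Surjective i.inv.f := fun y =>
    ⟨i.hom.f y, DFunLike.congr_fun (congrArg Rep.Hom.f i.hom_inv_id) y⟩
  have hg := gen_map_eq_top i.inv hsurj M.gen_range_unit
  have hsub : ((U Λ).obj ((Pyth Λ).obj M)).IsSubmodule (LinearMap.range M.unit.f.toLinearMap) := by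
    rw [LinearMap.range_eq_map]
    exact Mod.isSubmodule_map M.unit M.isSubmodule_top
  exact (isDilated_U L).exists_isFull_of_gen_eq_top (Mod.isSubmodule_map _ hsub) hg

/-- A generating submodule is complete. If it is also full and finite dimensional, its inclusion
takes values in every complete submodule, so it is the smallest one. -/
theorem Rep.HasFinitePDim.smallest_spec {L : Λ.Rep} (hL : L.HasFinitePDim) :
    IsLeast {K | ((U Λ).obj L).IsCompleteSubmodule K} ((U Λ).obj L).smallest ∧
    (((U Λ).obj L).restrict _ ((U Λ).obj L).smallest_isSubmodule).IsFull ∧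
    FiniteDimensional ℂ (((U Λ).obj L).restrict _ ((U Λ).obj L).smallest_isSubmodule).H := by
  obtain ⟨V, hV, hfd, hgen, hfull⟩ := hL.exists_isFull
  have : FiniteDimensional ℂ (((U Λ).obj L).restrict V hV).H := hfd
  have hleast : IsLeast {K | ((U Λ).obj L).IsCompleteSubmodule K} V := by
    refine ⟨(isDilated_U L).isCompleteSubmodule_of_gen_eq_top hV hgen, fun C hC ξ hξ => ?_⟩
    exact Mod.IsCompleteSubmodule.map_mem_of_isFull hfull (((U Λ).obj L).incl V hV) hC ⟨ξ, hξ⟩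
  obtain rfl := Mod.smallest_eq hleast
  exact ⟨hleast, hfull, hfd⟩

theorem sigmaWellDefined (Λ : KGraph.{u} k) [Λ.RowFinite] [Λ.LocallyConvex] :
    Λ.SigmaWellDefined where
  isLeast _ hL := hL.smallest_spec.1
  full _ hL := hL.smallest_spec.2.1
  finiteDimensional _ hL := hL.smallest_spec.2.2
  map_mem L K θ hL hK ξ hξ := by
    have := hL.smallest_spec.2.2
    -- The composite `Σ(L) → L → K` starts at a full finite-dimensional module, hence lands in the
    -- complete submodule `Σ(K)`.
    exact Mod.IsCompleteSubmodule.map_mem_of_isFull hL.smallest_spec.2.1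
      (((U Λ).obj L).incl _ ((U Λ).obj L).smallest_isSubmodule ≫ (U Λ).map θ)
      hK.smallest_spec.1.1 ⟨ξ, hξ⟩

end KGraph

namespace KGraph
open CategoryTheory

variable {k : ℕ} {Λ : KGraph.{u} k} [Λ.RowFinite] [Λ.LocallyConvex]

/-! ### Irreducibility -/

theorem Rep.π_mem_of_generators (L : Λ.Rep) {W : Submodule ℂ L.H} (hW : IsClosed (W : Set L.H))
    (h : ∀ l, ∀ ξ ∈ W, L.X l ξ ∈ W) (h' : ∀ l, ∀ ξ ∈ W, star (L.X l) ξ ∈ W) (b : Λ.OAlg) :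
    ∀ ξ ∈ W, L.π b ξ ∈ W := by
  have hc : ∀ ξ, Continuous fun b => L.π b ξ := fun ξ =>
    (ContinuousLinearMap.apply ℂ L.H ξ).continuous.comp L.continuous_π
  have hc' : ∀ ξ, Continuous fun b => star (L.π b) ξ := fun ξ =>
    (ContinuousLinearMap.apply ℂ L.H ξ).continuous.comp (continuous_star.comp L.continuous_π)
  refine fun ξ hξ => (OAlg.induction (p := fun b => ∀ ξ ∈ W, L.π b ξ ∈ W ∧ star (L.π b) ξ ∈ W)
    ?_ ?_ ?_ ?_ ?_ ?_ ?_ b ξ hξ).1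
  · simp only [Set.ofPred_forall, Set.ofPred_and]
    exact isClosed_iInter fun ξ => isClosed_iInter fun _ =>
      (hW.preimage (hc ξ)).inter (hW.preimage (hc' ξ))
  · exact fun l ξ hξ => ⟨h l ξ hξ, h' l ξ hξ⟩
  · intro ξ _
    rw [map_zero, star_zero, zero_apply]
    exact ⟨zero_mem _, zero_mem _⟩
  · intro b c hb hc ξ hξ
    rw [map_add, star_add, add_apply, add_apply]
    exact ⟨add_mem (hb ξ hξ).1 (hc ξ hξ).1, add_mem (hb ξ hξ).2 (hc ξ hξ).2⟩
  · intro b c hb hc ξ hξ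
    rw [map_mul, star_mul, mul_apply_eq_comp, mul_apply_eq_comp]
    exact ⟨(hb _ (hc ξ hξ).1).1, (hc _ (hb ξ hξ).2).2⟩
  · intro z b hb ξ hξ
    rw [map_smul, star_smul]
    exact ⟨W.smul_mem _ (hb ξ hξ).1, W.smul_mem _ (hb ξ hξ).2⟩
  · intro b hb ξ hξ
    rw [map_star, star_star]
    exact ⟨(hb ξ hξ).2, (hb ξ hξ).1⟩

/-- The projection onto `W` commutes with the action, so following `θ` by it gives a morphism `ψ`,
whose kernel is `0` or `M`. In the second case the image of `θ` lies in `Wᗮ`, in the first it turns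
out to lie in `W`; that image generates `N`. -/
theorem Mod.IsDilated.eq_bot_or_eq_top_of_isIrreducible {M N : Λ.Mod} (hN : N.IsDilated)
    [FiniteDimensional ℂ M.H] (hfull : M.IsFull) (hM : M.IsIrreducible) (θ : M ⟶ N)
    (hgen : N.gen (LinearMap.range θ.f.toLinearMap) = ⊤) {W : Submodule ℂ N.H}
    (hW : IsClosed (W : Set N.H)) (h : ∀ l, ∀ ξ ∈ W, N.A l ξ ∈ W)
    (h' : ∀ l, ∀ ξ ∈ W, star (N.A l) ξ ∈ W) : W = ⊥ ∨ W = ⊤ := by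
  have : CompleteSpace W := hW.completeSpace_coe
  have hsub : N.IsSubmodule (LinearMap.range θ.f.toLinearMap) := by
    rw [LinearMap.range_eq_map]
    exact isSubmodule_map θ M.isSubmodule_top
  have hcomp := hN.isCompleteSubmodule_of_gen_eq_top hsub hgen
  let ψ : M ⟶ N :=
    { f := W.starProjection ∘L θ.f
      comm := fun l => ContinuousLinearMap.ext fun ξ => by
        change W.starProjection (θ.f (M.A l ξ)) = N.A l (W.starProjection (θ.f ξ))
        rw [Hom.apply_A, starProjection_apply_comm (h l) (h' l)] }
  rcases hM.2 _ (isSubmodule_ker ψ) with hker | hker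
  · right
    rw [eq_top_iff, ← hgen]
    refine gen_le hW ?_
    rintro l _ ⟨ξ, rfl⟩
    refine h' l _ ?_
    -- Fullness forces `ψ` to take values in the range of `θ`, so the projection of `θ ξ` is some `θ
    -- ζ`. Then `ψ (ξ - ζ) = 0`, and injectivity of `ψ` gives `ξ = ζ`, hence `θ ξ ∈ W`.
    obtain ⟨ζ, hζ⟩ := hcomp.map_mem_of_isFull hfull ψ ξ
    have hζ' : θ.f ζ = W.starProjection (θ.f ξ) := hζ
    have h1 : ξ - ζ ∈ LinearMap.ker ψ.f.toLinearMap := by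
      change W.starProjection (θ.f (ξ - ζ)) = 0
      rw [map_sub, map_sub, hζ', Submodule.starProjection_eq_self_iff.2
        (Submodule.starProjection_apply_mem _ _), sub_self]
    rw [hker, Submodule.mem_bot, sub_eq_zero] at h1
    change θ.f ξ ∈ W
    rw [h1, hζ']
    exact Submodule.starProjection_apply_mem _ _
  · left
    rw [← Submodule.orthogonal_orthogonal W, Submodule.orthogonal_eq_bot_iff, eq_top_iff, ← hgen]
    refine gen_le (Submodule.isClosed_orthogonal W) ?_
    rintro l _ ⟨ξ, rfl⟩
    refine apply_mem_orthogonal (by rw [star_star]; exact h l) _ ?_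
    have h1 : ξ ∈ LinearMap.ker ψ.f.toLinearMap := by rw [hker]; trivial
    exact (Submodule.starProjection_apply_eq_zero_iff W).1 h1

theorem Rep.isIrreducible_iff {M : Λ.Mod} {L : Λ.Rep} [FiniteDimensional ℂ M.H]
    (hfull : M.IsFull) (θ : M ⟶ (U Λ).obj L) (hθ : Function.Injective θ.f)
    (hgen : ((U Λ).obj L).gen (LinearMap.range θ.f.toLinearMap) = ⊤) :
    M.IsIrreducible ↔ L.IsIrreducible := by
  constructor
  · intro hM
    have := hM.1
    refine ⟨hθ.nontrivial, fun W hW h => ?_⟩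
    refine (isDilated_U L).eq_bot_or_eq_top_of_isIrreducible hfull hM θ hgen hW
      (fun l ξ hξ => ?_) (fun l ξ hξ => ?_)
    · have := h (star (Λ.x l)) ξ hξ
      rw [map_star] at this
      exact this
    · rw [star_U_A]
      exact h (Λ.x l) ξ hξ
  · rintro ⟨hnt, hL⟩
    refine ⟨?_, fun K hK => ?_⟩
    · by_contra hn
      rw [not_nontrivial_iff_subsingleton] at hn
      have h1 : ((U Λ).obj L).gen (LinearMap.range θ.f.toLinearMap) ≤ ⊥ := by
        refine Mod.gen_le isClosed_singleton ?_
        rintro l _ ⟨ξ, rfl⟩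
        rw [Subsingleton.elim ξ 0, map_zero, map_zero]
        exact zero_mem _
      rw [hgen] at h1
      obtain ⟨x, hx⟩ := exists_ne (0 : L.H)
      exact hx (h1 (trivial : x ∈ (⊤ : Submodule ℂ ((U Λ).obj L).H)))
    · have hmap := Mod.isSubmodule_map θ hK
      have hinj : Function.Injective θ.f.toLinearMap := hθ
      -- The image of a submodule `K` generates an invariant subspace of `L`. If this is `0`, then
      -- `K = 0`; if it is all of `L`, the image of `K` is complete, so by fullness it contains the
      -- image of `M`, and `K = M` by injectivity.
      rcases hL (((U Λ).obj L).gen (K.map θ.f.toLinearMap)) (Mod.isClosed_gen _)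
        (L.π_mem_of_generators (Mod.isClosed_gen _) (fun l ξ hξ => by
          have := Mod.star_A_mem_gen_of_mem_gen l hξ
          rw [star_U_A] at this
          exact this) fun l ξ hξ => (isDilated_U L).A_mem_gen hmap l hξ) with h1 | h1
      · left
        have h2 : K.map θ.f.toLinearMap = ⊥ :=
          le_bot_iff.1 ((Mod.le_gen (K.map θ.f.toLinearMap)).trans_eq h1)
        exact Submodule.map_injective_of_injective hinj (h2.trans (Submodule.map_bot _).symm)
      · right
        rw [eq_top_iff]
        intro ξ _
        obtain ⟨ζ, hζ, hζξ⟩ := ((isDilated_U L).isCompleteSubmodule_of_gen_eq_top hmap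
          h1).map_mem_of_isFull hfull θ ξ
        rwa [← hinj hζξ]

/-! ### The equivalence -/

/-- A morphism with values in a submodule. -/
noncomputable def Mod.codRestrict {M N : Λ.Mod} (θ : M ⟶ N) {K : Submodule ℂ N.H}
    (hK : N.IsSubmodule K) (h : ∀ ξ, θ.f ξ ∈ K) : M ⟶ N.restrict K hK where
  f := θ.f.codRestrict K h
  comm l := ContinuousLinearMap.ext fun ξ => Subtype.ext (Mod.Hom.apply_A θ l ξ)

theorem Mod.unit_mem_smallest {M : Λ.Mod} (hM : Λ.fullFd M) (ξ : M.H) :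
    haveI := hM.2
    M.unit.f ξ ∈ ((U Λ).obj ((Pyth Λ).obj M)).smallest :=
  haveI := hM.2
  Mod.IsCompleteSubmodule.map_mem_of_isFull hM.1 M.unit
    ((sigmaWellDefined Λ).isLeast _ ⟨M, hM.2, ⟨Iso.refl _⟩⟩).1 ξ

/-- The unit `M → Σ(Π(M))`. -/
noncomputable def Mod.unitSigma {M : Λ.Mod} (hM : Λ.fullFd M) :
    M ⟶ ((U Λ).obj ((Pyth Λ).obj M)).restrict _
      ((U Λ).obj ((Pyth Λ).obj M)).smallest_isSubmodule :=
  haveI := hM.2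
  Mod.codRestrict M.unit _ (Mod.unit_mem_smallest hM)

/-- For surjectivity: the image of `M` in `Π(M)` generates, so it is a complete submodule and
contains the smallest one. -/
theorem Mod.isIso_unitSigma {M : Λ.Mod} (hM : Λ.fullFd M) : IsIso (Mod.unitSigma hM) := by
  have := hM.2
  refine Mod.isIso_of_bijective _ ⟨fun ξ η h => M.unitL_injective (congrArg Subtype.val h), ?_⟩
  rintro ⟨y, hy⟩
  have hsub : ((U Λ).obj ((Pyth Λ).obj M)).IsSubmodule (LinearMap.range M.unit.f.toLinearMap) := by
    rw [LinearMap.range_eq_map]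
    exact Mod.isSubmodule_map M.unit M.isSubmodule_top
  have hle := ((sigmaWellDefined Λ).isLeast _ ⟨M, hM.2, ⟨Iso.refl _⟩⟩).2
    ((isDilated_U _).isCompleteSubmodule_of_gen_eq_top hsub M.gen_range_unit)
  obtain ⟨ξ, hξ⟩ := hle hy
  exact ⟨ξ, Subtype.ext hξ⟩

/-- The sums defining the two embeddings run over different finite sets of vertices, so the two
vectors are compared after applying each vertex projection, where both become `[v, θ ξ]`. -/
theorem Mod.unitL_naturality {M N : Λ.Mod} [FiniteDimensional ℂ M.H] [FiniteDimensional ℂ N.H]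
    (θ : M ⟶ N) (ξ : M.H) : N.unitL (θ.f ξ) = Mod.dilMap θ (M.unitL ξ) := by
  refine ((U Λ).obj ((Pyth Λ).obj N)).ext_of_A_vert fun v => ?_
  have h : ∀ x : N.Dil, ((U Λ).obj ((Pyth Λ).obj N)).A (Λ.vert v) x = N.dilX (Λ.vert v) x :=
    fun x => DFunLike.congr_fun (N.dilX_vert_proj v).isSelfAdjoint.star_eq x
  refine (h _).trans (Eq.trans ?_ (h _).symm)
  rw [Mod.dilX_vert_unitL, ← ContinuousLinearMap.comp_apply, ← Mod.dilMap_comm,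
    ContinuousLinearMap.comp_apply, Mod.dilX_vert_unitL, Mod.dilMap_cls]

theorem Rep.lift_naturality {L K : Λ.Rep} (φ : L ⟶ K) {M N : Λ.Mod} (θ : M ⟶ N)
    (α : M ⟶ (U Λ).obj L) (β : N ⟶ (U Λ).obj K) (h : ∀ ξ, β.f (θ.f ξ) = φ.f (α.f ξ)) :
    (Pyth Λ).map θ ≫ Rep.lift β = Rep.lift α ≫ φ := by
  refine Rep.Hom.ext (Mod.dil_ext fun l ξ => ?_)
  have h1 : (Rep.lift β).f (Mod.dilMap θ (Mod.cls l ξ)) = K.X l (β.f (θ.f ξ)) := by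
    rw [Mod.dilMap_cls]
    exact Rep.lift_cls β l _
  have h2 : φ.f ((Rep.lift α).f (Mod.cls l ξ)) = K.X l (φ.f (α.f ξ)) := by
    rw [Rep.lift_cls]
    exact φ.apply_X l _
  exact h1.trans ((congrArg (K.X l) (h ξ)).trans h2.symm)

/-- The inclusion of the smallest complete submodule. -/
noncomputable def Rep.inclSmallest (L : Λ.Rep) :
    ((U Λ).obj L).restrict _ ((U Λ).obj L).smallest_isSubmodule ⟶ (U Λ).obj L :=
  ((U Λ).obj L).incl _ ((U Λ).obj L).smallest_isSubmodule

theorem Rep.HasFinitePDim.gen_range_inclSmallest {L : Λ.Rep} (hL : L.HasFinitePDim) :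
    ((U Λ).obj L).gen (LinearMap.range L.inclSmallest.f.toLinearMap) = ⊤ := by
  have h : LinearMap.range L.inclSmallest.f.toLinearMap = ((U Λ).obj L).smallest :=
    Submodule.range_subtype _
  rw [h]
  exact Mod.IsDilated.gen_eq_top_of_isCompleteSubmodule hL.smallest_spec.1.1

theorem Rep.HasFinitePDim.isIso_lift_inclSmallest {L : Λ.Rep} (hL : L.HasFinitePDim) :
    IsIso (Rep.lift L.inclSmallest) :=
  Rep.isIso_lift _ (fun _ => rfl) hL.gen_range_inclSmallest

/-- `Π` and `Σ` as an equivalence of categories. -/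
noncomputable def pythSigmaEquivalence (Λ : KGraph.{u} k) [Λ.RowFinite] [Λ.LocallyConvex] :
    Λ.ModFullFd ≌ Λ.RepPFd :=
  -- Two natural isomorphisms are enough: `Equivalence.mk` adjusts the unit to obtain the triangle
  -- identity and leaves both functors unchanged.
  CategoryTheory.Equivalence.mk Λ.PythFullFd (KGraph.Sigma (sigmaWellDefined Λ))
    (NatIso.ofComponents
      (fun M => Λ.fullFd.isoMk
        (@asIso _ _ _ _ (Mod.unitSigma M.property) (Mod.isIso_unitSigma M.property)))
      (fun {M N} θ => by
        have := M.property.2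
        have := N.property.2
        refine ObjectProperty.hom_ext _ (Mod.Hom.ext (ContinuousLinearMap.ext fun ξ => ?_))
        exact Subtype.ext (Mod.unitL_naturality θ.hom ξ)))
    (NatIso.ofComponents
      (fun L => Λ.pFd.isoMk
        (@asIso _ _ _ _ (Rep.lift L.obj.inclSmallest) L.property.isIso_lift_inclSmallest))
      (fun {L K} φ => by
        refine ObjectProperty.hom_ext _ ?_
        exact Rep.lift_naturality φ.hom
          (((KGraph.Sigma (sigmaWellDefined Λ)).map φ).hom) L.obj.inclSmallest K.obj.inclSmallest
          fun _ => rfl))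

theorem nonempty_iso_obj_iff {C : Type*} [Category C] {P : ObjectProperty C}
    {X Y : P.FullSubcategory} : Nonempty (X.obj ≅ Y.obj) ↔ Nonempty (X ≅ Y) :=
  ⟨fun ⟨i⟩ => ⟨P.isoMk i⟩, fun ⟨i⟩ => ⟨P.ι.mapIso i⟩⟩

theorem nonempty_iso_map_iff {C D : Type*} [Category C] [Category D] (F : C ⥤ D) [F.Full]
    [F.Faithful] {X Y : C} : Nonempty (X ≅ Y) ↔ Nonempty (F.obj X ≅ F.obj Y) :=
  ⟨fun ⟨i⟩ => ⟨F.mapIso i⟩, fun ⟨i⟩ => ⟨F.preimageIso i⟩⟩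

end KGraph

/-! ### Conclusion -/

open CategoryTheory
theorem mainTheorem1 {k : ℕ} (hk : 1 ≤ k) (Λ : KGraph.{u} k) [Λ.RowFinite] [Λ.LocallyConvex] :
    (Λ.PythFullFd.EssSurj ∧ Λ.PythFullFd.Full ∧ Λ.PythFullFd.Faithful) ∧
    ∃ h : Λ.SigmaWellDefined,
      ((KGraph.Sigma h).EssSurj ∧ (KGraph.Sigma h).Full ∧ (KGraph.Sigma h).Faithful) ∧
      (∃ E : Λ.ModFullFd ≌ Λ.RepPFd, E.functor = Λ.PythFullFd ∧ E.inverse = KGraph.Sigma h) ∧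
      (∀ M : Λ.ModFullFd, M.obj.IsIrreducible ↔ (Λ.PythFullFd.obj M).obj.IsIrreducible) ∧
      (∀ L : Λ.RepPFd, L.obj.IsIrreducible ↔ ((KGraph.Sigma h).obj L).obj.IsIrreducible) ∧
      (∀ M N : Λ.ModFullFd, Nonempty (M.obj ≅ N.obj) ↔
        Nonempty ((Λ.PythFullFd.obj M).obj ≅ (Λ.PythFullFd.obj N).obj)) ∧
      (∀ L K : Λ.RepPFd, Nonempty (L.obj ≅ K.obj) ↔
        Nonempty (((KGraph.Sigma h).obj L).obj ≅ ((KGraph.Sigma h).obj K).obj)) := by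
  have hP : Λ.PythFullFd.IsEquivalence := (KGraph.pythSigmaEquivalence Λ).isEquivalence_functor
  have hS : (KGraph.Sigma (KGraph.sigmaWellDefined Λ)).IsEquivalence :=
    (KGraph.pythSigmaEquivalence Λ).isEquivalence_inverse
  refine ⟨⟨hP.essSurj, hP.full, hP.faithful⟩, KGraph.sigmaWellDefined Λ,
    ⟨hS.essSurj, hS.full, hS.faithful⟩, ⟨KGraph.pythSigmaEquivalence Λ, rfl, rfl⟩,
    fun M => ?_, fun L => ?_, fun M N => ?_, fun L K => ?_⟩
  -- Both irreducibility statements are instances of one criterion, applied to the embedding `M →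
  -- Π(M)` here and to the inclusion `Σ(L) → L` next.
  · have := M.property.2
    exact KGraph.Rep.isIrreducible_iff M.property.1 M.obj.unit M.obj.unitL_injective
      M.obj.gen_range_unit
  · have := L.property.smallest_spec.2.2
    exact (KGraph.Rep.isIrreducible_iff L.property.smallest_spec.2.1 L.obj.inclSmallest
      Subtype.val_injective L.property.gen_range_inclSmallest).symm
  · rw [KGraph.nonempty_iso_obj_iff, KGraph.nonempty_iso_obj_iff,
      KGraph.nonempty_iso_map_iff Λ.PythFullFd]
  · rw [KGraph.nonempty_iso_obj_iff, KGraph.nonempty_iso_obj_iff,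
      KGraph.nonempty_iso_map_iff (KGraph.Sigma (KGraph.sigmaWellDefined Λ))]
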